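/- **Regions.** A circle means a circle of positive radius in $\mathbb{R}^2$. An SS-region is a pair $(D,\{S_j\}_{j=1}^l)$ of a non-empty connected open set $D\subset\mathbb{R}^2$ and $l>0$ distinct circles such that $\partial D:=\overline{D}-D\subset\bigcup_j S_j$, each $S_j$ meets $\overline{D}$, two distinct circles of the family are transverse at each common point in $\partial D$, and no point of $\partial D$ lies on three of the circles. A point of $\partial D$ is singular if it lies on exactly two of the circles, or if it lies on exactly one circle and is a critical point of the restriction of $\pi(x_1,x_2)=x_1$ to $\partial D$ near it. The Poincaré-Reeb graph of the SS-region is the quotient space of $\overline{D}$ whose points are the connected components of the sets $\pi^{-1}(t)\cap\overline{D}$; its vertices are the components containing singular points, and its (open) edges are the connected components of the complement of the set of vertices. The vertical Poincaré-Reeb graph is defined in the same way with $x_2$ in place of $x_1$. **MBCC addition.** Choose $p\in\partial D$ which lies on exactly one of the circles and is mapped to a vertex neither of the Poincaré-Reeb graph nor of the vertical one. Add a sufficiently small circle $S_{l+1}$ centered at $p$, and replace $D$ by $D-D_{l+1}$, where $D_{l+1}$ is the closed disk bounded by $S_{l+1}$. **SSCC addition.** Choose two distinct, sufficiently close points $p_1,p_2\in\partial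 D$ which lie on exactly one circle $S_j$ of the family, the same for both, and on a connected arc in $S_j\cap\overline{D}$, and which are mapped into the interior of the same edge of the Poincaré-Reeb graph and into the interior of the same edge of the vertical one. Add a new circle $S_{l+1}$ through $p_1$ and $p_2$. Let $D_j$ and $D_{l+1}$ be the closed disks bounded by $S_j$ and $S_{l+1}$, and let $C$ be the segment from $p_1$ to $p_2$. One of the following is done. * Case A-1: $C\subset\overline{D}$, $C\subset D_j\cap D_{l+1}$, and the area of $D_j\cap D_{l+1}$ is sufficiently small; $D$ is replaced by $D-D_{l+1}$. * Case A-2: $C\subset\overline{D}$, $C$ does not meet $\mathrm{Int}\,D_j-D_{l+1}$, and the area of $D_j-D_{l+1}$ is sufficiently small; $D$ is replaced by $D\cap\mathrm{Int}\,D_{l+1}$. * Case B: $C-\{p_1,p_2\}$ does not meet $\overline{D}$, and the area of $D_{l+1}-D_j$ is sufficiently small; $D$ is replaced by $D-D_{l+1}$. In both kinds of additions the result, with the circles $S_1,\dots,S_{l+1}$, has to be an SS-region again. **The rule.** A graph is a finite connected one-dimensional polyhedron, and a tree is a graph with first Betti number $0$. Take a graph with exactly one edge and two vertices, and add $n_{G_0}\ge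 0$ vertices in its edge; this gives $G_0$. Given $G_j$, for each vertex $v$ of degree $2$ of $G_j$ take a graph $G_{j,v}$ with exactly one edge and two vertices, identify one of its two vertices with $v$, and add $n_{G_{j,v}}\ge 0$ vertices in its edge; this gives $G_{j+1}$. Continue until a graph $G_{j_0}$ without vertices of degree $2$ is reached. The graphs $G_0$ and $G_{j,v}$ are called the pieces of $G_{j_0}$. Each edge $e$ of $G_{j_0}$ lies in exactly one piece; let $j_{0,e}\in\{0,1,2\}$ be the number of vertices of degree $3$ of $G_{j_0}$ incident to $e$. Finally add $n_e\ge 0$ vertices in the interior of each edge $e$ of $G_{j_0}$, where for each piece $P$, with $n_P$ the number of vertices added in its edge, the following holds. * If $n_P=0$, then $n_e$ is even for the edge $e$ in $P$. * If $n_P$ is even and non-zero, then $n_e$ is even and $n_e\ge 2j_{0,e}-1$ for each edge $e$ of $G_{j_0}$ in $P$. * If $n_P$ is odd, then for exactly one edge $e_0$ of $G_{j_0}$ in $P$, which may be chosen arbitrarily, $n_{e_0}$ is odd and $n_{e_0}\ge 2j_{0,e_0}$, and for each other edge $e$ of $G_{j_0}$ in $P$, $n_e$ is even and $n_e\ge 2j_{0,e}$.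 **Theorem.** Every graph $T$ obtained by this rule is a tree, and $T$ is isomorphic to the Poincaré-Reeb graph of an SS-region obtained from the open unit disk with the unit circle by finitely many MBCC and SSCC additions. Here "sufficiently small" and "sufficiently close" may be prescribed in advance: for arbitrary positive bounds for the radius in MBCC additions (depending on the region and $p$), and for the distance $|p_1-p_2|$ (depending on the region and $p_1$) and the area (depending on the region, $p_1$ and $p_2$) in SSCC additions, all of the additions can be chosen to respect these bounds. -/

import Mathlib

open MeasureTheory

noncomputable section

namespace SSRegions

/-! ### Regions surrounded by circles -/

/-- The Euclidean plane. -/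
abbrev Plane : Type := EuclideanSpace ℝ (Fin 2)

/-- A circle is given by its centre and its radius (positivity of the radius is required
where circles are used). -/
abbrev Circ : Type := EuclideanGeometry.Sphere Plane

/-- The tangent line (as a linear subspace) of the circle `S` at its point `p`. -/
def tangentLine (S : Circ) (p : Plane) : Submodule ℝ Plane :=
  (Submodule.span ℝ {p - S.center})ᗮ

/-- The open disk bounded by a circle. -/
def openDisk (S : Circ) : Set Plane := Metric.ball S.center S.radius

/-- The closed disk bounded by a circle. -/
def closedDisk (S : Circ) : Set Plane := Metric.closedBall S.center S.radius

/-- A region surrounded by circles (an SS-region). -/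
structure SSRegion where
  /-- the connected open set `D` -/
  domain : Set Plane
  /-- the finite non-empty set of circles `{S_j}` -/
  circles : Set Circ
  isOpen_domain : IsOpen domain
  isConnected_domain : IsConnected domain
  circles_finite : circles.Finite
  circles_nonempty : circles.Nonempty
  radius_pos : ∀ S ∈ circles, 0 < S.radius
  boundary_subset : closure domain \ domain ⊆ {p | ∃ S ∈ circles, p ∈ S}
  meets : ∀ S ∈ circles, ∃ p ∈ closure domain, p ∈ S
  transverse : ∀ S ∈ circles, ∀ T ∈ circles, S ≠ T → ∀ p ∈ closure domain \ domain,
    p ∈ S → p ∈ T → IsCompl (tangentLine S p) (tangentLine T p)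
  no_triple : ∀ S ∈ circles, ∀ T ∈ circles, ∀ U ∈ circles, S ≠ T → S ≠ U → T ≠ U →
    ∀ p ∈ closure domain \ domain, ¬ (p ∈ S ∧ p ∈ T ∧ p ∈ U)

namespace SSRegion

variable (R : SSRegion)

/-- The boundary of the region. -/
def boundary : Set Plane := closure R.domain \ R.domain

/-- `S` is the only circle of the region through `p`. -/
def OnlyOn (p : Plane) (S : Circ) : Prop :=
  S ∈ R.circles ∧ p ∈ S ∧ ∀ T ∈ R.circles, p ∈ T → T = S

/-- Singular points of the region with respect to the projection to the `i`-th coordinate.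
For `i = 0` these are the singular points used for the Poincaré-Reeb graph, for `i = 1` those
used for the vertical Poincaré-Reeb graph. Near a boundary point lying on exactly one circle `S`
the boundary is an open arc of `S`, so the point is critical for the coordinate if and only if the
coordinate vanishes on the tangent line of `S`. -/
def IsSingular (i : Fin 2) (p : Plane) : Prop :=
  p ∈ R.boundary ∧
    ({S | S ∈ R.circles ∧ p ∈ S}.ncard = 2 ∨
      ∃ S, R.OnlyOn p S ∧ ∀ v ∈ tangentLine S p, v i = 0)

/-- The connected component through `p` of the level set, in the closure of the region, of the
`i`-th coordinate. -/
def levelComponent (i : Fin 2) (p : closure R.domain) : Set Plane :=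
  connectedComponentIn (closure R.domain ∩ {z : Plane | z i = (p : Plane) i}) (p : Plane)

/-- The underlying space of the Poincaré-Reeb graph (`i = 0`) and of the vertical Poincaré-Reeb
graph (`i = 1`): the set of all components of level sets of the `i`-th coordinate on the closure of
the region, as a quotient space of that closure. -/
def ReebSpace (i : Fin 2) : Type := Quotient (Setoid.ker (R.levelComponent i))

instance (i : Fin 2) : TopologicalSpace (R.ReebSpace i) :=
  inferInstanceAs (TopologicalSpace (Quotient (Setoid.ker (R.levelComponent i))))

/-- The quotient map. -/
def toReeb (i : Fin 2) (p : closure R.domain) : R.ReebSpace i :=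
  Quotient.mk (Setoid.ker (R.levelComponent i)) p

/-- The vertices: the components which contain singular points. -/
def reebVertices (i : Fin 2) : Set (R.ReebSpace i) :=
  R.toReeb i '' {p | R.IsSingular i (p : Plane)}

/-- Two points of the closure are mapped to the interior of a same edge, that is, to a same
connected component of the complement of the vertices. -/
def SameEdge (i : Fin 2) (p q : closure R.domain) : Prop :=
  ∃ C : Set (R.ReebSpace i), IsPreconnected C ∧ Disjoint C (R.reebVertices i) ∧
    R.toReeb i p ∈ C ∧ R.toReeb i q ∈ C

end SSRegion

/-- The unit disk with the unit circle. -/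
def unitDisk : SSRegion where
  domain := Metric.ball 0 1
  circles := {⟨0, 1⟩}
  isOpen_domain := Metric.isOpen_ball
  isConnected_domain := (convex_ball (0 : Plane) 1).isConnected ⟨0, by simp⟩
  circles_finite := Set.finite_singleton _
  circles_nonempty := Set.singleton_nonempty _
  radius_pos := by
    rintro S rfl
    exact one_pos
  boundary_subset := by
    rintro p ⟨hp, hp'⟩
    refine ⟨⟨0, 1⟩, rfl, ?_⟩
    rw [closure_ball (0 : Plane) one_ne_zero] at hp
    rw [EuclideanGeometry.mem_sphere]
    rw [Metric.mem_closedBall] at hp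
    rw [Metric.mem_ball, not_lt] at hp'
    exact le_antisymm hp hp'
  meets := by
    rintro S rfl
    refine ⟨EuclideanSpace.single 0 1, ?_, ?_⟩
    · rw [closure_ball (0 : Plane) one_ne_zero]
      simp
    · rw [EuclideanGeometry.mem_sphere]
      simp
  transverse := by
    rintro S rfl T rfl h
    exact absurd rfl h
  no_triple := by
    rintro S rfl T rfl U rfl h
    exact absurd rfl h

/-! ### The two kinds of additions of circles -/

/-- A choice of positive bounds which says how small "sufficiently small" and "sufficiently close"
have to be, in dependence on the region and on the chosen points. -/
structure Smallness where
  /-- bound for the radius of a circle centred at a boundary point -/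
  radius : SSRegion → Plane → ℝ
  /-- bound for the distance of the two end points of a chord, given the first one -/
  length : SSRegion → Plane → ℝ
  /-- bound for the area of the region cut off, given the two end points of a chord -/
  area : SSRegion → Plane → Plane → ℝ
  radius_pos : ∀ R p, 0 < radius R p
  length_pos : ∀ R p, 0 < length R p
  area_pos : ∀ R p q, 0 < area R p q

/-- `R'` is obtained from `R` by an MBCC addition: a small circle `S` centred at a boundary point
`p` is added and the closed disk bounded by `S` is removed. -/
def MBCC (ε : Smallness) (R R' : SSRegion) : Prop :=
  ∃ (p : closure R.domain) (S : Circ),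
    (p : Plane) ∈ R.boundary ∧
    (∃ T, R.OnlyOn p T) ∧
    (∀ i : Fin 2, R.toReeb i p ∉ R.reebVertices i) ∧
    S.center = p ∧ 0 < S.radius ∧ S.radius < ε.radius R p ∧
    S ∉ R.circles ∧
    R'.circles = insert S R.circles ∧
    R'.domain = R.domain \ closedDisk S

/-- Case A-1 for the end points `p`, `q` on the circle `T` and the new circle `S`: the
chord lies in the closure of the region, and in the closure of the lens surrounded by `T` and `S`,
which has small area; the closed disk bounded by `S` is removed. -/
def CaseA1 (ε : Smallness) (R R' : SSRegion) (p q : Plane) (T S : Circ) : Prop :=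
  segment ℝ p q ⊆ closure R.domain ∧
  segment ℝ p q ⊆ closure (openDisk T ∩ openDisk S) ∧
  volume (closure (openDisk T ∩ openDisk S)) < ENNReal.ofReal (ε.area R p q) ∧
  R'.domain = R.domain \ closedDisk S

/-- Case A-2: the chord lies in the closure of the region, and outside the lune surrounded
by `T` and `S` (the part of the disk of `T` outside the disk of `S`), which has small area;
the region is intersected with the disk bounded by `S`. -/
def CaseA2 (ε : Smallness) (R R' : SSRegion) (p q : Plane) (T S : Circ) : Prop :=
  segment ℝ p q ⊆ closure R.domain ∧
  Disjoint (segment ℝ p q) (openDisk T \ closedDisk S) ∧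
  volume (closure (openDisk T \ closedDisk S)) < ENNReal.ofReal (ε.area R p q) ∧
  R'.domain = R.domain ∩ openDisk S

/-- Case B: the chord (without its end points) lies outside the closure of the region, and the lune
surrounded by `T` and `S` (the part of the disk of `S` outside the disk of `T`) has small
area; the closed disk bounded by `S` is removed. -/
def CaseB (ε : Smallness) (R R' : SSRegion) (p q : Plane) (T S : Circ) : Prop :=
  Disjoint (openSegment ℝ p q) (closure R.domain) ∧
  volume (closure (openDisk S \ closedDisk T)) < ENNReal.ofReal (ε.area R p q) ∧
  R'.domain = R.domain \ closedDisk S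

/-- `R'` is obtained from `R` by an SSCC addition: a circle `S` through two close boundary points
`p`, `q` on a same arc of a circle `T` is added. -/
def SSCC (ε : Smallness) (R R' : SSRegion) : Prop :=
  ∃ (p q : closure R.domain) (T S : Circ),
    (p : Plane) ≠ q ∧ (p : Plane) ∈ R.boundary ∧ (q : Plane) ∈ R.boundary ∧
    R.OnlyOn p T ∧ R.OnlyOn q T ∧
    (∃ A : Set Plane, IsConnected A ∧ A ⊆ closure R.domain ∩ {z | z ∈ T} ∧
      (p : Plane) ∈ A ∧ (q : Plane) ∈ A) ∧
    (∀ i : Fin 2, R.SameEdge i p q) ∧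
    dist (p : Plane) q < ε.length R p ∧
    0 < S.radius ∧ (p : Plane) ∈ S ∧ (q : Plane) ∈ S ∧
    S ∉ R.circles ∧
    R'.circles = insert S R.circles ∧
    (CaseA1 ε R R' p q T S ∨ CaseA2 ε R R' p q T S ∨ CaseB ε R R' p q T S)

/-- `R` is obtained from the unit disk by finitely many MBCC and SSCC additions. -/
def Obtainable (ε : Smallness) (R : SSRegion) : Prop :=
  Relation.ReflTransGen (fun R₁ R₂ => MBCC ε R₁ R₂ ∨ SSCC ε R₁ R₂) unitDisk R

/-! ### Finite graphs -/

/-- A finite graph with vertices `V` and edges `E`; the edge `e` joins `src e` and `tgt e`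
(the direction is only a bookkeeping device). -/
structure FGraph where
  V : Type
  E : Type
  src : E → V
  tgt : E → V
  finite_V : Finite V
  finite_E : Finite E

namespace FGraph

variable (G : FGraph)

/-- The degree of a vertex: the number of edges incident to it (a loop counts twice). -/
def degree (v : G.V) : ℕ := Nat.card {e // G.src e = v} + Nat.card {e // G.tgt e = v}

/-- The number of vertices of degree `3` incident to the edge `e`. -/
def cubicEnds (e : G.E) : ℕ :=
  Nat.card {v : G.V // (v = G.src e ∨ v = G.tgt e) ∧ G.degree v = 3}

/-- A tree: a non-empty connected graph whose first Betti number `|E| - |V| + 1` is zero. -/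
def IsTree : Prop :=
  Nonempty G.V ∧
  (∀ u v : G.V, Relation.EqvGen (fun a b => ∃ e, G.src e = a ∧ G.tgt e = b) u v) ∧
  Nat.card G.V = Nat.card G.E + 1

/-- The identifications in the geometric realization: the two ends of the unit interval of the edge
`e` are glued to the two vertices of `e`. -/
inductive Glue : ((Σ _ : G.V, Unit) ⊕ (Σ _ : G.E, unitInterval)) →
    ((Σ _ : G.V, Unit) ⊕ (Σ _ : G.E, unitInterval)) → Prop
  | src (e : G.E) : Glue (Sum.inr ⟨e, 0⟩) (Sum.inl ⟨G.src e, ()⟩)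
  | tgt (e : G.E) : Glue (Sum.inr ⟨e, 1⟩) (Sum.inl ⟨G.tgt e, ()⟩)

/-- The geometric realization, a one-dimensional polyhedron: the discrete space of vertices with one
unit interval glued in for each edge. -/
def Realization : Type := Quot G.Glue

instance : TopologicalSpace G.Realization := inferInstanceAs (TopologicalSpace (Quot G.Glue))

/-- A vertex as a point of the geometric realization. -/
def vertexPoint (v : G.V) : G.Realization := Quot.mk G.Glue (Sum.inl ⟨v, ()⟩)

/-- The graph with exactly one edge and two vertices. -/
def oneEdge : FGraph where
  V := Bool
  E := Unit
  src := fun _ => false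
  tgt := fun _ => true
  finite_V := inferInstance
  finite_E := inferInstance

/-- The graph obtained by adding `n e` vertices in the interior of each edge `e`. -/
def subdivide (n : G.E → ℕ) : FGraph where
  V := G.V ⊕ (Σ e : G.E, Fin (n e))
  E := Σ e : G.E, Fin (n e + 1)
  src := fun x => Fin.cases (motive := fun _ => G.V ⊕ (Σ e : G.E, Fin (n e)))
    (Sum.inl (G.src x.1)) (fun k => Sum.inr ⟨x.1, k⟩) x.2
  tgt := fun x => Fin.lastCases (motive := fun _ => G.V ⊕ (Σ e : G.E, Fin (n e)))
    (Sum.inl (G.tgt x.1)) (fun k => Sum.inr ⟨x.1, k⟩) x.2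
  finite_V := by
    have := G.finite_V
    have := G.finite_E
    infer_instance
  finite_E := by
    have := G.finite_E
    infer_instance

end FGraph

/-- The Poincaré-Reeb graph of the region `R` is (isomorphic to) the graph `T`: there is a
homeomorphism of the underlying spaces which maps the set of vertices onto the set of vertices. -/
def HasPoincareReebGraph (R : SSRegion) (T : FGraph) : Prop :=
  ∃ h : T.Realization ≃ₜ R.ReebSpace 0, h '' Set.range T.vertexPoint = R.reebVertices 0

/-! ### The inductive rule -/

/-- A graph composed of one-edge graphs (pieces): `piece e` is the piece which contains the edge
`e`, and `added P` is the number of vertices which were added in the edge of the piece `P`. -/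
structure PiecedGraph extends FGraph where
  Piece : Type
  piece : E → Piece
  added : Piece → ℕ

namespace PiecedGraph

/-- The starting graph: a graph with exactly one edge, with `n` vertices added in it. -/
def start (n : ℕ) : PiecedGraph where
  toFGraph := FGraph.oneEdge.subdivide (fun _ => n)
  Piece := Unit
  piece := fun _ => ()
  added := fun _ => n

/-- To each vertex `v` of degree `2` a new one-edge graph is attached along one of its two vertices,
with `n v` vertices added in its edge. The new vertices on the piece at `v` are numbered
`0, …, n v` in the order of their distance from `v` (the last one is the other end of the piece),
and the new edge number `k` ends at the new vertex number `k`. -/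
def attach (G : PiecedGraph) (n : {v : G.V // G.degree v = 2} → ℕ) : PiecedGraph where
  V := G.V ⊕ (Σ v : {v : G.V // G.degree v = 2}, Fin (n v + 1))
  E := G.E ⊕ (Σ v : {v : G.V // G.degree v = 2}, Fin (n v + 1))
  src := Sum.elim (fun e => Sum.inl (G.src e)) (fun x =>
    Fin.cases (motive := fun _ => G.V ⊕ (Σ v : {v : G.V // G.degree v = 2}, Fin (n v + 1)))
      (Sum.inl x.1.1) (fun k => Sum.inr ⟨x.1, k.castSucc⟩) x.2)
  tgt := Sum.elim (fun e => Sum.inl (G.tgt e)) (fun x => Sum.inr x)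
  finite_V := by
    have := G.finite_V
    infer_instance
  finite_E := by
    have := G.finite_V
    have := G.finite_E
    infer_instance
  Piece := G.Piece ⊕ {v : G.V // G.degree v = 2}
  piece := Sum.map G.piece (fun x => x.1)
  added := Sum.elim G.added n

/-- The graphs which occur in the inductive procedure. -/
inductive IsStage : PiecedGraph → Prop
  | start (n : ℕ) : IsStage (start n)
  | attach (G : PiecedGraph) (n : {v : G.V // G.degree v = 2} → ℕ) :
      IsStage G → IsStage (G.attach n)

/-- The conditions on the numbers `m e` of vertices finally added to the edges `e` of the graph. -/
def Admissible (G : PiecedGraph) (m : G.E → ℕ) : Prop :=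
  ∀ P : G.Piece,
    (G.added P = 0 → ∀ e, G.piece e = P → Even (m e)) ∧
    (G.added P ≠ 0 → Even (G.added P) →
      ∀ e, G.piece e = P → Even (m e) ∧ 2 * (G.cubicEnds e : ℤ) - 1 ≤ (m e : ℤ)) ∧
    (Odd (G.added P) →
      ∃ e₀, G.piece e₀ = P ∧ Odd (m e₀) ∧ 2 * G.cubicEnds e₀ ≤ m e₀ ∧
        ∀ e, G.piece e = P → e ≠ e₀ → Even (m e) ∧ 2 * G.cubicEnds e ≤ m e)

end PiecedGraph

end SSRegions

end

noncomputable section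
namespace SSRegions

/-! ### Rooted trees grown from a leaf -/

/-! Each kind of addition is used for one elementary change of the graph, and every tree of the rule
grows from a single edge by these two changes.

Geometry. Let all edges be directed by increasing first coordinate. Over an open edge the closure of
the region is a strip between two graphs `lo < hi`. Suppose that the upper boundary falls strictly
along a generic arc of one circle. A new circle through two close points of the arc cuts off a thin
piece; the two points become corners, so the edge receives two vertices of degree 2 (the move
`splitPair`). If instead a small disk centred at a point of the arc is removed, its leftmost point
lies in the interior of the strip, and there the strip divides: the part above the disk ends at the
upper corner, which is a leaf, while the part below the disk continues past the lower corner, which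
is a vertex of degree 2 (the move `fork`). Both can be done in any edge and below any prescribed
bounds (`exists_sscc`, `exists_mbcc`).

The invariant kept along the way is `StripData.IsModel`: the closure of the region is partitioned
into vertical segments, one for each vertex, and strips, one for each edge; the segments are exactly
the cells with singular points; and each strip has a stretch on which its upper boundary falls
strictly. This last condition makes the next move possible, and it passes to all strips which a move
creates. Since the cells at one level are finitely many disjoint closed segments, they are the
components of the level set (`Covers.component_eq`), which identifies the Poincaré-Reeb graph with
the geometric realization (`Covers.homeo`).

Combinatorics. It remains to grow the given tree. Seen from an end vertex of the first piece, a
piece with `n` added vertices is a path through `n` vertices of degree 3, each of which carries a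
branch. The branches come from later stages, so the last stage is treated first
(`Ext.exists_grown`). Subdividing by pairs does not change parities. A fork creates a cubic vertex,
but leaves one extra vertex of degree 2 behind it. For even `n` the forks are made two at a time, so
that both extra vertices land in one edge and all parities are even. For odd `n` one extra vertex
remains, and the order of the moves decides which edge of the path becomes odd (`grown_path`). The
numerical bounds in the rule are needed only to guarantee two vertices in each edge of a piece with
`n ≠ 0` (`Admissible.fits`).

Finally, a directed tree is determined by what is seen from its root edge (`Below.iso`), which turns
the grown tree into the given graph and the growth steps into the two moves
(`isTree_and_buildable`). -/

/-- Rooted trees, described by what happens at the end of their stem: the stem is a leaf edge, it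
ends at a vertex of degree `2`, or it ends at a vertex of degree `3`. -/
inductive Tr : Type
  | leaf : Tr
  | w : Tr → Tr
  | v : Tr → Tr → Tr

namespace Tr

/-- One growth step: two vertices of degree `2` are added in an edge, or a vertex of degree `3`
which carries a new leaf edge, followed by a vertex of degree `2`. -/
inductive Step : Tr → Tr → Prop
  | pair (t : Tr) : Step t (w (w t))
  | fork (t : Tr) : Step t (v leaf (w t))
  | stem {t t' : Tr} : Step t t' → Step (w t) (w t')
  | left {a a' : Tr} (b : Tr) : Step a a' → Step (v a b) (v a' b)
  | right (a : Tr) {b b' : Tr} : Step b b' → Step (v a b) (v a b')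

/-- `t'` arises from `t` by finitely many growth steps. -/
abbrev Steps : Tr → Tr → Prop := Relation.ReflTransGen Step

/-- Trees which arise from a leaf edge. -/
abbrev Grown (t : Tr) : Prop := Steps leaf t

theorem Steps.stem {t t' : Tr} (h : Steps t t') : Steps (w t) (w t') :=
  Relation.ReflTransGen.lift w (fun _ _ => Step.stem) _ _ h

theorem Steps.fork_congr {a a' b b' : Tr} (ha : Steps a a') (hb : Steps b b') :
    Steps (v a b) (v a' b') :=
  (Relation.ReflTransGen.lift (fun x => v x b) (fun _ _ => Step.left b) _ _ ha).trans
    (Relation.ReflTransGen.lift (v a') (fun _ _ => Step.right a') _ _ hb)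

/-- The stem is prolonged by `n` vertices of degree `2`. -/
def wpow : ℕ → Tr → Tr
  | 0, t => t
  | n + 1, t => w (wpow n t)

theorem wpow_add (a b : ℕ) (t : Tr) : wpow (a + b) t = wpow a (wpow b t) := by
  induction a with
  | zero => simp [wpow]
  | succ a ih => rw [Nat.add_right_comm]; simp [wpow, ih]

theorem steps_wpow_of_even {n : ℕ} (hn : Even n) (t : Tr) : Steps t (wpow n t) := by
  obtain ⟨k, rfl⟩ := hn
  induction k with
  | zero => exact .refl
  | succ k ih =>
    have : k + 1 + (k + 1) = 1 + 1 + (k + k) := by omega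
    rw [this, wpow_add]
    exact ih.tail (Step.pair _)

theorem Grown.wpow {t : Tr} (ht : Grown t) {n : ℕ} (hn : Even n) : Grown (wpow n t) :=
  Relation.ReflTransGen.trans ht (steps_wpow_of_even hn t)

/-- The part behind the first edge of a path with `k` vertices of degree `3`, the `j`-th of
which carries the branch `s j`, while the `j`-th edge is subdivided by `m j` vertices. -/
def body (m : ℕ → ℕ) (s : ℕ → Tr) : ℕ → ℕ → Tr
  | _, 0 => leaf
  | i, k + 1 => v (s i) (wpow (m (i + 1)) (body m s (i + 1) k))

/-- The new leaf edge of a fork is itself a place where growth can go on, so it can be replaced by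
any grown branch. The price of a cubic vertex is the single `w` behind it. -/
theorem steps_fork {s : Tr} (hs : Grown s) (X : Tr) : Steps X (v s (w X)) :=
  Relation.ReflTransGen.trans (.single (Step.fork X)) (Steps.fork_congr hs .refl)

/-- The cubic vertices are created in twos, beginning at the far end of the path. The extra vertex
left by one fork is pushed behind the next fork, so each couple of forks spends two vertices of one
edge and leaves the edge between the two forks free of parity defects. -/
theorem grown_body_even (m : ℕ → ℕ) (s : ℕ → Tr) (k i : ℕ)
    (hs : ∀ j, i ≤ j → j < i + 2 * k → Grown (s j))
    (hm : ∀ j, i < j → j ≤ i + 2 * k → Even (m j) ∧ 2 ≤ m j) :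
    Grown (body m s i (2 * k)) := by
  induction k generalizing i with
  | zero => exact .refl
  | succ k ih =>
    have hB := ih (i + 2) (fun j h1 h2 => hs j (by omega) (by omega))
      (fun j h1 h2 => hm j (by omega) (by omega))
    obtain ⟨e1, -⟩ := hm (i + 1) (by omega) (by omega)
    obtain ⟨e2, l2⟩ := hm (i + 2) (by omega) (by omega)
    -- These are the two vertices which the two forks leave behind; this is where the lower bound 2
    -- is needed.
    obtain ⟨c, hc⟩ : ∃ c, m (i + 2) = 1 + (1 + c) := ⟨m (i + 2) - 2, by omega⟩
    have hceven : Even c := by rw [hc] at e2; rw [← add_assoc] at e2; simpa [Nat.even_add] using e2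
    have h2k : 2 * (k + 1) = 2 * k + 1 + 1 := by ring
    rw [h2k]
    simp only [body]
    rw [hc, wpow_add, wpow_add]
    set X := wpow c (body m s (i + 2) (2 * k))
    have hX : Grown X := hB.wpow hceven
    have h1 := steps_fork (hs i (by omega) (by omega)) X
    have h2 := steps_fork (hs (i + 1) (by omega) (by omega)) (w X)
    -- The second fork is made in front of the extra vertex of the first, at `w X`, so that both
    -- extra vertices lie behind it; the edge between the forks is empty and is then filled by
    -- pairs.
    exact hX.trans (h1.trans (Steps.fork_congr .refl (h2.trans (steps_wpow_of_even e1 _))))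

/-- With an odd number of forks one extra vertex has no partner, so exactly one edge is odd. The
stem with its `c` vertices belongs to the statement because this edge may be the stem. If the odd
edge is the stem or the first edge behind it, the remaining even number of forks is covered by
`grown_body_even`; otherwise two forks are split off, and the odd edge moves two places closer. -/
theorem grown_body_odd (m : ℕ → ℕ) (s : ℕ → Tr) (k i c : ℕ)
    (hs : ∀ j, i ≤ j → j < i + (2 * k + 1) → Grown (s j))
    (h2 : ∀ j, i < j → j ≤ i + (2 * k + 1) → 2 ≤ m j)
    (hm : (Odd c ∧ ∀ j, i < j → j ≤ i + (2 * k + 1) → Even (m j)) ∨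
      (Even c ∧ ∃ j₀, i < j₀ ∧ j₀ ≤ i + (2 * k + 1) ∧ Odd (m j₀) ∧
        ∀ j, i < j → j ≤ i + (2 * k + 1) → j ≠ j₀ → Even (m j))) :
    Grown (wpow c (body m s i (2 * k + 1))) := by
  induction k generalizing i c with
  | zero =>
    simp only [Nat.mul_zero, Nat.zero_add] at *
    have hs0 := hs i le_rfl (by omega)
    have h2' := h2 (i + 1) (by omega) (by omega)
    simp only [body]
    rcases hm with ⟨⟨d, rfl⟩, hev⟩ | ⟨hc, j₀, hj, hj', hodd, -⟩
    · have e1 := hev (i + 1) (by omega) (by omega)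
      obtain ⟨b, hb⟩ : ∃ b, m (i + 1) = 1 + (1 + b) := ⟨m (i + 1) - 2, by omega⟩
      have hbe : Even b := by rw [hb] at e1; rw [← add_assoc] at e1; simpa [Nat.even_add] using e1
      rw [hb, wpow_add, wpow_add, wpow_add]
      have hX : Grown (wpow b leaf) := Grown.wpow .refl hbe
      refine Grown.wpow ?_ (even_two_mul d)
      -- A pair is inserted and the fork is made between its two vertices: one vertex stays in the
      -- stem, which becomes odd, and the other joins the extra vertex of the fork behind it.
      exact hX.trans ((Relation.ReflTransGen.single (Step.pair _)).trans
        (Steps.stem (steps_fork hs0 _)))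
    · obtain rfl : j₀ = i + 1 := by omega
      obtain ⟨d, hd⟩ := hodd
      -- The odd vertex of this edge is the one that the fork leaves behind; the other `2 * d` are
      -- there before.
      rw [hd, add_comm, wpow_add]
      refine Grown.wpow ?_ hc
      have hX : Grown (wpow (2 * d) leaf) := Grown.wpow .refl (even_two_mul d)
      exact hX.trans (steps_fork hs0 _)
  | succ k ih =>
    have hs0 := hs i le_rfl (by omega)
    have hs1 := hs (i + 1) (by omega) (by omega)
    have h21 := h2 (i + 1) (by omega) (by omega)
    have h22 := h2 (i + 2) (by omega) (by omega)
    have hbody : ∀ h : (∀ j, i + 1 < j → j ≤ i + (2 * (k + 1) + 1) → Even (m j)),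
        Grown (body m s (i + 1) (2 * (k + 1))) := fun h =>
      grown_body_even m s (k + 1) (i + 1) (fun j a b => hs j (by omega) (by omega))
        (fun j a b => ⟨h j a (by omega), h2 j (by omega) (by omega)⟩)
    rcases hm with ⟨⟨d, rfl⟩, hev⟩ | ⟨hc, j₀, hj, hj', hodd, hev⟩
    · have hB := hbody (fun j a b => hev j (by omega) b)
      have e1 := hev (i + 1) (by omega) (by omega)
      obtain ⟨b, hb⟩ : ∃ b, m (i + 1) = 1 + (1 + b) := ⟨m (i + 1) - 2, by omega⟩
      have hbe : Even b := by rw [hb] at e1; rw [← add_assoc] at e1; simpa [Nat.even_add] using e1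
      rw [body, hb, wpow_add, wpow_add, wpow_add]
      have hX := hB.wpow hbe
      refine Grown.wpow ?_ (even_two_mul d)
      exact hX.trans ((Relation.ReflTransGen.single (Step.pair _)).trans
        (Steps.stem (steps_fork hs0 _)))
    · by_cases hj1 : j₀ = i + 1
      · subst hj1
        have hB := hbody (fun j a b => hev j (by omega) b (by omega))
        obtain ⟨d, hd⟩ := hodd
        rw [body, hd, add_comm, wpow_add]
        refine Grown.wpow ?_ hc
        exact (hB.wpow (even_two_mul d)).trans (steps_fork hs0 _)
      · have e1 := hev (i + 1) (by omega) (by omega) (by omega)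
        obtain ⟨b, hb⟩ : ∃ b, m (i + 2) = 1 + (1 + b) := ⟨m (i + 2) - 2, by omega⟩
        have hX : Grown (wpow b (body m s (i + 2) (2 * k + 1))) := by
          refine ih (i + 2) b (fun j a c => hs j (by omega) (by omega))
            (fun j a c => h2 j (by omega) (by omega)) ?_
          -- After its two vertices are spent on the forks, edge `i + 2` plays the role of the stem
          -- with `b` vertices. If it was the odd edge, `b` is odd; otherwise `b` is even and the
          -- odd edge lies further on.
          by_cases hj2 : j₀ = i + 2
          · left
            subst hj2
            refine ⟨?_, fun j a c => hev j (by omega) (by omega) (by omega)⟩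
            rw [Nat.odd_iff] at hodd ⊢
            omega
          · right
            refine ⟨?_, j₀, by omega, by omega, hodd,
              fun j a c d => hev j (by omega) (by omega) d⟩
            have e2 := hev (i + 2) (by omega) (by omega) (by omega)
            rw [hb, ← add_assoc] at e2
            simpa [Nat.even_add] using e2
        have h2k : 2 * (k + 1) + 1 = 2 * k + 1 + 1 + 1 := by ring
        rw [h2k]
        simp only [body]
        rw [hb, wpow_add, wpow_add]
        refine Grown.wpow ?_ hc
        exact hX.trans ((steps_fork hs0 _).trans
          (Steps.fork_congr .refl ((steps_fork hs1 _).trans (steps_wpow_of_even e1 _))))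

/-- A path whose edges carry the numbers of vertices prescribed by the parity conditions can be
grown. -/
theorem grown_path (m : ℕ → ℕ) (s : ℕ → Tr) (n : ℕ) (hs : ∀ j < n, Grown (s j))
    (h2 : n ≠ 0 → ∀ j ≤ n, 2 ≤ m j) (hev : Even n → ∀ j ≤ n, Even (m j))
    (hodd : Odd n → ∃ j₀ ≤ n, Odd (m j₀) ∧ ∀ j ≤ n, j ≠ j₀ → Even (m j)) :
    Grown (wpow (m 0) (body m s 0 n)) := by
  rcases Nat.even_or_odd n with hn | hn
  · have hm := hev hn
    refine Grown.wpow ?_ (hm 0 (Nat.zero_le _))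
    obtain ⟨k, rfl⟩ := hn
    rw [← two_mul] at *
    exact grown_body_even m s k 0 (fun j _ h => hs j (by omega))
      (fun j _ h => ⟨hm j (by omega), h2 (by omega) j (by omega)⟩)
  · obtain ⟨j₀, hj, ho, he⟩ := hodd hn
    obtain ⟨k, rfl⟩ := hn
    refine grown_body_odd m s k 0 (m 0) (fun j _ h => hs j (by omega))
      (fun j _ h => h2 (by omega) j (by omega)) ?_
    by_cases h0 : j₀ = 0
    · subst h0
      exact Or.inl ⟨ho, fun j a b => he j (by omega) (by omega)⟩
    · exact Or.inr ⟨he 0 (by omega) (by omega), j₀, by omega, by omega, ho,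
        fun j a b c => he j (by omega) c⟩

end Tr

/-! ### Rooted forests given by a parent function -/

/-- Finitely many edges, each of which starts at the end of its parent edge or at the root. -/
structure RF where
  P : Type
  par : P → Option P
  fin : Finite P

namespace RF

/-- The graph with the edges `P`, each of which joins the end of its parent to its own end. -/
abbrev graph (A : RF) : FGraph where
  V := Option A.P
  E := A.P
  src := A.par
  tgt := some
  finite_V := by have := A.fin; infer_instance
  finite_E := A.fin

/-- A new edge below the root. -/
def stem (A : RF) : RF where
  P := Option A.P
  par := fun o => o.elim none (fun p => some (A.par p))
  fin := by have := A.fin; infer_instance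

/-- A new edge below the common root of two forests. -/
def join (A B : RF) : RF where
  P := Option (A.P ⊕ B.P)
  par := fun o => o.elim none (Sum.elim (fun p => some ((A.par p).map Sum.inl))
    (fun p => some ((B.par p).map Sum.inr)))
  fin := by have := A.fin; have := B.fin; infer_instance

/-- `B` arises from `A` by cutting the edge `e` into three pieces (the second one is `n₂`, the
first one `n₁`), and by adding leaf edges at the end of `n₁`. -/
structure Grow (X : Type) (A B : RF) where
  e : A.P
  ι : A.P → B.P
  n₁ : B.P
  n₂ : B.P
  l : X → B.P
  inj : Function.Injective (Sum.elim ι (Sum.elim (fun b : Bool => cond b n₁ n₂) l))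
  surj : Function.Surjective (Sum.elim ι (Sum.elim (fun b : Bool => cond b n₁ n₂) l))
  par_n₁ : B.par n₁ = (A.par e).map ι
  par_n₂ : B.par n₂ = some n₁
  par_e : B.par (ι e) = some n₂
  par_l : ∀ x, B.par (l x) = some n₁
  par_ι : ∀ p, p ≠ e → B.par (ι p) = (A.par p).map ι

/-- Growing commutes with prolonging the stem. -/
def Grow.stem {X : Type} {A B : RF} (g : Grow X A B) : Grow X A.stem B.stem where
  e := some g.e
  ι := Option.map g.ι
  n₁ := some g.n₁
  n₂ := some g.n₂
  l := fun x => some (g.l x)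
  inj := by
    intro a b h
    have := @g.inj
    rcases a with (_ | a) | a | a <;> rcases b with (_ | b) | b | b <;>
      simp_all [Function.Injective, RF.stem] <;> (try cases a) <;> (try cases b) <;> (try simp_all) <;>
      grind
  surj := by
    rintro (_ | b)
    · exact ⟨.inl none, rfl⟩
    · obtain ⟨a, rfl⟩ := g.surj b
      rcases a with a | (_ | _) | a
      · exact ⟨.inl (some a), rfl⟩
      · exact ⟨.inr (.inl false), rfl⟩
      · exact ⟨.inr (.inl true), rfl⟩
      · exact ⟨.inr (.inr a), rfl⟩
  par_n₁ := by simp [RF.stem, g.par_n₁]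
  par_n₂ := by simp [RF.stem, g.par_n₂]
  par_e := by simp [RF.stem, g.par_e]
  par_l := by simp [RF.stem, g.par_l]
  par_ι := by
    rintro (_ | p) hp
    · simp [RF.stem]
    · have : p ≠ g.e := fun h => hp (by rw [h])
      simp [RF.stem, g.par_ι p this]

/-- Growing commutes with joining. -/
def Grow.left {X : Type} {A B : RF} (g : Grow X A B) (C : RF) :
    Grow X (A.join C) (B.join C) where
  e := some (.inl g.e)
  ι := Option.map (Sum.map g.ι id)
  n₁ := some (.inl g.n₁)
  n₂ := some (.inl g.n₂)
  l := fun x => some (.inl (g.l x))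
  inj := by
    intro a b h
    have := @g.inj
    rcases a with (_ | a | a) | a | a <;> rcases b with (_ | b | b) | b | b <;>
      simp_all [Function.Injective, RF.join] <;> (try cases a) <;> (try cases b) <;> (try simp_all) <;>
      grind
  surj := by
    rintro (_ | b | b)
    · exact ⟨.inl none, rfl⟩
    · obtain ⟨a, rfl⟩ := g.surj b
      rcases a with a | (_ | _) | a
      · exact ⟨.inl (some (.inl a)), rfl⟩
      · exact ⟨.inr (.inl false), rfl⟩
      · exact ⟨.inr (.inl true), rfl⟩
      · exact ⟨.inr (.inr a), rfl⟩
    · exact ⟨.inl (some (.inr b)), rfl⟩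
  par_n₁ := by
    simp only [RF.join, Option.elim, Sum.elim_inl, g.par_n₁]
    cases A.par g.e <;> simp
  par_n₂ := by simp [RF.join, g.par_n₂]
  par_e := by simp [RF.join, g.par_e]
  par_l := by simp [RF.join, g.par_l]
  par_ι := by
    rintro (_ | p | p) hp
    · simp [RF.join]
    · have : p ≠ g.e := fun h => hp (by rw [h])
      simp only [RF.join, Option.elim, Option.map, Sum.map_inl, Sum.elim_inl, g.par_ι p this]
      cases A.par p <;> simp
    · simp only [RF.join, Option.elim, Option.map_some, Sum.map_inr, Sum.elim_inr]
      cases hq : C.par p <;> simp [hq]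

/-- The two branches of a join may be exchanged. -/
def Grow.right {X : Type} {A B : RF} (g : Grow X A B) (C : RF) :
    Grow X (C.join A) (C.join B) where
  e := some (.inr g.e)
  ι := Option.map (Sum.map id g.ι)
  n₁ := some (.inr g.n₁)
  n₂ := some (.inr g.n₂)
  l := fun x => some (.inr (g.l x))
  inj := by
    intro a b h
    have := @g.inj
    rcases a with (_ | a | a) | a | a <;> rcases b with (_ | b | b) | b | b <;>
      simp_all [Function.Injective, RF.join] <;> (try cases a) <;> (try cases b) <;> (try simp_all) <;>
      grind
  surj := by
    rintro (_ | b | b)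
    · exact ⟨.inl none, rfl⟩
    · exact ⟨.inl (some (.inl b)), rfl⟩
    · obtain ⟨a, rfl⟩ := g.surj b
      rcases a with a | (_ | _) | a
      · exact ⟨.inl (some (.inr a)), rfl⟩
      · exact ⟨.inr (.inl false), rfl⟩
      · exact ⟨.inr (.inl true), rfl⟩
      · exact ⟨.inr (.inr a), rfl⟩
  par_n₁ := by
    simp only [RF.join, Option.elim, Sum.elim_inr, g.par_n₁]
    cases A.par g.e <;> simp
  par_n₂ := by simp [RF.join, g.par_n₂]
  par_e := by simp [RF.join, g.par_e]
  par_l := by simp [RF.join, g.par_l]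
  par_ι := by
    rintro (_ | p | p) hp
    · simp [RF.join]
    · simp only [RF.join, Option.elim, Option.map_some, Sum.map_inl, Sum.elim_inl]
      cases hq : C.par p <;> simp [hq]
    · have : p ≠ g.e := fun h => hp (by rw [h])
      simp only [RF.join, Option.elim, Option.map, Sum.map_inr, Sum.elim_inr, g.par_ι p this]
      cases A.par p <;> simp

end RF

/-- The forest of the edges of a tree. -/
def Tr.rf : Tr → RF
  | .leaf => ⟨Unit, fun _ => none, inferInstance⟩
  | .w t => t.rf.stem
  | .v a b => a.rf.join b.rf

/-- The stem is the unique edge at the root. It is the edge that the basic steps `pair` and `fork`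
cut. -/
theorem Tr.exists_root (t : Tr) : ∃ r : t.rf.P, ∀ p, t.rf.par p = none ↔ p = r := by
  cases t with
  | leaf => exact ⟨(), fun p => ⟨fun _ => rfl, fun _ => rfl⟩⟩
  | w t => exact ⟨none, by rintro (_ | p) <;> simp [Tr.rf, RF.stem]⟩
  | v a b => exact ⟨none, by rintro (_ | p | p) <;> simp [Tr.rf, RF.join]⟩

/-- A basic step puts `t` behind two new edges, so the stem of `t` becomes the last of the three
pieces into which it is cut. `Empty` and `Unit` index the leaf edges that come with a pair and with
a fork; the other steps are transported by the congruences of `Grow`. -/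
theorem Tr.Step.grow {t t' : Tr} (h : Tr.Step t t') :
    Nonempty (RF.Grow Empty t.rf t'.rf) ∨ Nonempty (RF.Grow Unit t.rf t'.rf) := by
  induction h with
  | pair t =>
    obtain ⟨r, hr⟩ := t.exists_root
    have hr0 := (hr r).2 rfl
    refine .inl ⟨⟨r, fun p => some (some p), none, some none, Empty.elim, ?_, ?_, ?_, rfl, ?_,
      fun x => x.elim, ?_⟩⟩
    · rintro (a | (_ | _) | a) (b | (_ | _) | b) h <;>
        first
        | exact Empty.elim ‹Empty›
        | exact congrArg Sum.inl (Option.some.inj (Option.some.inj h))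
        | simp_all [Tr.rf, RF.stem]
    · rintro (_ | _ | b)
      exacts [⟨.inr (.inl true), rfl⟩, ⟨.inr (.inl false), rfl⟩, ⟨.inl b, rfl⟩]
    · rw [hr0]; rfl
    · simp [Tr.rf, RF.stem, hr0]
    · intro p hp
      cases h : t.rf.par p with
      | none => exact absurd ((hr p).1 h) hp
      | some q => simp [Tr.rf, RF.stem, h]
  | fork t =>
    obtain ⟨r, hr⟩ := t.exists_root
    have hr0 := (hr r).2 rfl
    refine .inr ⟨⟨r, fun p => some (.inr (some p)), none, some (.inr none),
      fun _ => some (.inl ()), ?_, ?_, ?_, rfl, ?_, fun _ => rfl, ?_⟩⟩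
    · rintro (a | (_ | _) | a) (b | (_ | _) | b) h <;>
        simp_all [Tr.rf, RF.stem, RF.join]
    · rintro (_ | b | _ | b)
      exacts [⟨.inr (.inl true), rfl⟩, ⟨.inr (.inr ()), rfl⟩, ⟨.inr (.inl false), rfl⟩,
        ⟨.inl b, rfl⟩]
    · rw [hr0]; rfl
    · simp [Tr.rf, RF.stem, RF.join, hr0]
    · intro p hp
      cases h : t.rf.par p with
      | none => exact absurd ((hr p).1 h) hp
      | some q => simp [Tr.rf, RF.stem, RF.join, h]
  | stem _ ih => exact ih.imp (fun ⟨g⟩ => ⟨g.stem⟩) (fun ⟨g⟩ => ⟨g.stem⟩)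
  | left b _ ih => exact ih.imp (fun ⟨g⟩ => ⟨g.left _⟩) (fun ⟨g⟩ => ⟨g.left _⟩)
  | right a _ ih => exact ih.imp (fun ⟨g⟩ => ⟨g.right _⟩) (fun ⟨g⟩ => ⟨g.right _⟩)

end SSRegions
end

/-! ### Cutting and sprouting of graphs, and directed trees determined by the view from the root -/

noncomputable section
namespace SSRegions

namespace FGraph

open Classical in
/-- The graph obtained by adding one vertex in the edge `e`: the edge `none` is the first half of
`e`, and the edge `some e` is the second half. -/
def split (G : FGraph) (e : G.E) : FGraph where
  V := Option G.V
  E := Option G.E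
  src := fun o => o.elim (some (G.src e)) (fun f => if f = e then none else some (G.src f))
  tgt := fun o => o.elim none (fun f => some (G.tgt f))
  finite_V := by have := G.finite_V; infer_instance
  finite_E := by have := G.finite_E; infer_instance

/-- The graph obtained by attaching a leaf edge at the vertex `v`. -/
def sprout (G : FGraph) (v : G.V) : FGraph where
  V := Option G.V
  E := Option G.E
  src := fun o => o.elim (some v) (fun f => some (G.src f))
  tgt := fun o => o.elim none (fun f => some (G.tgt f))
  finite_V := by have := G.finite_V; infer_instance
  finite_E := by have := G.finite_E; infer_instance

/-- Two vertices are added in the edge `e`; the part of `e` between them is the edge `none`. -/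
def splitPair (G : FGraph) (e : G.E) : FGraph := (G.split e).split (some e)

/-- Two vertices are added in the edge `e`, and a leaf edge is attached at the first one. -/
def fork (G : FGraph) (e : G.E) : FGraph := (G.splitPair e).sprout (some none)

theorem splitPair_src_none (G : FGraph) (e : G.E) : (G.splitPair e).src none = some none := by
  simp [splitPair, split]

theorem splitPair_src_some_none (G : FGraph) (e : G.E) :
    (G.splitPair e).src (some none) = some (some (G.src e)) := by
  simp [splitPair, split]

theorem splitPair_src_self (G : FGraph) (e : G.E) :
    (G.splitPair e).src (some (some e)) = none := by
  simp [splitPair, split]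

theorem splitPair_src_of_ne (G : FGraph) {e f : G.E} (h : f ≠ e) :
    (G.splitPair e).src (some (some f)) = some (some (G.src f)) := by
  simp [splitPair, split, h]

/-- An isomorphism of directed graphs. -/
structure Iso (G H : FGraph) where
  eV : G.V ≃ H.V
  eE : G.E ≃ H.E
  src : ∀ e, H.src (eE e) = eV (G.src e)
  tgt : ∀ e, H.tgt (eE e) = eV (G.tgt e)

/-- Graphs obtained from the graph with one edge by cutting edges and attaching leaf edges. -/
inductive Buildable : FGraph → Prop
  | base : Buildable oneEdge
  | pair (G : FGraph) (e : G.E) : Buildable G → Buildable (G.splitPair e)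
  | fork (G : FGraph) (e : G.E) : Buildable G → Buildable (G.fork e)
  | iso (G H : FGraph) (φ : Iso G H) : Buildable G → Buildable H

end FGraph

theorem RF.Grow.buildable_pair {A B : RF} (g : RF.Grow Empty A B) (h : A.graph.Buildable) :
    B.graph.Buildable := by
  have hi := g.inj
  have hs := g.surj
  refine .iso _ _ ?_ (FGraph.Buildable.pair _ g.e h)
  -- In `splitPair` the edge `none` is the middle piece and `some none` the first one. A vertex of a
  -- forest other than the root is the end of exactly one edge, which dictates `fV`.
  let fE : Option (Option A.P) → B.P := fun o =>
    o.elim g.n₂ (fun o => o.elim g.n₁ g.ι)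
  let fV : Option (Option (Option A.P)) → Option B.P := fun o =>
    o.elim (some g.n₂) (fun o => o.elim (some g.n₁) (Option.map g.ι))
  have hE : Function.Bijective fE := by
    constructor
    · rintro (_ | _ | a) (_ | _ | b) hab
      · rfl
      · have := @hi (.inr (.inl false)) (.inr (.inl true)) hab; simp at this
      · have := @hi (.inr (.inl false)) (.inl b) hab; simp at this
      · have := @hi (.inr (.inl true)) (.inr (.inl false)) hab; simp at this
      · rfl
      · have := @hi (.inr (.inl true)) (.inl b) hab; simp at this
      · have := @hi (.inl a) (.inr (.inl false)) hab; simp at this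
      · have := @hi (.inl a) (.inr (.inl true)) hab; simp at this
      · have := @hi (.inl a) (.inl b) hab; simp at this; rw [this]
    · intro b
      obtain ⟨a | (_ | _) | a, rfl⟩ := hs b
      exacts [⟨some (some a), rfl⟩, ⟨none, rfl⟩, ⟨some none, rfl⟩, a.elim]
  have hV : Function.Bijective fV := by
    -- Apart from the root, each vertex is matched with the edge that ends there; bijectivity on
    -- vertices then follows from bijectivity on edges.
    have key : ∀ o, fV o = match o with
      | some (some none) => none
      | some (some (some a)) => some (fE (some (some a)))
      | some none => some (fE (some none))
      | none => some (fE none) := by rintro (_ | _ | _ | a) <;> rfl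
    constructor
    · intro a b hab
      rw [key a, key b] at hab
      rcases a with (_ | _ | _ | a) <;> rcases b with (_ | _ | _ | b) <;>
        simp [hE.1.eq_iff] at hab ⊢
      exact hab
    · rintro (_ | b)
      · exact ⟨some (some none), rfl⟩
      · obtain ⟨_ | _ | a, rfl⟩ := hE.2 b
        exacts [⟨none, rfl⟩, ⟨some none, rfl⟩, ⟨some (some (some a)), rfl⟩]
  refine ⟨Equiv.ofBijective fV hV, Equiv.ofBijective fE hE, ?_, ?_⟩
  · change ∀ o, B.par (fE o) = fV ((A.graph.splitPair g.e).src o)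
    rintro (_ | _ | p)
    · exact g.par_n₂.trans (congrArg fV (A.graph.splitPair_src_none g.e)).symm
    · exact g.par_n₁.trans (congrArg fV (A.graph.splitPair_src_some_none g.e)).symm
    · by_cases hp : p = g.e
      · subst hp
        exact g.par_e.trans (congrArg fV (A.graph.splitPair_src_self g.e)).symm
      · exact (g.par_ι p hp).trans (congrArg fV (A.graph.splitPair_src_of_ne hp)).symm
  · rintro (_ | _ | p) <;> rfl

theorem RF.Grow.buildable_fork {A B : RF} (g : RF.Grow Unit A B) (h : A.graph.Buildable) :
    B.graph.Buildable := by
  have hi := g.inj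
  have hs := g.surj
  refine .iso _ _ ?_ (FGraph.Buildable.fork _ g.e h)
  let fE : Option (Option (Option A.P)) → B.P := fun o =>
    o.elim (g.l ()) (fun o => o.elim g.n₂ (fun o => o.elim g.n₁ g.ι))
  let fV : Option (Option (Option (Option A.P))) → Option B.P := fun o =>
    o.elim (some (g.l ())) (fun o => o.elim (some g.n₂) (fun o => o.elim (some g.n₁)
      (Option.map g.ι)))
  have hE : Function.Bijective fE := by
    have key : ∀ o, fE o = Sum.elim g.ι (Sum.elim (fun b : Bool => cond b g.n₁ g.n₂) g.l)
      (match o with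
      | none => .inr (.inr ())
      | some none => .inr (.inl false)
      | some (some none) => .inr (.inl true)
      | some (some (some p)) => .inl p) := by rintro (_ | _ | _ | a) <;> rfl
    constructor
    · intro a b hab
      rw [key, key] at hab
      have := hi hab
      rcases a with (_ | _ | _ | a) <;> rcases b with (_ | _ | _ | b) <;> simp at this ⊢
      exact this
    · intro b
      obtain ⟨a | (_ | _) | a, rfl⟩ := hs b
      exacts [⟨some (some (some a)), rfl⟩, ⟨some none, rfl⟩, ⟨some (some none), rfl⟩,
        ⟨none, rfl⟩]
  have hV : Function.Bijective fV := by
    have key : ∀ o, fV o = match o with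
      | some (some (some none)) => none
      | some (some (some (some a))) => some (fE (some (some (some a))))
      | some (some none) => some (fE (some (some none)))
      | some none => some (fE (some none))
      | none => some (fE none) := by rintro (_ | _ | _ | _ | a) <;> rfl
    constructor
    · intro a b hab
      rw [key a, key b] at hab
      rcases a with (_ | _ | _ | _ | a) <;> rcases b with (_ | _ | _ | _ | b) <;>
        simp [hE.1.eq_iff] at hab ⊢
      exact hab
    · rintro (_ | b)
      · exact ⟨some (some (some none)), rfl⟩
      · obtain ⟨_ | _ | _ | a, rfl⟩ := hE.2 b
        exacts [⟨none, rfl⟩, ⟨some none, rfl⟩, ⟨some (some none), rfl⟩,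
          ⟨some (some (some (some a))), rfl⟩]
  refine ⟨Equiv.ofBijective fV hV, Equiv.ofBijective fE hE, ?_, ?_⟩
  · change ∀ o, B.par (fE o) = fV ((A.graph.fork g.e).src o)
    rintro (_ | _ | _ | p)
    · exact g.par_l ()
    · exact g.par_n₂.trans (congrArg (fun o => fV (some o)) (A.graph.splitPair_src_none g.e)).symm
    · exact g.par_n₁.trans
        (congrArg (fun o => fV (some o)) (A.graph.splitPair_src_some_none g.e)).symm
    · by_cases hp : p = g.e
      · subst hp
        exact g.par_e.trans
          (congrArg (fun o => fV (some o)) (A.graph.splitPair_src_self g.e)).symm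
      · exact (g.par_ι p hp).trans
          (congrArg (fun o => fV (some o)) (A.graph.splitPair_src_of_ne hp)).symm
  · rintro (_ | _ | _ | p) <;> rfl

theorem Tr.Grown.buildable {t : Tr} (h : Tr.Grown t) : t.rf.graph.Buildable := by
  induction h with
  | refl =>
    let fV : Bool ≃ Option Unit :=
      ⟨fun b => cond b (some ()) none, fun o => o.isSome, by rintro (_ | _) <;> rfl,
        by rintro (_ | _) <;> rfl⟩
    have φ : FGraph.Iso FGraph.oneEdge Tr.leaf.rf.graph :=
      ⟨fV, Equiv.refl Unit, fun _ => rfl, fun _ => rfl⟩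
    exact .iso _ _ φ .base
  | tail _ hs ih =>
    rcases hs.grow with ⟨⟨g⟩⟩ | ⟨⟨g⟩⟩
    exacts [g.buildable_pair ih, g.buildable_fork ih]

/-! ### Trees inside directed graphs -/

namespace FGraph

/-- The part of the graph which is reached from the end `v` of a stem is the given tree. -/
inductive Below (H : FGraph) : H.V → Tr → Prop
  | leaf (v : H.V) (h : ∀ f, H.src f ≠ v) : Below H v .leaf
  | w (v : H.V) (e : H.E) (t : Tr) (h : ∀ f, H.src f = v ↔ f = e) (ht : Below H (H.tgt e) t) :
      Below H v (.w t)
  | v (v : H.V) (e e' : H.E) (a b : Tr) (hne : e ≠ e') (h : ∀ f, H.src f = v ↔ f = e ∨ f = e')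
      (ha : Below H (H.tgt e) a) (hb : Below H (H.tgt e') b) : Below H v (.v a b)

/-- A directed tree with root `r`: each vertex but the root is the end of exactly one edge. -/
structure IsArb (H : FGraph) (r : H.V) : Prop where
  inj : Function.Injective H.tgt
  ne_root : ∀ e, H.tgt e ≠ r
  surj : ∀ v, v ≠ r → ∃ e, H.tgt e = v

/-- A map of a forest to the edges of a directed graph. -/
structure Mapping (H : FGraph) (A : RF) (u : H.V) (φ : A.P → H.E) : Prop where
  root : ∀ p, A.par p = none → H.src (φ p) = u
  child : ∀ p q, A.par p = some q → H.src (φ p) = H.tgt (φ q)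
  inj_root : ∀ p q, A.par p = none → A.par q = none → φ p = φ q → p = q
  inj_child : ∀ p q s, A.par p = some s → A.par q = some s → φ p = φ q → p = q
  closed : ∀ p f, H.src f = H.tgt (φ p) → ∃ q, φ q = f
  wf : ∃ d : A.P → ℕ, ∀ p q, A.par p = some q → d q < d p

/-- The tree is laid out edge by edge, with its stem on `e`. The layout is known to be injective
only among siblings, which is all that the local data of `Below` give; global injectivity requires
that edges of `H` do not merge. -/
theorem Below.exists_mapping {H : FGraph} {v : H.V} {t : Tr} (h : H.Below v t) (e : H.E)
    (he : H.tgt e = v) :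
    ∃ φ : t.rf.P → H.E, Mapping H t.rf (H.src e) φ ∧ ∃ p, φ p = e ∧ t.rf.par p = none := by
  induction h generalizing e with
  | leaf v h =>
    subst he
    exact ⟨fun _ => e, ⟨fun _ _ => rfl, fun p q h => by simp [Tr.rf] at h,
      fun _ _ _ _ _ => rfl, fun _ _ _ _ _ _ => rfl, fun _ f hf => absurd hf (h f),
      fun _ => 0, fun p q h => by simp [Tr.rf] at h⟩, (), rfl, rfl⟩
  | w v e' t h ht ih =>
    subst he
    obtain ⟨φ, hφ, p, hp, hp'⟩ := ih e' rfl
    have hs : H.src e' = H.tgt e := (h e').2 rfl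
    obtain ⟨d, hd⟩ := hφ.wf
    refine ⟨fun o : Option t.rf.P => o.elim e φ, ⟨?_, ?_, ?_, ?_, ?_, ?_⟩, none, rfl, rfl⟩
    · rintro (_ | q) hq
      · rfl
      · simp [Tr.rf, RF.stem] at hq
    · rintro (_ | q) (_ | q') hq
      · simp [Tr.rf, RF.stem] at hq
      · simp [Tr.rf, RF.stem] at hq
      · have := hφ.root q (by simpa [Tr.rf, RF.stem] using hq)
        exact this.trans hs
      · exact hφ.child q q' (by simpa [Tr.rf, RF.stem] using hq)
    · rintro (_ | q) (_ | q') hq hq' _ <;> simp [Tr.rf, RF.stem] at hq hq' ⊢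
    · rintro (_ | q) (_ | q') s hq hq' hqq <;> simp [Tr.rf, RF.stem] at hq hq' hqq ⊢
      cases s with
      | none => exact hφ.inj_root _ _ (Option.some.inj hq) (Option.some.inj hq') hqq
      | some s => exact hφ.inj_child _ _ _ (Option.some.inj hq) (Option.some.inj hq') hqq
    · rintro (_ | q) f hf
      · exact ⟨some p, hp.trans ((h f).1 hf).symm⟩
      · obtain ⟨q', hq'⟩ := hφ.closed q f hf
        exact ⟨some q', hq'⟩
    · refine ⟨fun o => o.elim 0 (fun p => d p + 1), ?_⟩
      rintro (_ | q) (_ | q') hq <;> simp [Tr.rf, RF.stem] at hq ⊢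
      exact hd _ _ hq
  | v v e₁ e₂ a b hne h ha hb iha ihb =>
    subst he
    obtain ⟨φ, hφ, p, hp, hp'⟩ := iha e₁ rfl
    obtain ⟨ψ, hψ, q, hq, hq'⟩ := ihb e₂ rfl
    have hs₁ : H.src e₁ = H.tgt e := (h e₁).2 (.inl rfl)
    have hs₂ : H.src e₂ = H.tgt e := (h e₂).2 (.inr rfl)
    obtain ⟨d, hd⟩ := hφ.wf
    obtain ⟨d', hd'⟩ := hψ.wf
    have ra : ∀ x, a.rf.par x = none → φ x = e₁ := by
      intro x hx
      obtain ⟨r, hr⟩ := a.exists_root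
      rw [(hr x).1 hx, ← (hr p).1 hp', hp]
    have rb : ∀ x, b.rf.par x = none → ψ x = e₂ := by
      intro x hx
      obtain ⟨r, hr⟩ := b.exists_root
      rw [(hr x).1 hx, ← (hr q).1 hq', hq]
    refine ⟨fun o : Option (a.rf.P ⊕ b.rf.P) => o.elim e (Sum.elim φ ψ),
      ⟨?_, ?_, ?_, ?_, ?_, ?_⟩, none, rfl, rfl⟩
    · rintro (_ | x | x) hx
      · rfl
      · simp [Tr.rf, RF.join] at hx
      · simp [Tr.rf, RF.join] at hx
    · rintro (_ | x | x) (_ | y | y) hx <;> simp [Tr.rf, RF.join] at hx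
      · exact (hφ.root x hx).trans hs₁
      · exact hφ.child x y hx
      · exact (hψ.root x hx).trans hs₂
      · exact hψ.child x y hx
    · rintro (_ | x | x) (_ | y | y) hx hy _ <;> simp [Tr.rf, RF.join] at hx hy ⊢
    · rintro (_ | x | x) (_ | y | y) (_ | s | s) hx hy hxy <;>
        simp [Tr.rf, RF.join] at hx hy hxy ⊢
      · exact hφ.inj_root _ _ hx hy hxy
      · exact hφ.inj_child _ _ _ hx hy hxy
      · exact hne (by rw [← ra x hx, ← rb y hy, hxy])
      · exact hne (by rw [← ra y hy, ← rb x hx, hxy])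
      · exact hψ.inj_root _ _ hx hy hxy
      · exact hψ.inj_child _ _ _ hx hy hxy
    · rintro (_ | x | x) f hf
      · rcases (h f).1 hf with rfl | rfl
        exacts [⟨some (.inl p), hp⟩, ⟨some (.inr q), hq⟩]
      · obtain ⟨y, hy⟩ := hφ.closed x f hf
        exact ⟨some (.inl y), hy⟩
      · obtain ⟨y, hy⟩ := hψ.closed x f hf
        exact ⟨some (.inr y), hy⟩
    · refine ⟨fun o => o.elim 0 (Sum.elim (fun x => d x + 1) (fun x => d' x + 1)), ?_⟩
      rintro (_ | x | x) (_ | y | y) hx <;> simp [Tr.rf, RF.join] at hx ⊢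
      · exact hd _ _ hx
      · exact hd' _ _ hx

/-- Induction on the depth: two edges with the same image have images with the same source, so
either both start at the root, or their parents have images with the same end. In a directed tree
the latter forces the images of the parents, hence the parents, to agree, and siblings are separated
by assumption. The root is not the end of an edge, which excludes the mixed case. -/
theorem Mapping.injective {H : FGraph} {A : RF} {r : H.V} {φ : A.P → H.E} (hφ : Mapping H A r φ)
    (hH : H.IsArb r) : Function.Injective φ := by
  obtain ⟨d, hd⟩ := hφ.wf
  have key : ∀ n p q, d p = n → φ p = φ q → p = q := by
    intro n
    induction n using Nat.strong_induction_on with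
    | _ n ih =>
      rintro p q rfl hpq
      cases hp : A.par p with
      | none =>
        cases hq : A.par q with
        | none => exact hφ.inj_root _ _ hp hq hpq
        | some s =>
          have h1 := hφ.root p hp
          rw [hpq, hφ.child q s hq] at h1
          exact absurd h1 (hH.ne_root _)
      | some s =>
        have h1 := hφ.child p s hp
        cases hq : A.par q with
        | none =>
          rw [hpq, hφ.root q hq] at h1
          exact absurd h1.symm (hH.ne_root _)
        | some s' =>
          rw [hpq, hφ.child q s' hq] at h1
          have := ih (d s) (hd p s hp) s s' rfl (hH.inj h1.symm)
          subst this
          exact hφ.inj_child _ _ _ hp hq hpq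
  exact fun p q h => key _ p q rfl h

/-- Every vertex is reached from the root. -/
def Connected (H : FGraph) : Prop :=
  ∀ u v : H.V, Relation.EqvGen (fun a b => ∃ e, H.src e = a ∧ H.tgt e = b) u v

/-- Every vertex except the root is the end of exactly one edge, so there is one more vertex than
there are edges. -/
theorem IsArb.isTree {H : FGraph} {r : H.V} (h : H.IsArb r) (hc : H.Connected) : H.IsTree := by
  refine ⟨⟨r⟩, hc, ?_⟩
  have := H.finite_E
  have hb : Function.Bijective (fun o : Option H.E => o.elim r H.tgt) := by
    constructor
    · rintro (_ | a) (_ | b) hab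
      · rfl
      · exact absurd hab.symm (h.ne_root b)
      · exact absurd hab (h.ne_root a)
      · exact congrArg some (h.inj hab)
    · intro v
      by_cases hv : v = r
      · exact ⟨none, hv.symm⟩
      · obtain ⟨e, he⟩ := h.surj v hv
        exact ⟨some e, he⟩
  rw [← Nat.card_eq_of_bijective _ hb, Finite.card_option]

/-- A directed tree is determined by the tree which is seen from its root edge. -/
theorem Below.iso {H : FGraph} {r : H.V} (hH : H.IsArb r) (hc : H.Connected) {t : Tr} (e : H.E)
    (her : ∀ f, H.src f = r ↔ f = e) (h : H.Below (H.tgt e) t) :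
    Nonempty (Iso t.rf.graph H) := by
  obtain ⟨φ, hφ, p₀, hp₀, -⟩ := h.exists_mapping e rfl
  rw [(her e).2 rfl] at hφ
  have hi := hφ.injective hH
  -- The set of vertices reached by the layout is invariant along edges in both directions, so by
  -- connectedness it contains all vertices.
  have hs : ∀ v, v = r ∨ ∃ p, H.tgt (φ p) = v := by
    have hiff : ∀ a b : H.V, (∃ e, H.src e = a ∧ H.tgt e = b) →
        ((a = r ∨ ∃ p, H.tgt (φ p) = a) ↔ (b = r ∨ ∃ p, H.tgt (φ p) = b)) := by
      rintro a b ⟨f, rfl, rfl⟩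
      constructor
      · rintro (ha | ⟨p, hp⟩)
        · exact .inr ⟨p₀, by rw [hp₀, (her f).1 ha]⟩
        · obtain ⟨q, hq⟩ := hφ.closed p f hp.symm
          exact .inr ⟨q, by rw [hq]⟩
      · rintro (hb | ⟨p, hp⟩)
        · exact absurd hb (hH.ne_root f)
        · obtain rfl := hH.inj hp
          cases hpp : t.rf.par p with
          | none => exact .inl (hφ.root p hpp)
          | some q => exact .inr ⟨q, (hφ.child p q hpp).symm⟩
    intro v
    have key : ∀ a b, Relation.EqvGen (fun a b => ∃ e, H.src e = a ∧ H.tgt e = b) a b →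
        ((a = r ∨ ∃ p, H.tgt (φ p) = a) ↔ (b = r ∨ ∃ p, H.tgt (φ p) = b)) := by
      intro a b hab
      induction hab with
      | rel a b h => exact hiff a b h
      | refl => exact Iff.rfl
      | symm _ _ _ ih => exact ih.symm
      | trans _ _ _ _ _ ih ih' => exact ih.trans ih'
    exact (key r v (hc r v)).1 (.inl rfl)
  have hbE : Function.Bijective φ := by
    refine ⟨hi, fun f => ?_⟩
    obtain h1 | ⟨p, hp⟩ := hs (H.tgt f)
    · exact absurd h1 (hH.ne_root f)
    · exact ⟨p, hH.inj hp⟩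
  have hbV : Function.Bijective (fun o : Option t.rf.P => o.elim r (fun p => H.tgt (φ p))) := by
    constructor
    · rintro (_ | a) (_ | b) hab
      · rfl
      · exact absurd hab.symm (hH.ne_root _)
      · exact absurd hab (hH.ne_root _)
      · exact congrArg some (hi (hH.inj hab))
    · intro v
      obtain h1 | ⟨p, hp⟩ := hs v
      exacts [⟨none, h1.symm⟩, ⟨some p, hp⟩]
  refine ⟨Equiv.ofBijective _ hbV, Equiv.ofBijective φ hbE, fun p => ?_, fun p => rfl⟩
  change H.src (φ p) = (t.rf.par p).elim r (fun p => H.tgt (φ p))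
  cases hpp : t.rf.par p with
  | none => exact hφ.root p hpp
  | some q => exact hφ.child p q hpp

end FGraph

end SSRegions
end

/-! ### Incidences and degrees in subdivisions and in the stages of the rule -/

noncomputable section
namespace SSRegions

namespace FGraph

variable (G : FGraph) (m : G.E → ℕ)

theorem subdivide_src_zero (e : G.E) : (G.subdivide m).src ⟨e, 0⟩ = Sum.inl (G.src e) := rfl

theorem subdivide_src_succ (e : G.E) (k : Fin (m e)) :
    (G.subdivide m).src ⟨e, k.succ⟩ = Sum.inr ⟨e, k⟩ := rfl

theorem subdivide_tgt_last (e : G.E) :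
    (G.subdivide m).tgt ⟨e, Fin.last _⟩ = Sum.inl (G.tgt e) := by
  simp [subdivide]

theorem subdivide_tgt_castSucc (e : G.E) (k : Fin (m e)) :
    (G.subdivide m).tgt ⟨e, k.castSucc⟩ = Sum.inr ⟨e, k⟩ := by
  simp [subdivide]

theorem subdivide_src_eq_inl {f : (G.subdivide m).E} {v : G.V} :
    (G.subdivide m).src f = Sum.inl v ↔ ∃ e, f = ⟨e, 0⟩ ∧ G.src e = v := by
  obtain ⟨e, k⟩ := f
  cases k using Fin.cases with
  | zero =>
    rw [subdivide_src_zero]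
    constructor
    · intro h
      exact ⟨e, rfl, Sum.inl.inj h⟩
    · rintro ⟨e', h, rfl⟩
      cases h
      rfl
  | succ k =>
    rw [subdivide_src_succ]
    constructor
    · intro h
      cases h
    · rintro ⟨e', h, rfl⟩
      obtain rfl : e = e' := congrArg Sigma.fst h
      exact absurd (eq_of_heq (Sigma.mk.inj h).2) (Fin.succ_ne_zero k)

theorem subdivide_src_eq_inr {f : (G.subdivide m).E} {e : G.E} {k : Fin (m e)} :
    (G.subdivide m).src f = Sum.inr ⟨e, k⟩ ↔ f = ⟨e, k.succ⟩ := by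
  obtain ⟨e', k'⟩ := f
  cases k' using Fin.cases with
  | zero =>
    rw [subdivide_src_zero]
    constructor
    · intro h
      cases h
    · intro h
      obtain rfl : e' = e := congrArg Sigma.fst h
      exact absurd (eq_of_heq (Sigma.mk.inj h).2).symm (Fin.succ_ne_zero k)
  | succ k' =>
    rw [subdivide_src_succ]
    constructor
    · intro h
      have h' := Sum.inr.inj h
      obtain rfl : e' = e := congrArg Sigma.fst h'
      rw [eq_of_heq (Sigma.mk.inj h').2]
    · intro h
      obtain rfl : e' = e := congrArg Sigma.fst h
      rw [Fin.succ_injective _ (eq_of_heq (Sigma.mk.inj h).2)]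

theorem subdivide_tgt_eq_inl {f : (G.subdivide m).E} {v : G.V} :
    (G.subdivide m).tgt f = Sum.inl v ↔ ∃ e, f = ⟨e, Fin.last _⟩ ∧ G.tgt e = v := by
  obtain ⟨e, k⟩ := f
  cases k using Fin.lastCases with
  | last =>
    rw [subdivide_tgt_last]
    constructor
    · intro h
      exact ⟨e, rfl, Sum.inl.inj h⟩
    · rintro ⟨e', h, rfl⟩
      exact congrArg (fun x : Σ e, Fin (m e + 1) => Sum.inl (G.tgt x.1)) h
  | cast k =>
    rw [subdivide_tgt_castSucc]
    constructor
    · intro h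
      cases h
    · rintro ⟨e', h, rfl⟩
      obtain rfl : e = e' := congrArg Sigma.fst h
      exact absurd (eq_of_heq (Sigma.mk.inj h).2) (Fin.castSucc_lt_last k).ne

theorem subdivide_tgt_eq_inr {f : (G.subdivide m).E} {e : G.E} {k : Fin (m e)} :
    (G.subdivide m).tgt f = Sum.inr ⟨e, k⟩ ↔ f = ⟨e, k.castSucc⟩ := by
  obtain ⟨e', k'⟩ := f
  cases k' using Fin.lastCases with
  | last =>
    rw [subdivide_tgt_last]
    constructor
    · intro h
      cases h
    · intro h
      obtain rfl : e' = e := congrArg Sigma.fst h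
      exact absurd (eq_of_heq (Sigma.mk.inj h).2).symm (Fin.castSucc_lt_last k).ne
  | cast k' =>
    rw [subdivide_tgt_castSucc]
    constructor
    · intro h
      have h' := Sum.inr.inj h
      obtain rfl : e' = e := congrArg Sigma.fst h'
      rw [eq_of_heq (Sigma.mk.inj h').2]
    · intro h
      obtain rfl : e' = e := congrArg Sigma.fst h
      rw [Fin.castSucc_injective _ (eq_of_heq (Sigma.mk.inj h).2)]

theorem IsArb.subdivide {G : FGraph} {r : G.V} (h : G.IsArb r) (m : G.E → ℕ) :
    (G.subdivide m).IsArb (Sum.inl r) := by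
  refine ⟨fun f f' hf => ?_, fun f hf => ?_, ?_⟩
  · cases hx : (G.subdivide m).tgt f' with
    | inl v =>
      obtain ⟨e, rfl, he⟩ := (G.subdivide_tgt_eq_inl m).1 (hf.trans hx)
      obtain ⟨e', rfl, he'⟩ := (G.subdivide_tgt_eq_inl m).1 hx
      rw [h.inj (he.trans he'.symm)]
    | inr x =>
      rw [(G.subdivide_tgt_eq_inr m).1 (hf.trans hx), (G.subdivide_tgt_eq_inr m).1 hx]
  · obtain ⟨e, -, he⟩ := (G.subdivide_tgt_eq_inl m).1 hf
    exact h.ne_root e he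
  · rintro (v | ⟨e, k⟩) hv
    · obtain ⟨e, he⟩ := h.surj v (fun h => hv (by rw [h]))
      exact ⟨⟨e, Fin.last _⟩, by rw [subdivide_tgt_last, he]⟩
    · exact ⟨_, G.subdivide_tgt_castSucc m e k⟩

/-- It is enough to connect the images of the vertices of a connected graph, and to connect each
vertex to such an image. -/
theorem Connected.of_map {G H : FGraph} (h : G.Connected) (i : G.V → H.V)
    (he : ∀ e, Relation.EqvGen (fun a b => ∃ e, H.src e = a ∧ H.tgt e = b) (i (G.src e))
      (i (G.tgt e)))
    (hi : ∀ v, ∃ u, Relation.EqvGen (fun a b => ∃ e, H.src e = a ∧ H.tgt e = b) (i u) v) :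
    H.Connected := by
  have key : ∀ u v, Relation.EqvGen (fun a b => ∃ e, G.src e = a ∧ G.tgt e = b) u v →
      Relation.EqvGen (fun a b => ∃ e, H.src e = a ∧ H.tgt e = b) (i u) (i v) := by
    intro u v huv
    induction huv with
    | rel a b h => obtain ⟨e, rfl, rfl⟩ := h; exact he e
    | refl => exact .refl _
    | symm _ _ _ ih => exact .symm _ _ ih
    | trans _ _ _ _ _ ih ih' => exact .trans _ _ _ ih ih'
  intro u v
  obtain ⟨u', hu⟩ := hi u
  obtain ⟨v', hv⟩ := hi v
  exact .trans _ _ _ (.symm _ _ hu) (.trans _ _ _ (key u' v' (h u' v')) hv)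

theorem Connected.subdivide {G : FGraph} (h : G.Connected) (m : G.E → ℕ) :
    (G.subdivide m).Connected := by
  have key : ∀ e (n : ℕ) (hn : n < m e + 1),
      Relation.EqvGen (fun a b => ∃ f, (G.subdivide m).src f = a ∧ (G.subdivide m).tgt f = b)
        (Sum.inl (G.src e)) ((G.subdivide m).tgt ⟨e, ⟨n, hn⟩⟩) := by
    intro e n
    induction n with
    | zero => exact fun hn => .rel _ _ ⟨⟨e, ⟨0, hn⟩⟩, rfl, rfl⟩
    | succ n ih =>
      intro hn
      refine .trans _ _ _ (ih (by omega)) (.rel _ _ ⟨⟨e, ⟨n + 1, hn⟩⟩, ?_, rfl⟩)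
      have h1 := G.subdivide_src_succ m e ⟨n, by omega⟩
      have h2 := G.subdivide_tgt_castSucc m e ⟨n, by omega⟩
      exact h1.trans h2.symm
  refine h.of_map Sum.inl (fun e => ?_) ?_
  · have := key e (m e) (by omega)
    rwa [← G.subdivide_tgt_last m e]
  · rintro (v | ⟨e, k⟩)
    · exact ⟨v, .refl _⟩
    · exact ⟨G.src e, by rw [← G.subdivide_tgt_castSucc m e k]; exact key e k (by omega)⟩

theorem card_subtype_eq_one {α : Type} {p : α → Prop} (a : α) (h : ∀ f, p f ↔ f = a) :
    Nat.card {f // p f} = 1 := by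
  have : p = fun f => f = a := funext fun f => propext (h f)
  subst this
  simp

theorem card_subtype_eq_zero {α : Type} {p : α → Prop} (h : ∀ f, ¬ p f) :
    Nat.card {f // p f} = 0 := by
  have : IsEmpty {f // p f} := ⟨fun f => h f.1 f.2⟩
  exact Nat.card_of_isEmpty

theorem card_subtype_map {α β : Type} {p : α → Prop} {q : β → Prop} (i : α → β)
    (hi : Function.Injective i) (h : ∀ b, q b ↔ ∃ a, b = i a ∧ p a) :
    Nat.card {f // q f} = Nat.card {f // p f} := by
  symm
  refine Nat.card_eq_of_bijective (fun a : {f // p f} => ⟨i a.1, (h _).2 ⟨a.1, rfl, a.2⟩⟩)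
    ⟨fun a b hab => Subtype.ext (hi (congrArg Subtype.val hab)), ?_⟩
  rintro ⟨b, hb⟩
  obtain ⟨a, rfl, ha⟩ := (h b).1 hb
  exact ⟨⟨a, ha⟩, rfl⟩

theorem card_subtype_map_succ {α β : Type} [Finite α] {p : α → Prop} {q : β → Prop} (i : α → β)
    (hi : Function.Injective i) (b₀ : β) (hb₀ : ∀ a, i a ≠ b₀)
    (h : ∀ b, q b ↔ b = b₀ ∨ ∃ a, b = i a ∧ p a) :
    Nat.card {f // q f} = Nat.card {f // p f} + 1 := by
  rw [← Finite.card_option]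
  symm
  refine Nat.card_eq_of_bijective (fun o : Option {f // p f} =>
    (⟨o.elim b₀ (fun a => i a.1), ?_⟩ : {f // q f})) ⟨?_, ?_⟩
  · cases o with
    | none => exact (h _).2 (.inl rfl)
    | some a => exact (h _).2 (.inr ⟨a.1, rfl, a.2⟩)
  · rintro (_ | a) (_ | b) hab
    · rfl
    · exact absurd (congrArg Subtype.val hab).symm (hb₀ _)
    · exact absurd (congrArg Subtype.val hab) (hb₀ _)
    · exact congrArg some (Subtype.ext (hi (congrArg Subtype.val hab)))
  · rintro ⟨b, hb⟩
    rcases (h b).1 hb with rfl | ⟨a, rfl, ha⟩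
    exacts [⟨none, rfl⟩, ⟨some ⟨a, ha⟩, rfl⟩]

theorem degree_eq_of_card {G : FGraph} {v : G.V} {a b : ℕ}
    (ha : Nat.card {e // G.src e = v} = a) (hb : Nat.card {e // G.tgt e = v} = b) :
    G.degree v = a + b := by
  rw [← ha, ← hb]
  rfl

theorem degree_subdivide_inl (v : G.V) :
    (G.subdivide m).degree (Sum.inl v) = G.degree v := by
  unfold degree
  congr 1
  · exact card_subtype_map (fun e => ⟨e, 0⟩) (fun a b h => congrArg Sigma.fst h)
      (fun f => G.subdivide_src_eq_inl m)
  · exact card_subtype_map (fun e => ⟨e, Fin.last _⟩) (fun a b h => congrArg Sigma.fst h)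
      (fun f => G.subdivide_tgt_eq_inl m)

theorem degree_subdivide_inr (x : Σ e : G.E, Fin (m e)) :
    (G.subdivide m).degree (Sum.inr x) = 2 := by
  unfold degree
  rw [card_subtype_eq_one _ (fun f => G.subdivide_src_eq_inr m),
    card_subtype_eq_one _ (fun f => G.subdivide_tgt_eq_inr m)]

theorem oneEdge_degree (v : oneEdge.V) : oneEdge.degree v = 1 := by
  unfold degree
  cases v
  · rw [card_subtype_eq_one (p := fun e => oneEdge.src e = false) () (fun f => ⟨fun _ => rfl, fun _ => rfl⟩),
      card_subtype_eq_zero (p := fun e => oneEdge.tgt e = false) (fun f => by simp [oneEdge])]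
  · rw [card_subtype_eq_zero (p := fun e => oneEdge.src e = true) (fun f => by simp [oneEdge]),
      card_subtype_eq_one (p := fun e => oneEdge.tgt e = true) () (fun f => ⟨fun _ => rfl, fun _ => rfl⟩)]

theorem oneEdge_isArb : oneEdge.IsArb false :=
  ⟨fun _ _ _ => rfl, fun _ h => Bool.noConfusion h, fun v hv => ⟨(), by
    cases v
    · exact absurd rfl hv
    · rfl⟩⟩

theorem oneEdge_connected : oneEdge.Connected := by
  have h : Relation.EqvGen (fun a b => ∃ e, oneEdge.src e = a ∧ oneEdge.tgt e = b) false true :=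
    .rel _ _ ⟨(), rfl, rfl⟩
  rintro (_ | _) (_ | _)
  exacts [.refl _, h, .symm _ _ h, .refl _]

end FGraph

namespace PiecedGraph

variable (G : PiecedGraph) (n : {v : G.V // G.degree v = 2} → ℕ)

theorem attach_src_eq_inl {f : (G.attach n).E} {u : G.V} :
    (G.attach n).src f = Sum.inl u ↔ (∃ e, f = Sum.inl e ∧ G.src e = u) ∨
      ∃ h : G.degree u = 2, f = Sum.inr ⟨⟨u, h⟩, 0⟩ := by
  rcases f with e | ⟨⟨v, hv⟩, k⟩
  · constructor
    · intro h
      exact .inl ⟨e, rfl, Sum.inl.inj h⟩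
    · rintro (⟨e', he, rfl⟩ | ⟨h, he⟩)
      · cases he
        rfl
      · cases he
  · cases k using Fin.cases with
    | zero =>
      constructor
      · intro h
        obtain rfl : v = u := Sum.inl.inj h
        exact .inr ⟨hv, rfl⟩
      · rintro (⟨e', he, rfl⟩ | ⟨h, he⟩)
        · cases he
        · have := congrArg Sigma.fst (Sum.inr.inj he)
          obtain rfl : v = u := congrArg Subtype.val this
          rfl
    | succ k =>
      constructor
      · intro h
        cases h
      · rintro (⟨e', he, rfl⟩ | ⟨h, he⟩)
        · cases he
        · have h1 := Sum.inr.inj he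
          have h2 := congrArg Sigma.fst h1
          obtain rfl : v = u := congrArg Subtype.val h2
          exact absurd (eq_of_heq (Sigma.mk.inj h1).2) (Fin.succ_ne_zero k)

theorem attach_src_eq_inr {f : (G.attach n).E} (v : {v : G.V // G.degree v = 2})
    (k : ℕ) (hk : k < n v + 1) :
    (G.attach n).src f = Sum.inr ⟨v, ⟨k, hk⟩⟩ ↔
      ∃ h : k + 1 < n v + 1, f = Sum.inr ⟨v, ⟨k + 1, h⟩⟩ := by
  rcases f with e | ⟨v', k'⟩
  · constructor
    · intro h
      cases h
    · rintro ⟨h, he⟩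
      cases he
  · cases k' using Fin.cases with
    | zero =>
      constructor
      · intro h
        cases h
      · rintro ⟨h, he⟩
        have h1 := Sum.inr.inj he
        obtain rfl := congrArg Sigma.fst h1
        have := congrArg Fin.val (eq_of_heq (Sigma.mk.inj h1).2)
        simp at this
    | succ k' =>
      change (Sum.inr ⟨v', k'.castSucc⟩ :
        G.V ⊕ (Σ v : {v : G.V // G.degree v = 2}, Fin (n v + 1))) = _ ↔ _
      constructor
      · intro h
        have h1 := Sum.inr.inj h
        obtain rfl := congrArg Sigma.fst h1
        have := congrArg Fin.val (eq_of_heq (Sigma.mk.inj h1).2)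
        simp only [Fin.val_castSucc] at this
        subst this
        exact ⟨Nat.succ_lt_succ k'.2, rfl⟩
      · rintro ⟨h, he⟩
        have h1 := Sum.inr.inj he
        obtain rfl := congrArg Sigma.fst h1
        have := congrArg Fin.val (eq_of_heq (Sigma.mk.inj h1).2)
        simp only [Fin.val_succ, Nat.add_right_cancel_iff] at this
        subst this
        rfl

theorem attach_tgt_eq_inl {f : (G.attach n).E} {u : G.V} :
    (G.attach n).tgt f = Sum.inl u ↔ ∃ e, f = Sum.inl e ∧ G.tgt e = u := by
  rcases f with e | x
  · constructor
    · intro h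
      exact ⟨e, rfl, Sum.inl.inj h⟩
    · rintro ⟨e', h, rfl⟩
      cases h
      rfl
  · constructor
    · intro h
      cases h
    · rintro ⟨e', h, -⟩
      cases h

theorem attach_tgt_eq_inr {f : (G.attach n).E}
    {x : Σ v : {v : G.V // G.degree v = 2}, Fin (n v + 1)} :
    (G.attach n).tgt f = Sum.inr x ↔ f = Sum.inr x := by
  rcases f with e | y
  · constructor
    · intro h
      cases h
    · intro h
      cases h
  · exact ⟨fun h => congrArg Sum.inr (Sum.inr.inj h), fun h => congrArg Sum.inr (Sum.inr.inj h)⟩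

theorem isArb_attach {r : G.V} (h : G.IsArb r) : (G.attach n).IsArb (Sum.inl r) := by
  refine ⟨?_, ?_, ?_⟩
  · rintro (e | x) (e' | y) hxy
    · exact congrArg Sum.inl (h.inj (Sum.inl.inj hxy))
    · cases hxy
    · cases hxy
    · exact congrArg Sum.inr (Sum.inr.inj hxy)
  · rintro (e | x) hx
    · exact h.ne_root e (Sum.inl.inj hx)
    · cases hx
  · rintro (v | x) hv
    · obtain ⟨e, he⟩ := h.surj v (fun h => hv (by rw [h]))
      exact ⟨Sum.inl e, congrArg Sum.inl he⟩
    · exact ⟨Sum.inr x, rfl⟩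

theorem connected_attach (h : G.Connected) : (G.attach n).Connected := by
  refine h.of_map Sum.inl (fun e => .rel _ _ ⟨Sum.inl e, rfl, rfl⟩) ?_
  rintro (v | ⟨v, k, hk⟩)
  · exact ⟨v, .refl _⟩
  · refine ⟨v.1, ?_⟩
    induction k with
    | zero => exact .rel _ _ ⟨Sum.inr ⟨v, ⟨0, hk⟩⟩, rfl, rfl⟩
    | succ k ih =>
      exact .trans _ _ _ (ih (by omega)) (.rel _ _ ⟨Sum.inr ⟨v, ⟨k + 1, hk⟩⟩,
        (G.attach_src_eq_inr n v k (by omega)).2 ⟨hk, rfl⟩, rfl⟩)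

theorem degree_attach_inl_of_ne {u : G.V} (hu : G.degree u ≠ 2) :
    (G.attach n).degree (Sum.inl u) = G.degree u := by
  refine FGraph.degree_eq_of_card ?_ ?_
  · refine FGraph.card_subtype_map Sum.inl Sum.inl_injective (fun f => ?_)
    exact (attach_src_eq_inl G n).trans (or_iff_left (fun ⟨h, _⟩ => hu h))
  · refine FGraph.card_subtype_map Sum.inl Sum.inl_injective (fun f => ?_)
    exact attach_tgt_eq_inl G n

theorem degree_attach_inl_of_eq {u : G.V} (hu : G.degree u = 2) :
    (G.attach n).degree (Sum.inl u) = 3 := by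
  have h1 : Nat.card {e // (G.attach n).src e = Sum.inl u} = Nat.card {e // G.src e = u} + 1 := by
    have := G.finite_E
    refine FGraph.card_subtype_map_succ Sum.inl Sum.inl_injective (Sum.inr ⟨⟨u, hu⟩, 0⟩)
      (fun a h => by cases h) (fun f => ?_)
    refine (attach_src_eq_inl G n).trans ?_
    rw [or_comm]
    exact or_congr ⟨fun ⟨_, h⟩ => h, fun h => ⟨hu, h⟩⟩ Iff.rfl
  have h2 : Nat.card {e // (G.attach n).tgt e = Sum.inl u} = Nat.card {e // G.tgt e = u} := by
    refine FGraph.card_subtype_map Sum.inl Sum.inl_injective (fun f => ?_)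
    exact attach_tgt_eq_inl G n
  refine (FGraph.degree_eq_of_card h1 h2).trans ?_
  have : Nat.card {e // G.src e = u} + Nat.card {e // G.tgt e = u} = 2 := hu
  omega

theorem card_tgt_attach_inr (x : Σ v : {v : G.V // G.degree v = 2}, Fin (n v + 1)) :
    Nat.card {e // (G.attach n).tgt e = Sum.inr x} = 1 := by
  refine FGraph.card_subtype_eq_one (Sum.inr x) (fun f => ?_)
  exact attach_tgt_eq_inr G n

theorem degree_attach_inr_of_lt (v : {v : G.V // G.degree v = 2}) (k : ℕ) (hk : k < n v + 1)
    (hk' : k < n v) : (G.attach n).degree (Sum.inr ⟨v, ⟨k, hk⟩⟩) = 2 := by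
  refine FGraph.degree_eq_of_card (FGraph.card_subtype_eq_one
    (Sum.inr ⟨v, ⟨k + 1, by omega⟩⟩) (fun f => ?_)) (card_tgt_attach_inr G n _)
  exact (attach_src_eq_inr G n v k hk).trans ⟨fun ⟨_, h⟩ => h, fun h => ⟨by omega, h⟩⟩

theorem degree_attach_inr_last (v : {v : G.V // G.degree v = 2}) :
    (G.attach n).degree (Sum.inr ⟨v, ⟨n v, by omega⟩⟩) = 1 := by
  refine FGraph.degree_eq_of_card (FGraph.card_subtype_eq_zero (fun f h => ?_))
    (card_tgt_attach_inr G n _)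
  obtain ⟨h, -⟩ := (attach_src_eq_inr G n v (n v) (by omega)).1 h
  omega

/-- The facts about the stages which do not depend on the final subdivision. -/
structure StageFacts (G : PiecedGraph) (r : G.V) (e₀ : G.E) : Prop where
  isArb : G.IsArb r
  connected : G.Connected
  root : ∀ f, G.src f = r ↔ f = e₀
  degree_root : G.degree r = 1
  cubic : ∀ e, G.added (G.piece e) ≠ 0 → ∃ u, (u = G.src e ∨ u = G.tgt e) ∧
    (G.degree u = 2 ∨ G.degree u = 3)

theorem stageFacts_start (n : ℕ) : StageFacts (start n) (Sum.inl false) ⟨(), 0⟩ where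
  isArb := FGraph.oneEdge_isArb.subdivide _
  connected := FGraph.oneEdge_connected.subdivide _
  root := fun f => (FGraph.subdivide_src_eq_inl _ _).trans
    ⟨fun ⟨_, h, _⟩ => h, fun h => ⟨(), h, rfl⟩⟩
  degree_root := (FGraph.degree_subdivide_inl _ _ _).trans (FGraph.oneEdge_degree _)
  cubic := by
    rintro ⟨⟨⟩, k⟩ (hn : n ≠ 0)
    have h2 : ∀ j : Fin n, (start n).degree (Sum.inr ⟨(), j⟩) = 2 := fun j =>
      FGraph.degree_subdivide_inr FGraph.oneEdge (fun _ => n) ⟨(), j⟩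
    cases k using Fin.cases with
    | succ k => exact ⟨_, .inl rfl, .inl (h2 k)⟩
    | zero =>
      refine ⟨Sum.inr ⟨(), ⟨0, Nat.pos_of_ne_zero hn⟩⟩, .inr ?_, .inl (h2 _)⟩
      exact (FGraph.subdivide_tgt_castSucc FGraph.oneEdge (fun _ => n) ()
        ⟨0, Nat.pos_of_ne_zero hn⟩).symm

/-- The `cubic` field persists because attaching turns degree 2 into degree 3 and does not change
degree 3, while an edge of a new piece starts either at the old vertex, now cubic, or at an inner
vertex of the piece. -/
theorem StageFacts.attach {G : PiecedGraph} {r : G.V} {e₀ : G.E} (h : StageFacts G r e₀)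
    (n : {v : G.V // G.degree v = 2} → ℕ) :
    StageFacts (G.attach n) (Sum.inl r) (Sum.inl e₀) where
  isArb := isArb_attach G n h.isArb
  connected := connected_attach G n h.connected
  root := by
    intro f
    rw [attach_src_eq_inl]
    constructor
    · rintro (⟨e, rfl, he⟩ | ⟨h2, -⟩)
      · rw [(h.root e).1 he]
      · rw [h.degree_root] at h2
        omega
    · rintro rfl
      exact .inl ⟨e₀, rfl, (h.root e₀).2 rfl⟩
  degree_root := by
    rw [degree_attach_inl_of_ne _ _ (by rw [h.degree_root]; omega), h.degree_root]
  cubic := by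
    rintro (e | ⟨v, k, hk⟩) hn
    · obtain ⟨u, hu, hu'⟩ := h.cubic e hn
      refine ⟨Sum.inl u, hu.imp (congrArg Sum.inl) (congrArg Sum.inl), .inr ?_⟩
      by_cases h2 : G.degree u = 2
      · exact degree_attach_inl_of_eq G n h2
      · rw [degree_attach_inl_of_ne _ _ h2]
        exact hu'.resolve_left h2
    · cases k with
      | zero => exact ⟨Sum.inl v.1, .inl rfl, .inr (degree_attach_inl_of_eq G n v.2)⟩
      | succ k =>
        exact ⟨Sum.inr ⟨v, ⟨k, by omega⟩⟩, .inl rfl,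
          .inl (degree_attach_inr_of_lt G n v k _ (by omega))⟩

end PiecedGraph

end SSRegions
end

/-! ### From the stages of the rule to grown trees -/

noncomputable section
namespace SSRegions

namespace PiecedGraph

/-- A directed graph `H` which consists of the subdivision of `G`, with a grown tree attached at
each vertex of degree `2` of `G`. -/
structure Ext (G : PiecedGraph) (m : G.E → ℕ) (H : FGraph) where
  ιV : (G.subdivide m).V → H.V
  ιE : (G.subdivide m).E → H.E
  g : {v : G.V // G.degree v = 2} → H.E
  s : {v : G.V // G.degree v = 2} → Tr
  src : ∀ f, H.src (ιE f) = ιV ((G.subdivide m).src f)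
  tgt : ∀ f, H.tgt (ιE f) = ιV ((G.subdivide m).tgt f)
  inj : Function.Injective ιE
  ne : ∀ v f, ιE f ≠ g v
  src_g : ∀ v, H.src (g v) = ιV (Sum.inl v.1)
  below : ∀ v, H.Below (H.tgt (g v)) (s v)
  grown : ∀ v, (s v).Grown
  out : ∀ f u, H.src f = ιV u → (∃ f', f = ιE f' ∧ (G.subdivide m).src f' = u) ∨
    ∃ v : {v : G.V // G.degree v = 2}, u = Sum.inl v.1 ∧ f = g v

variable {G : PiecedGraph} {m : G.E → ℕ} {H : FGraph}

/-- The subdividing vertices are passed from the far end back to the near one. Nothing is attached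
at them, since branches hang only on vertices of `G`, so each contributes one `w`. -/
theorem Ext.below_edge (X : Ext G m H) (e : G.E) {t : Tr}
    (h : H.Below (X.ιV (Sum.inl (G.tgt e))) t) :
    H.Below (H.tgt (X.ιE ⟨e, 0⟩)) (Tr.wpow (m e) t) := by
  have key : ∀ d (j : Fin (m e + 1)), j.val + d = m e →
      H.Below (H.tgt (X.ιE ⟨e, j⟩)) (Tr.wpow d t) := by
    intro d
    induction d with
    | zero =>
      intro j hj
      have : j = Fin.last _ := Fin.ext (by simpa using hj)
      subst this
      have h1 : H.tgt (X.ιE ⟨e, Fin.last _⟩) = X.ιV (Sum.inl (G.tgt e)) :=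
        (X.tgt _).trans (congrArg X.ιV (FGraph.subdivide_tgt_last _ m e))
      exact h1 ▸ h
    | succ d ih =>
      intro j hj
      obtain ⟨k, rfl⟩ : ∃ k : Fin (m e), j = k.castSucc :=
        ⟨⟨j.val, by omega⟩, rfl⟩
      rw [Fin.val_castSucc] at hj
      have hk := ih k.succ (by rw [Fin.val_succ]; omega)
      refine .w _ (X.ιE ⟨e, k.succ⟩) _ (fun f => ?_) hk
      have h1 : H.tgt (X.ιE ⟨e, k.castSucc⟩) = X.ιV (Sum.inr ⟨e, k⟩) :=
        (X.tgt _).trans (congrArg X.ιV (FGraph.subdivide_tgt_castSucc _ m e k))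
      constructor
      · intro hf
        rcases X.out f _ (hf.trans h1) with ⟨f', rfl, hf'⟩ | ⟨v, hv, -⟩
        · rw [(FGraph.subdivide_src_eq_inr _ _).1 hf']
        · cases hv
      · rintro rfl
        exact (X.src _).trans h1.symm
  exact key (m e) 0 (by simp)

theorem Ext.below_leaf (X : Ext G m H) (v : G.V) (hv : G.degree v ≠ 2)
    (h : ∀ f, G.src f ≠ v) : H.Below (X.ιV (Sum.inl v)) .leaf := by
  refine .leaf _ (fun f hf => ?_)
  rcases X.out f _ hf with ⟨f', rfl, hf'⟩ | ⟨v', hv', -⟩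
  · obtain ⟨e, -, he⟩ := (FGraph.subdivide_src_eq_inl _ _).1 hf'
    exact h e he
  · obtain rfl := Sum.inl.inj hv'
    exact hv v'.2

theorem Ext.below_vertex (X : Ext G m H) (v : {v : G.V // G.degree v = 2}) (e : G.E)
    (h : ∀ f, G.src f = v.1 ↔ f = e) {t : Tr} (ht : H.Below (H.tgt (X.ιE ⟨e, 0⟩)) t) :
    H.Below (X.ιV (Sum.inl v.1)) (.v (X.s v) t) := by
  refine .v _ (X.g v) (X.ιE ⟨e, 0⟩) _ _ (X.ne v _).symm (fun f => ?_) (X.below v) ht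
  constructor
  · intro hf
    rcases X.out f _ hf with ⟨f', rfl, hf'⟩ | ⟨v', hv', rfl⟩
    · obtain ⟨e', rfl, he⟩ := (FGraph.subdivide_src_eq_inl _ _).1 hf'
      obtain rfl := (h e').1 he
      exact .inr rfl
    · rw [Subtype.ext (Sum.inl.inj hv')]
      exact .inl rfl
  · rintro (rfl | rfl)
    · exact X.src_g v
    · exact (X.src _).trans (congrArg (fun u => X.ιV (Sum.inl u)) ((h e).2 rfl))

open Classical in
/-- The tree below the first edge of a path of `G` whose inner vertices have degree `2`. -/
theorem Ext.below_path (X : Ext G m H) (ed : ℕ → G.E) (n : ℕ)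
    (h2 : ∀ k < n, G.degree (G.tgt (ed k)) = 2)
    (hnext : ∀ k < n, ∀ f, G.src f = G.tgt (ed k) ↔ f = ed (k + 1))
    (hn : G.degree (G.tgt (ed n)) ≠ 2) (hlast : ∀ f, G.src f ≠ G.tgt (ed n))
    (he2 : n ≠ 0 → ∀ j ≤ n, 2 ≤ m (ed j)) (hev : Even n → ∀ j ≤ n, Even (m (ed j)))
    (hodd : Odd n → ∃ j₀ ≤ n, Odd (m (ed j₀)) ∧ ∀ j ≤ n, j ≠ j₀ → Even (m (ed j))) :
    ∃ t : Tr, t.Grown ∧ H.Below (H.tgt (X.ιE ⟨ed 0, 0⟩)) t := by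
  let s : ℕ → Tr := fun k =>
    if h : G.degree (G.tgt (ed k)) = 2 then X.s ⟨_, h⟩ else .leaf
  refine ⟨_, Tr.grown_path (fun j => m (ed j)) s n (fun j hj => ?_) he2 hev hodd, ?_⟩
  · simp only [s, dif_pos (h2 j hj)]
    exact X.grown _
  · have key : ∀ d i, i + d = n → H.Below (H.tgt (X.ιE ⟨ed i, 0⟩))
        (Tr.wpow (m (ed i)) (Tr.body (fun j => m (ed j)) s i d)) := by
      intro d
      induction d with
      | zero =>
        rintro i rfl
        exact X.below_edge _ (X.below_leaf _ hn hlast)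
      | succ d ih =>
        intro i hi
        have := X.below_vertex ⟨_, h2 i (by omega)⟩ _ (hnext i (by omega)) (ih (i + 1) (by omega))
        have hs : s i = X.s ⟨_, h2 i (by omega)⟩ := by
          simp only [s, dif_pos (h2 i (by omega))]
        rw [← hs] at this
        exact X.below_edge _ this
    exact key n 0 (by omega)

/-- The consequences of admissibility which are used in the construction. -/
def Fits (G : PiecedGraph) (m : G.E → ℕ) : Prop :=
  ∀ P : G.Piece, (G.added P ≠ 0 → ∀ e, G.piece e = P → 2 ≤ m e) ∧
    (Even (G.added P) → ∀ e, G.piece e = P → Even (m e)) ∧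
    (Odd (G.added P) → ∃ e₀, G.piece e₀ = P ∧ Odd (m e₀) ∧
      ∀ e, G.piece e = P → e ≠ e₀ → Even (m e))

/-- The conditions for a path which is a piece. -/
theorem Fits.path (hm : Fits G m) (P : G.Piece) (ed : ℕ → G.E)
    (hed : ∀ e, G.piece e = P ↔ ∃ j ≤ G.added P, ed j = e) :
    (G.added P ≠ 0 → ∀ j ≤ G.added P, 2 ≤ m (ed j)) ∧
    (Even (G.added P) → ∀ j ≤ G.added P, Even (m (ed j))) ∧
    (Odd (G.added P) → (∀ i ≤ G.added P, ∀ j ≤ G.added P, ed i = ed j → i = j) →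
      ∃ j₀ ≤ G.added P, Odd (m (ed j₀)) ∧ ∀ j ≤ G.added P, j ≠ j₀ → Even (m (ed j))) := by
  obtain ⟨h1, h2, h3⟩ := hm P
  refine ⟨fun h j hj => h1 h _ ((hed _).2 ⟨j, hj, rfl⟩),
    fun h j hj => h2 h _ ((hed _).2 ⟨j, hj, rfl⟩), fun h hi => ?_⟩
  obtain ⟨e₀, he₀, ho, hev⟩ := h3 h
  obtain ⟨j₀, hj₀, rfl⟩ := (hed e₀).1 he₀
  exact ⟨j₀, hj₀, ho, fun j hj hne => hev _ ((hed _).2 ⟨j, hj, rfl⟩)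
    (fun he => hne (hi j hj j₀ hj₀ he))⟩

theorem Ext.exists_start {n : ℕ} {m : (start n).E → ℕ} (hm : Fits (start n) m)
    (X : Ext (start n) m H) :
    ∃ t : Tr, t.Grown ∧ H.Below (H.tgt (X.ιE ⟨⟨(), 0⟩, 0⟩)) t := by
  -- The index is capped at `n` to obtain a function on all of `ℕ`; only `j ≤ n` matters, and there
  -- the edges are distinct.
  let ed : ℕ → (start n).E := fun j => ⟨(), ⟨min j n, Nat.lt_succ_of_le (min_le_right _ _)⟩⟩
  have hed : ∀ e, (start n).piece e = () ↔ ∃ j ≤ (start n).added (), ed j = e := by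
    rintro ⟨⟨⟩, j, hj⟩
    refine ⟨fun _ => ⟨j, Nat.le_of_lt_succ hj, ?_⟩, fun _ => rfl⟩
    exact congrArg (Sigma.mk ()) (Fin.ext (min_eq_left (Nat.le_of_lt_succ hj)))
  have hlt : ∀ k (hk : k < n), (start n).tgt (ed k) = Sum.inr ⟨(), ⟨k, hk⟩⟩ := by
    intro k hk
    have h1 := FGraph.subdivide_tgt_castSucc FGraph.oneEdge (fun _ => n) () ⟨k, hk⟩
    have : ed k = ⟨(), (⟨k, hk⟩ : Fin n).castSucc⟩ := by
      exact congrArg (Sigma.mk ()) (Fin.ext (min_eq_left hk.le))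
    rw [this]
    exact h1
  have hlast : (start n).tgt (ed n) = Sum.inl true := by
    have h1 := FGraph.subdivide_tgt_last FGraph.oneEdge (fun _ => n) ()
    have : ed n = ⟨(), Fin.last n⟩ := by
      exact congrArg (Sigma.mk ()) (Fin.ext (min_self n))
    rw [this]
    exact h1
  obtain ⟨p1, p2, p3⟩ := hm.path () ed hed
  have hinj : ∀ i ≤ n, ∀ j ≤ n, ed i = ed j → i = j := by
    intro i hi j hj hij
    have h1 := congrArg Fin.val (eq_of_heq (Sigma.mk.inj hij).2)
    simp only [min_eq_left hi, min_eq_left hj] at h1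
    exact h1
  refine X.below_path ed n (fun k hk => ?_) (fun k hk f => ?_) ?_ (fun f hf => ?_) p1 p2
    (fun h => p3 h hinj)
  · rw [hlt k hk]
    exact FGraph.degree_subdivide_inr FGraph.oneEdge (fun _ => n) ⟨(), ⟨k, hk⟩⟩
  · rw [hlt k hk]
    refine (FGraph.subdivide_src_eq_inr FGraph.oneEdge (fun _ => n)).trans ?_
    have : ed (k + 1) = ⟨(), (⟨k, hk⟩ : Fin n).succ⟩ := by
      exact congrArg (Sigma.mk ()) (Fin.ext (min_eq_left (Nat.succ_le_of_lt hk)))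
    rw [this]
    rfl
  · rw [hlast]
    have h1 := (FGraph.degree_subdivide_inl FGraph.oneEdge (fun _ => n) true).trans
      (FGraph.oneEdge_degree true)
    intro h2
    have := h1.symm.trans h2
    omega
  · rw [hlast] at hf
    obtain ⟨e, -, he⟩ := (FGraph.subdivide_src_eq_inl FGraph.oneEdge (fun _ => n)).1 hf
    exact Bool.noConfusion he

/-- A newly attached piece is a path from `v` to a leaf whose inner vertices have degree 2, with
grown branches hanging there. It is thus a grown tree by the parity argument for a single path. -/
theorem Ext.exists_attach {n : {v : G.V // G.degree v = 2} → ℕ} {m : (G.attach n).E → ℕ}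
    (hm : Fits (G.attach n) m) (X : Ext (G.attach n) m H) (v : {v : G.V // G.degree v = 2}) :
    ∃ t : Tr, t.Grown ∧ H.Below (H.tgt (X.ιE ⟨Sum.inr ⟨v, 0⟩, 0⟩)) t := by
  let ed : ℕ → (G.attach n).E := fun j => Sum.inr ⟨v, ⟨min j (n v), Nat.lt_succ_of_le (min_le_right _ _)⟩⟩
  have hed0 : ∀ j (hj : j ≤ n v), ed j = Sum.inr ⟨v, ⟨j, Nat.lt_succ_of_le hj⟩⟩ := by
    intro j hj
    exact congrArg (fun k : Fin (n v + 1) => (Sum.inr ⟨v, k⟩ : (G.attach n).E))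
      (Fin.ext (min_eq_left hj))
  have hed : ∀ e, (G.attach n).piece e = Sum.inr v ↔
      ∃ j ≤ (G.attach n).added (Sum.inr v), ed j = e := by
    rintro (e | ⟨v', j, hj⟩)
    · constructor
      · intro h
        cases h
      · rintro ⟨j, -, h⟩
        cases h
    · constructor
      · intro h
        obtain rfl : v' = v := Sum.inr.inj h
        exact ⟨j, Nat.le_of_lt_succ hj, hed0 j (Nat.le_of_lt_succ hj)⟩
      · rintro ⟨j, hj, h⟩
        rw [← h]
        rfl
  obtain ⟨p1, p2, p3⟩ := hm.path _ ed hed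
  have hinj : ∀ i ≤ n v, ∀ j ≤ n v, ed i = ed j → i = j := by
    intro i hi j hj hij
    rw [hed0 i hi, hed0 j hj] at hij
    have h1 := congrArg Fin.val (eq_of_heq (Sigma.mk.inj (Sum.inr.inj hij)).2)
    exact h1
  have htgt : ∀ k (hk : k ≤ n v), (G.attach n).tgt (ed k) =
      Sum.inr ⟨v, ⟨k, Nat.lt_succ_of_le hk⟩⟩ := by
    intro k hk
    rw [hed0 k hk]
    rfl
  have h0 : ed 0 = Sum.inr ⟨v, 0⟩ := hed0 0 (Nat.zero_le _)
  rw [← h0]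
  refine X.below_path ed (n v) (fun k hk => ?_) (fun k hk f => ?_) ?_ (fun f hf => ?_) p1 p2
    (fun h => p3 h hinj)
  · rw [htgt k hk.le]
    exact degree_attach_inr_of_lt G n v k _ hk
  · rw [htgt k hk.le, hed0 (k + 1) hk]
    exact (attach_src_eq_inr G n v k _).trans ⟨fun ⟨_, h⟩ => h, fun h => ⟨Nat.succ_lt_succ hk, h⟩⟩
  · rw [htgt _ le_rfl]
    intro h
    have := (degree_attach_inr_last G n v).symm.trans h
    omega
  · rw [htgt _ le_rfl] at hf
    obtain ⟨h, -⟩ := (attach_src_eq_inr G n v _ _).1 hf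
    omega

/-- A graph which extends a stage by grown trees is a grown tree. -/
theorem Ext.exists_grown {G : PiecedGraph} (hG : G.IsStage) :
    ∃ r e₀, StageFacts G r e₀ ∧ ∀ (m : G.E → ℕ) (H : FGraph) (X : Ext G m H), Fits G m →
      ∃ t : Tr, t.Grown ∧ H.Below (H.tgt (X.ιE ⟨e₀, 0⟩)) t := by
  induction hG with
  | start n =>
    exact ⟨_, _, stageFacts_start n, fun m H X hm => X.exists_start hm⟩
  -- The pieces of the last stage are absorbed into the attached trees: with its branches, each
  -- becomes one grown tree hanging on its vertex of `G`, and `H` becomes an extension of the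
  -- previous stage.
  | attach G n _ ih =>
    obtain ⟨r, e₀, hr, h⟩ := ih
    refine ⟨_, _, hr.attach n, fun m H X hm => ?_⟩
    choose s hs hb using X.exists_attach hm
    have hm' : Fits G (fun e => m (Sum.inl e)) := by
      intro P
      obtain ⟨h1, h2, h3⟩ := hm (Sum.inl P)
      refine ⟨fun hP e he => h1 hP _ (congrArg Sum.inl he),
        fun hP e he => h2 hP _ (congrArg Sum.inl he), fun hP => ?_⟩
      obtain ⟨e₀ | x, he₀, ho, hev⟩ := h3 hP
      · exact ⟨e₀, Sum.inl.inj he₀, ho, fun e he hne =>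
          hev _ (congrArg Sum.inl he) (fun h => hne (Sum.inl.inj h))⟩
      · cases he₀
    let ιV : (G.subdivide (fun e => m (Sum.inl e))).V → ((G.attach n).subdivide m).V :=
      Sum.elim (fun v => Sum.inl (Sum.inl v)) (fun x => Sum.inr ⟨Sum.inl x.1, x.2⟩)
    let ιE : (G.subdivide (fun e => m (Sum.inl e))).E → ((G.attach n).subdivide m).E :=
      fun x => ⟨Sum.inl x.1, x.2⟩
    have hsrc : ∀ f, ((G.attach n).subdivide m).src (ιE f) =
        ιV ((G.subdivide (fun e => m (Sum.inl e))).src f) := by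
      rintro ⟨e, k⟩
      cases k using Fin.cases with
      | zero => rfl
      | succ k => rfl
    have htgt : ∀ f, ((G.attach n).subdivide m).tgt (ιE f) =
        ιV ((G.subdivide (fun e => m (Sum.inl e))).tgt f) := by
      rintro ⟨e, k⟩
      cases k using Fin.lastCases with
      | last =>
        rw [FGraph.subdivide_tgt_last]
        exact FGraph.subdivide_tgt_last (G.attach n).toFGraph m (Sum.inl e)
      | cast k =>
        rw [FGraph.subdivide_tgt_castSucc]
        exact FGraph.subdivide_tgt_castSucc (G.attach n).toFGraph m (Sum.inl e) k
    have hout : ∀ f u, ((G.attach n).subdivide m).src f = ιV u →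
        (∃ f', f = ιE f' ∧ (G.subdivide (fun e => m (Sum.inl e))).src f' = u) ∨
        ∃ v : {v : G.V // G.degree v = 2}, u = Sum.inl v.1 ∧ f = ⟨Sum.inr ⟨v, 0⟩, 0⟩ := by
      rintro f (u | ⟨e, k⟩) hf
      · obtain ⟨e, rfl, he⟩ := (FGraph.subdivide_src_eq_inl (G.attach n).toFGraph m).1 hf
        rcases (attach_src_eq_inl G n).1 he with ⟨e', rfl, he'⟩ | ⟨h2, rfl⟩
        · exact .inl ⟨⟨e', 0⟩, rfl, congrArg Sum.inl he'⟩
        · exact .inr ⟨⟨u, h2⟩, rfl, rfl⟩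
      · have := (FGraph.subdivide_src_eq_inr (G.attach n).toFGraph m
          (e := Sum.inl e) (k := k)).1 hf
        exact .inl ⟨⟨e, k.succ⟩, this, rfl⟩
    -- Old vertices no longer have degree 2, so the given extension hangs nothing on them. The only
    -- outgoing edges there, besides those of `G`, are the first edges of the new pieces.
    have hdeg : ∀ u, (G.attach n).degree (Sum.inl u) ≠ 2 := by
      intro u h2
      by_cases hu : G.degree u = 2
      · have := (degree_attach_inl_of_eq G n hu).symm.trans h2
        omega
      · exact hu ((degree_attach_inl_of_ne G n hu).symm.trans h2)
    let Y : Ext G (fun e => m (Sum.inl e)) H :=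
      { ιV := fun u => X.ιV (ιV u)
        ιE := fun f => X.ιE (ιE f)
        g := fun v => X.ιE ⟨Sum.inr ⟨v, 0⟩, 0⟩
        s := s
        src := fun f => (X.src _).trans (congrArg X.ιV (hsrc f))
        tgt := fun f => (X.tgt _).trans (congrArg X.ιV (htgt f))
        inj := ?_
        ne := ?_
        src_g := fun v => X.src _
        below := hb
        grown := hs
        out := ?_ }
    · exact h _ H Y hm'
    · intro f f' hf
      have h1 : ιE f = ιE f' := X.inj hf
      obtain ⟨e, k⟩ := f
      obtain ⟨e', k'⟩ := f'
      obtain rfl : e = e' := Sum.inl.inj (congrArg Sigma.fst h1)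
      exact congrArg (Sigma.mk e) (eq_of_heq (Sigma.mk.inj h1).2)
    · intro v f hf
      have h1 := congrArg Sigma.fst (X.inj hf)
      cases h1
    · intro f u hf
      rcases X.out f _ hf with ⟨f', rfl, hf'⟩ | ⟨v, hv, -⟩
      · rcases hout f' u hf' with ⟨f'', rfl, h''⟩ | ⟨v, rfl, rfl⟩
        · exact .inl ⟨f'', rfl, h''⟩
        · exact .inr ⟨v, rfl, rfl⟩
      · rcases u with u | x
        · have h1 := v.2
          rw [← Sum.inl.inj hv] at h1
          exact absurd h1 (hdeg u)
        · cases hv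

/-- In a finished graph every edge of a piece with added vertices has a cubic end. Hence `2 * j - 1
≥ 1`, which for an even number means at least 2, and `2 * j ≥ 2` in the odd case. No stronger bound
is used later. -/
theorem Admissible.fits {r : G.V} {e₀ : G.E} (hG : StageFacts G r e₀)
    (hdone : ∀ v : G.V, G.degree v ≠ 2) (hm : G.Admissible m) : Fits G m := by
  have hc : ∀ e, G.added (G.piece e) ≠ 0 → 1 ≤ G.cubicEnds e := by
    intro e he
    obtain ⟨u, hu, hu'⟩ := hG.cubic e he
    have := G.finite_V
    exact Nat.card_pos_iff.2 ⟨⟨⟨u, hu, hu'.resolve_left (hdone u)⟩⟩, inferInstance⟩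
  intro P
  obtain ⟨h1, h2, h3⟩ := hm P
  refine ⟨fun hP e he => ?_, fun hP e he => ?_, fun hP => ?_⟩
  · have hce := hc e (by rwa [he])
    rcases Nat.even_or_odd (G.added P) with hev | hodd
    · obtain ⟨⟨a, ha⟩, hb⟩ := h2 hP hev e he
      omega
    · obtain ⟨e₁, -, -, hl, hall⟩ := h3 hodd
      by_cases hee : e = e₁
      · subst hee
        omega
      · have := (hall e he hee).2
        omega
  · by_cases h0 : G.added P = 0
    · exact h1 h0 e he
    · exact (h2 h0 hP e he).1
  · obtain ⟨e₁, he₁, ho, -, hall⟩ := h3 hP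
    exact ⟨e₁, he₁, ho, fun e he hne => (hall e he hne).1⟩

/-- The graphs of the inductive rule are trees, which are built by cutting edges and attaching leaf
edges. -/
theorem isTree_and_buildable (hG : G.IsStage) (hdone : ∀ v : G.V, G.degree v ≠ 2)
    (hm : G.Admissible m) : (G.subdivide m).IsTree ∧ (G.subdivide m).Buildable := by
  obtain ⟨r, e₀, hr, h⟩ := Ext.exists_grown hG
  have ha := hr.isArb.subdivide m
  have hc := hr.connected.subdivide m
  refine ⟨ha.isTree hc, ?_⟩
  -- Without vertices of degree 2 there is nothing to attach, so the final graph extends the last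
  -- stage trivially.
  let X : Ext G m (G.subdivide m) :=
    { ιV := id
      ιE := id
      g := fun v => absurd v.2 (hdone v.1)
      s := fun v => absurd v.2 (hdone v.1)
      src := fun _ => rfl
      tgt := fun _ => rfl
      inj := Function.injective_id
      ne := fun v => absurd v.2 (hdone v.1)
      src_g := fun v => absurd v.2 (hdone v.1)
      below := fun v => absurd v.2 (hdone v.1)
      grown := fun v => absurd v.2 (hdone v.1)
      out := fun f u hf => .inl ⟨f, rfl, hf⟩ }
  obtain ⟨t, ht, hb⟩ := h m _ X (hm.fits hr hdone)
  obtain ⟨φ⟩ := FGraph.Below.iso ha hc (⟨e₀, 0⟩ : (G.subdivide m).E) (fun f => by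
    refine (FGraph.subdivide_src_eq_inl _ _).trans ⟨?_, ?_⟩
    · rintro ⟨e, rfl, he⟩
      obtain rfl := (hr.root e).1 he
      rfl
    · rintro rfl
      exact ⟨e₀, rfl, (hr.root e₀).2 rfl⟩) hb
  exact .iso _ _ φ ht.buildable

end PiecedGraph

end SSRegions
end

/-! ### Plane regions between graphs, strip decompositions and components of level sets -/

noncomputable section
namespace SSRegions

open Set

/-! ### Coordinates of the plane -/

/-- The point with given coordinates. -/
def pt (a b : ℝ) : Plane := !₂[a, b]

@[simp] theorem pt_zero (a b : ℝ) : pt a b 0 = a := by simp [pt]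

@[simp] theorem pt_one (a b : ℝ) : pt a b 1 = b := by simp [pt]

theorem plane_ext {z w : Plane} (h₀ : z 0 = w 0) (h₁ : z 1 = w 1) : z = w := by
  ext i
  fin_cases i
  exacts [h₀, h₁]

@[simp] theorem pt_eta (z : Plane) : pt (z 0) (z 1) = z := plane_ext (by simp) (by simp)

theorem continuous_coord (i : Fin 2) : Continuous (fun z : Plane => z i) := by fun_prop

theorem continuous_pt : Continuous (fun p : ℝ × ℝ => pt p.1 p.2) := by
  unfold pt
  refine (PiLp.continuous_toLp 2 _).comp (continuous_pi fun i => ?_)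
  fin_cases i
  exacts [continuous_fst, continuous_snd]

theorem continuousOn_pt {X : Type*} [TopologicalSpace X] {f g : X → ℝ} {s : Set X}
    (hf : ContinuousOn f s) (hg : ContinuousOn g s) : ContinuousOn (fun x => pt (f x) (g x)) s :=
  continuous_pt.comp_continuousOn (hf.prodMk hg)

/-- A vertical segment. -/
def vseg (a l h : ℝ) : Set Plane := {z | z 0 = a ∧ l ≤ z 1 ∧ z 1 ≤ h}

theorem isClosed_vseg (a l h : ℝ) : IsClosed (vseg a l h) :=
  (isClosed_eq (continuous_coord 0) continuous_const).inter
    ((isClosed_le continuous_const (continuous_coord 1)).inter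
      (isClosed_le (continuous_coord 1) continuous_const))

theorem isPreconnected_vseg (a l h : ℝ) : IsPreconnected (vseg a l h) := by
  have : vseg a l h = (fun b => pt a b) '' Icc l h := by
    ext z
    constructor
    · rintro ⟨h0, h1, h2⟩
      subst h0
      exact ⟨z 1, ⟨h1, h2⟩, pt_eta z⟩
    · rintro ⟨b, hb, rfl⟩
      exact ⟨by simp, by simpa using hb.1, by simpa using hb.2⟩
  rw [this]
  exact isPreconnected_Icc.image _
    (continuous_pt.comp (Continuous.prodMk_right a)).continuousOn

/-- The closed region between two graphs. -/
def cbetween (a b : ℝ) (f g : ℝ → ℝ) : Set Plane :=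
  {z | z 0 ∈ Icc a b ∧ f (z 0) ≤ z 1 ∧ z 1 ≤ g (z 0)}

/-- The open region between two graphs. -/
def obetween (a b : ℝ) (f g : ℝ → ℝ) : Set Plane :=
  {z | z 0 ∈ Ioo a b ∧ f (z 0) < z 1 ∧ z 1 < g (z 0)}

theorem isClosed_cbetween {a b : ℝ} {f g : ℝ → ℝ} (hf : ContinuousOn f (Icc a b))
    (hg : ContinuousOn g (Icc a b)) : IsClosed (cbetween a b f g) := by
  have hs : IsClosed {z : Plane | z 0 ∈ Icc a b} := isClosed_Icc.preimage (continuous_coord 0)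
  have hm : MapsTo (fun z : Plane => z 0) {z : Plane | z 0 ∈ Icc a b} (Icc a b) := fun z hz => hz
  have h1 : ContinuousOn (fun z : Plane => z 1 - f (z 0)) {z : Plane | z 0 ∈ Icc a b} :=
    (continuous_coord 1).continuousOn.sub (hf.comp (continuous_coord 0).continuousOn hm)
  have h2 : ContinuousOn (fun z : Plane => g (z 0) - z 1) {z : Plane | z 0 ∈ Icc a b} :=
    (hg.comp (continuous_coord 0).continuousOn hm).sub (continuous_coord 1).continuousOn
  have := (h1.preimage_isClosed_of_isClosed hs (isClosed_Ici (a := (0 : ℝ)))).inter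
    (h2.preimage_isClosed_of_isClosed hs (isClosed_Ici (a := (0 : ℝ))))
  convert this using 1
  ext z
  simp only [cbetween, mem_ofPred_eq, mem_inter_iff, mem_preimage, mem_Ici, sub_nonneg]
  tauto

theorem isOpen_obetween {a b : ℝ} {f g : ℝ → ℝ} (hf : ContinuousOn f (Ioo a b))
    (hg : ContinuousOn g (Ioo a b)) : IsOpen (obetween a b f g) := by
  have hs : IsOpen {z : Plane | z 0 ∈ Ioo a b} := isOpen_Ioo.preimage (continuous_coord 0)
  have hm : MapsTo (fun z : Plane => z 0) {z : Plane | z 0 ∈ Ioo a b} (Ioo a b) := fun z hz => hz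
  have h1 : ContinuousOn (fun z : Plane => z 1 - f (z 0)) {z : Plane | z 0 ∈ Ioo a b} :=
    (continuous_coord 1).continuousOn.sub (hf.comp (continuous_coord 0).continuousOn hm)
  have h2 : ContinuousOn (fun z : Plane => g (z 0) - z 1) {z : Plane | z 0 ∈ Ioo a b} :=
    (hg.comp (continuous_coord 0).continuousOn hm).sub (continuous_coord 1).continuousOn
  have := (h1.isOpen_inter_preimage hs (isOpen_Ioi (a := (0 : ℝ)))).inter
    (h2.isOpen_inter_preimage hs (isOpen_Ioi (a := (0 : ℝ))))
  convert this using 1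
  ext z
  simp only [obetween, mem_ofPred_eq, mem_inter_iff, mem_preimage, mem_Ioi, sub_pos]
  tauto

/-- The region is a continuous image of the open rectangle `Ioo a b ×ˢ Ioo 0 1`, the second
coordinate interpolating between the two graphs. -/
theorem isPreconnected_obetween {a b : ℝ} {f g : ℝ → ℝ} (hf : ContinuousOn f (Ioo a b))
    (hg : ContinuousOn g (Ioo a b)) (h : ∀ x ∈ Ioo a b, f x < g x) :
    IsPreconnected (obetween a b f g) := by
  have : obetween a b f g = (fun p : ℝ × ℝ => pt p.1 (f p.1 + p.2 * (g p.1 - f p.1))) ''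
      (Ioo a b ×ˢ Ioo 0 1) := by
    ext z
    constructor
    · rintro ⟨h0, h1, h2⟩
      have hpos := sub_pos.2 (h _ h0)
      refine ⟨(z 0, (z 1 - f (z 0)) / (g (z 0) - f (z 0))), ⟨h0, div_pos (by linarith) hpos, ?_⟩, ?_⟩
      · rw [div_lt_one hpos]
        linarith
      · apply plane_ext
        · simp
        · simp only [pt_one]
          field_simp
          ring
    · rintro ⟨⟨x, t⟩, ⟨hx, ht⟩, rfl⟩
      have hpos := sub_pos.2 (h _ hx)
      refine ⟨by simpa using hx, ?_, ?_⟩ <;> simp only [pt_zero, pt_one]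
      · nlinarith [mul_pos ht.1 hpos]
      · nlinarith [mul_pos (sub_pos.2 ht.2) hpos]
  rw [this]
  refine (isPreconnected_Ioo.prod isPreconnected_Ioo).image _ ?_
  have hm : MapsTo Prod.fst (Ioo a b ×ˢ Ioo (0 : ℝ) 1) (Ioo a b) := fun p hp => hp.1
  have hf' := hf.comp continuous_fst.continuousOn hm
  have hg' := hg.comp continuous_fst.continuousOn hm
  exact continuousOn_pt continuous_fst.continuousOn
    (hf'.add (continuous_snd.continuousOn.mul (hg'.sub hf')))

theorem cbetween_subset_closure {a b : ℝ} (hab : a < b) {f g : ℝ → ℝ}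
    (hf : ContinuousOn f (Icc a b)) (hg : ContinuousOn g (Icc a b))
    (h : ∀ x ∈ Ioo a b, f x < g x) : cbetween a b f g ⊆ closure (obetween a b f g) := by
  rintro z ⟨h0, h1, h2⟩
  obtain ⟨t, ht, hz⟩ : ∃ t ∈ Icc (0 : ℝ) 1, z 1 = f (z 0) + t * (g (z 0) - f (z 0)) := by
    -- At the ends of the interval the two graphs may meet; then any interpolation parameter will
    -- do, and 0 is taken.
    rcases (h1.trans h2).eq_or_lt with he | hlt
    · exact ⟨0, by simp, by linarith⟩
    · have hpos := sub_pos.2 hlt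
      refine ⟨(z 1 - f (z 0)) / (g (z 0) - f (z 0)), ⟨div_nonneg (by linarith) hpos.le, ?_⟩, ?_⟩
      · rw [div_le_one hpos]
        linarith
      · field_simp
        ring
  have hm : MapsTo Prod.fst (Icc a b ×ˢ Icc (0 : ℝ) 1) (Icc a b) := fun p hp => hp.1
  have hc : ContinuousOn (fun p : ℝ × ℝ => pt p.1 (f p.1 + p.2 * (g p.1 - f p.1)))
      (Icc a b ×ˢ Icc (0 : ℝ) 1) := by
    have hf' := hf.comp continuous_fst.continuousOn hm
    have hg' := hg.comp continuous_fst.continuousOn hm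
    exact continuousOn_pt continuous_fst.continuousOn
      (hf'.add (continuous_snd.continuousOn.mul (hg'.sub hf')))
  have hcl : Icc a b ×ˢ Icc (0 : ℝ) 1 = closure (Ioo a b ×ˢ Ioo (0 : ℝ) 1) := by
    rw [closure_prod_eq, closure_Ioo hab.ne, closure_Ioo zero_ne_one]
  rw [hcl] at hc
  have hmem : (z 0, t) ∈ closure (Ioo a b ×ˢ Ioo (0 : ℝ) 1) := by
    rw [← hcl]
    exact ⟨h0, ht⟩
  have himg := hc.image_closure ⟨_, hmem, rfl⟩
  have hz' : pt (z 0) (f (z 0) + t * (g (z 0) - f (z 0))) = z := by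
    rw [← hz, pt_eta]
  simp only [hz'] at himg
  refine closure_mono ?_ himg
  rintro _ ⟨⟨x, s⟩, ⟨hx, hs⟩, rfl⟩
  have hpos := sub_pos.2 (h _ hx)
  refine ⟨by simpa using hx, ?_, ?_⟩ <;> simp only [pt_zero, pt_one]
  · nlinarith [mul_pos hs.1 hpos]
  · nlinarith [mul_pos (sub_pos.2 hs.2) hpos]

/-! ### Decompositions into strips -/

/-- For each vertex a vertical segment, and for each edge a strip between two graphs. -/
structure StripData (T : FGraph) where
  x : T.V → ℝ
  bot : T.V → ℝ
  top : T.V → ℝ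
  lo : T.E → ℝ → ℝ
  hi : T.E → ℝ → ℝ

namespace StripData

variable {T : FGraph} (S : StripData T)

/-- The segment of a vertex. -/
def seg (v : T.V) : Set Plane := vseg (S.x v) (S.bot v) (S.top v)

/-- The strip of an edge, without its two ends. -/
def strip (e : T.E) : Set Plane :=
  {z | z 0 ∈ Ioo (S.x (T.src e)) (S.x (T.tgt e)) ∧ S.lo e (z 0) ≤ z 1 ∧ z 1 ≤ S.hi e (z 0)}

/-- The strip of an edge with its two ends. -/
def cstrip (e : T.E) : Set Plane := cbetween (S.x (T.src e)) (S.x (T.tgt e)) (S.lo e) (S.hi e)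

/-- The interior of the strip of an edge. -/
def ostrip (e : T.E) : Set Plane := obetween (S.x (T.src e)) (S.x (T.tgt e)) (S.lo e) (S.hi e)

/-- The set `K` is the disjoint union of the segments and strips, which fit together as in the
graph `T`. -/
structure Covers (K : Set Plane) : Prop where
  bot_le_top : ∀ v, S.bot v ≤ S.top v
  lt : ∀ e, S.x (T.src e) < S.x (T.tgt e)
  lo_cont : ∀ e, ContinuousOn (S.lo e) (Icc (S.x (T.src e)) (S.x (T.tgt e)))
  hi_cont : ∀ e, ContinuousOn (S.hi e) (Icc (S.x (T.src e)) (S.x (T.tgt e)))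
  lo_lt_hi : ∀ e, ∀ a ∈ Ioo (S.x (T.src e)) (S.x (T.tgt e)), S.lo e a < S.hi e a
  src_bot : ∀ e, S.bot (T.src e) ≤ S.lo e (S.x (T.src e))
  src_top : ∀ e, S.hi e (S.x (T.src e)) ≤ S.top (T.src e)
  tgt_bot : ∀ e, S.bot (T.tgt e) ≤ S.lo e (S.x (T.tgt e))
  tgt_top : ∀ e, S.hi e (S.x (T.tgt e)) ≤ S.top (T.tgt e)
  cover : ∀ z, z ∈ K ↔ (∃ v, z ∈ S.seg v) ∨ ∃ e, z ∈ S.strip e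
  seg_disj : ∀ v w z, z ∈ S.seg v → z ∈ S.seg w → v = w
  strip_disj : ∀ e f z, z ∈ S.strip e → z ∈ S.strip f → e = f
  seg_strip : ∀ v e z, z ∈ S.seg v → z ∉ S.strip e

variable {S} {K : Set Plane} (hS : S.Covers K)
include hS

theorem Covers.lo_le_hi (e : T.E) {a : ℝ} (ha : a ∈ Icc (S.x (T.src e)) (S.x (T.tgt e))) :
    S.lo e a ≤ S.hi e a := by
  have hcl : closure (Ioo (S.x (T.src e)) (S.x (T.tgt e))) = Icc _ _ := closure_Ioo (hS.lt e).ne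
  rw [← hcl] at ha
  have h1 := hS.lo_cont e
  have h2 := hS.hi_cont e
  rw [← hcl] at h1 h2
  exact le_on_closure (fun x hx => (hS.lo_lt_hi e x hx).le) h1 h2 ha

theorem Covers.strip_subset (e : T.E) : S.strip e ⊆ K := fun z hz => (hS.cover z).2 (.inr ⟨e, hz⟩)

theorem Covers.seg_subset (v : T.V) : S.seg v ⊆ K := fun z hz => (hS.cover z).2 (.inl ⟨v, hz⟩)

omit hS in
theorem strip_subset_cstrip (e : T.E) : S.strip e ⊆ S.cstrip e :=
  fun _ hz => ⟨Ioo_subset_Icc_self hz.1, hz.2⟩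

theorem Covers.mem_cstrip (e : T.E) {z : Plane} (hz : z ∈ S.cstrip e) :
    z ∈ S.strip e ∨ (z 0 = S.x (T.src e) ∧ z ∈ S.seg (T.src e)) ∨
      (z 0 = S.x (T.tgt e) ∧ z ∈ S.seg (T.tgt e)) := by
  obtain ⟨⟨h0, h0'⟩, h1, h2⟩ := hz
  rcases h0.eq_or_lt with h | h
  · right; left
    rw [← h] at h1 h2
    exact ⟨h.symm, h.symm, (hS.src_bot e).trans h1, h2.trans (hS.src_top e)⟩
  · rcases h0'.eq_or_lt with h' | h'
    · right; right
      rw [h'] at h1 h2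
      exact ⟨h', h', (hS.tgt_bot e).trans h1, h2.trans (hS.tgt_top e)⟩
    · exact .inl ⟨⟨h, h'⟩, h1, h2⟩

theorem Covers.cstrip_subset (e : T.E) : S.cstrip e ⊆ K := by
  intro z hz
  rcases hS.mem_cstrip e hz with h | ⟨-, h⟩ | ⟨-, h⟩
  exacts [hS.strip_subset e h, hS.seg_subset _ h, hS.seg_subset _ h]

theorem Covers.isClosed_cstrip (e : T.E) : IsClosed (S.cstrip e) :=
  isClosed_cbetween (hS.lo_cont e) (hS.hi_cont e)

omit hS in
theorem isClosed_seg (v : T.V) : IsClosed (S.seg v) := isClosed_vseg _ _ _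

/-- Near a point of a strip there are no other points than those of the strip. -/
theorem Covers.exists_ball {e : T.E} {z : Plane} (hz : z ∈ S.strip e) :
    ∃ δ > 0, ∀ w ∈ K, dist w z < δ → w ∈ S.strip e := by
  have := T.finite_V
  have := T.finite_E
  -- The other cells are enlarged to closed sets. The ends added to a strip lie in segments, so the
  -- finite union still misses `z`.
  let F : Set Plane := (⋃ v, S.seg v) ∪ ⋃ f : {f : T.E // f ≠ e}, S.cstrip f
  have hF : IsClosed F := (isClosed_iUnion_of_finite fun v => isClosed_seg v).union
    (isClosed_iUnion_of_finite fun f => hS.isClosed_cstrip f)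
  have hzF : z ∉ F := by
    rintro (h | h)
    · obtain ⟨v, hv⟩ := mem_iUnion.1 h
      exact hS.seg_strip v e z hv hz
    · obtain ⟨f, hf⟩ := mem_iUnion.1 h
      rcases hS.mem_cstrip f hf with h | ⟨-, h⟩ | ⟨-, h⟩
      exacts [f.2 (hS.strip_disj _ _ _ h hz), hS.seg_strip _ _ _ h hz, hS.seg_strip _ _ _ h hz]
  obtain ⟨δ, hδ, hb⟩ := Metric.isOpen_iff.1 hF.isOpen_compl z hzF
  refine ⟨δ, hδ, fun w hw hd => ?_⟩
  have hwF := hb (Metric.mem_ball.2 hd)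
  rcases (hS.cover w).1 hw with ⟨v, hv⟩ | ⟨f, hf⟩
  · exact absurd (.inl (mem_iUnion.2 ⟨v, hv⟩)) hwF
  · by_cases hfe : f = e
    · exact hfe ▸ hf
    · exact absurd (.inr (mem_iUnion.2 ⟨⟨f, hfe⟩, strip_subset_cstrip f hf⟩)) hwF

/-! ### Components of level sets -/

omit hS in
/-- The part of a cell at a given level. -/
def cellAt (S : StripData T) (t : ℝ) : T.V ⊕ T.E → Set Plane :=
  Sum.elim (fun v => {z | z ∈ S.seg v ∧ z 0 = t}) (fun e => {z | z ∈ S.strip e ∧ z 0 = t})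

omit hS in
theorem cellAt_eq (S : StripData T) (t : ℝ) (c : T.V ⊕ T.E) :
    S.cellAt t c = ∅ ∨ ∃ l h, S.cellAt t c = vseg t l h := by
  rcases c with v | e
  · by_cases ht : S.x v = t
    · right
      refine ⟨S.bot v, S.top v, ?_⟩
      ext z
      constructor
      · exact fun h => ⟨h.2, h.1.2⟩
      · exact fun h => ⟨⟨h.1.trans ht.symm, h.2⟩, h.1⟩
    · left
      ext z
      simp only [cellAt, Sum.elim_inl, mem_ofPred_eq, mem_empty_iff_false, iff_false]
      exact fun h => ht (h.1.1.symm.trans h.2)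
  · by_cases ht : t ∈ Ioo (S.x (T.src e)) (S.x (T.tgt e))
    · right
      refine ⟨S.lo e t, S.hi e t, ?_⟩
      ext z
      constructor
      · rintro ⟨⟨-, h⟩, rfl⟩
        exact ⟨rfl, h⟩
      · rintro ⟨rfl, h⟩
        exact ⟨⟨ht, h⟩, rfl⟩
    · left
      ext z
      simp only [cellAt, Sum.elim_inr, mem_ofPred_eq, mem_empty_iff_false, iff_false]
      rintro ⟨h, rfl⟩
      exact ht h.1

omit hS in
theorem isClosed_cellAt (S : StripData T) (t : ℝ) (c : T.V ⊕ T.E) : IsClosed (S.cellAt t c) := by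
  rcases S.cellAt_eq t c with h | ⟨l, h', h⟩ <;> rw [h]
  exacts [isClosed_empty, isClosed_vseg _ _ _]

omit hS in
theorem isPreconnected_cellAt (S : StripData T) (t : ℝ) (c : T.V ⊕ T.E) :
    IsPreconnected (S.cellAt t c) := by
  rcases S.cellAt_eq t c with h | ⟨l, h', h⟩ <;> rw [h]
  exacts [isPreconnected_empty, isPreconnected_vseg _ _ _]

theorem Covers.cellAt_disj {t : ℝ} {c c' : T.V ⊕ T.E} {z : Plane} (h : z ∈ S.cellAt t c)
    (h' : z ∈ S.cellAt t c') : c = c' := by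
  rcases c with v | e <;> rcases c' with v' | e'
  · rw [hS.seg_disj _ _ _ h.1 h'.1]
  · exact absurd h'.1 (hS.seg_strip _ _ _ h.1)
  · exact absurd h.1 (hS.seg_strip _ _ _ h'.1)
  · rw [hS.strip_disj _ _ _ h.1 h'.1]

theorem Covers.exists_cellAt {z : Plane} (hz : z ∈ K) : ∃ c, z ∈ S.cellAt (z 0) c := by
  rcases (hS.cover z).1 hz with ⟨v, hv⟩ | ⟨e, he⟩
  exacts [⟨.inl v, hv, rfl⟩, ⟨.inr e, he, rfl⟩]

theorem Covers.cellAt_subset (t : ℝ) (c : T.V ⊕ T.E) :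
    S.cellAt t c ⊆ K ∩ {z : Plane | z 0 = t} := by
  rcases c with v | e
  · exact fun z hz => ⟨hS.seg_subset v hz.1, hz.2⟩
  · exact fun z hz => ⟨hS.strip_subset e hz.1, hz.2⟩

/-- At a fixed level the cells are finitely many pairwise disjoint closed sets, each empty or a
vertical segment. A connected subset of their union cannot meet two of them, so the nonempty ones
are the components. -/
theorem Covers.component_eq {z : Plane} {c : T.V ⊕ T.E} (hz : z ∈ S.cellAt (z 0) c) :
    connectedComponentIn (K ∩ {w : Plane | w 0 = z 0}) z = S.cellAt (z 0) c := by
  have := T.finite_V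
  have := T.finite_E
  have hzK := hS.cellAt_subset _ _ hz
  apply Subset.antisymm
  · set C := connectedComponentIn (K ∩ {w : Plane | w 0 = z 0}) z with hC
    have hCp : IsPreconnected C := isPreconnected_connectedComponentIn
    have hzC : z ∈ C := mem_connectedComponentIn hzK
    have hCs : C ⊆ K ∩ {w : Plane | w 0 = z 0} := connectedComponentIn_subset _ _
    let F : Set Plane := ⋃ d : {d : T.V ⊕ T.E // d ≠ c}, S.cellAt (z 0) d
    have hF : IsClosed F := isClosed_iUnion_of_finite fun d => S.isClosed_cellAt _ _
    intro w hw
    by_contra hwc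
    have hcov : C ⊆ S.cellAt (z 0) c ∪ F := by
      intro y hy
      obtain ⟨hyK, hy0⟩ := hCs hy
      obtain ⟨d, hd⟩ := hS.exists_cellAt hyK
      rw [show y 0 = z 0 from hy0] at hd
      by_cases hdc : d = c
      · exact .inl (hdc ▸ hd)
      · exact .inr (mem_iUnion.2 ⟨⟨d, hdc⟩, hd⟩)
    obtain ⟨y, -, hy1, hy2⟩ := isPreconnected_closed_iff.1 hCp _ _ (S.isClosed_cellAt _ c) hF hcov
      ⟨z, hzC, hz⟩ ⟨w, hw, (hcov hw).resolve_left hwc⟩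
    obtain ⟨d, hd⟩ := mem_iUnion.1 hy2
    exact d.2 (hS.cellAt_disj hd hy1)
  · exact (S.isPreconnected_cellAt _ _).subset_connectedComponentIn hz (hS.cellAt_subset _ _)

end StripData

end SSRegions
end

/-! ### The Poincaré-Reeb graph of a region which is decomposed into strips -/

noncomputable section
namespace SSRegions

open Set

namespace FGraph

variable (T : FGraph)

/-- A point of an edge as a point of the geometric realization. -/
def edgePoint (e : T.E) (t : unitInterval) : T.Realization := Quot.mk T.Glue (Sum.inr ⟨e, t⟩)

theorem edgePoint_zero (e : T.E) : T.edgePoint e 0 = T.vertexPoint (T.src e) := Quot.sound (.src e)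

theorem edgePoint_one (e : T.E) : T.edgePoint e 1 = T.vertexPoint (T.tgt e) := Quot.sound (.tgt e)

theorem continuous_edgePoint (e : T.E) : Continuous (T.edgePoint e) :=
  continuous_quot_mk.comp (continuous_inr.comp (continuous_sigmaMk (σ := fun _ : T.E => unitInterval)))

end FGraph

namespace StripData

variable {T : FGraph} (S : StripData T)

/-- The position of a level in an edge. -/
def param (e : T.E) (t : ℝ) : unitInterval :=
  projIcc 0 1 zero_le_one ((t - S.x (T.src e)) / (S.x (T.tgt e) - S.x (T.src e)))

theorem continuous_param (e : T.E) : Continuous (S.param e) :=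
  continuous_projIcc.comp (by fun_prop)

theorem param_src (e : T.E) : S.param e (S.x (T.src e)) = 0 := by
  simp [param]

variable {S} {K : Set Plane}

theorem Covers.param_tgt (hS : S.Covers K) (e : T.E) : S.param e (S.x (T.tgt e)) = 1 := by
  have := sub_ne_zero.2 (hS.lt e).ne'
  simp [param, div_self this]

theorem Covers.param_level (hS : S.Covers K) (e : T.E) (t : unitInterval) :
    S.param e (S.x (T.src e) + t * (S.x (T.tgt e) - S.x (T.src e))) = t := by
  have := sub_ne_zero.2 (hS.lt e).ne'
  rw [param, add_sub_cancel_left, mul_div_cancel_right₀ _ this, projIcc_val]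

/-- The map to the geometric realization. -/
def Covers.toRealization (hS : S.Covers K) (z : K) : T.Realization :=
  Sum.elim T.vertexPoint (fun e => T.edgePoint e (S.param e ((z : Plane) 0)))
    (hS.exists_cellAt z.2).choose

theorem Covers.toRealization_of_cellAt (hS : S.Covers K) (z : K) {c : T.V ⊕ T.E}
    (h : (z : Plane) ∈ S.cellAt ((z : Plane) 0) c) : hS.toRealization z =
      Sum.elim T.vertexPoint (fun e => T.edgePoint e (S.param e ((z : Plane) 0))) c := by
  rw [toRealization, hS.cellAt_disj (hS.exists_cellAt z.2).choose_spec h]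

theorem Covers.toRealization_seg (hS : S.Covers K) (z : K) {v : T.V} (h : (z : Plane) ∈ S.seg v) :
    hS.toRealization z = T.vertexPoint v :=
  hS.toRealization_of_cellAt z (c := .inl v) ⟨h, rfl⟩

/-- At the two ends the parameter is 0 or 1, and the gluing in the realization identifies these
points with the vertices to which the end segments are sent. -/
theorem Covers.toRealization_cstrip (hS : S.Covers K) (z : K) {e : T.E}
    (h : (z : Plane) ∈ S.cstrip e) :
    hS.toRealization z = T.edgePoint e (S.param e ((z : Plane) 0)) := by
  rcases hS.mem_cstrip e h with h | ⟨h0, h⟩ | ⟨h0, h⟩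
  · exact hS.toRealization_of_cellAt z (c := .inr e) ⟨h, rfl⟩
  · rw [hS.toRealization_seg z h, h0, S.param_src, T.edgePoint_zero]
  · rw [hS.toRealization_seg z h, h0, hS.param_tgt, T.edgePoint_one]

/-- Segments and closed strips form a finite closed cover, and on each of its members the map is
visibly continuous. -/
theorem Covers.continuous_toRealization (hS : S.Covers K) : Continuous hS.toRealization := by
  have := T.finite_V
  have := T.finite_E
  let F : T.V ⊕ T.E → Set K := Sum.elim (fun v => Subtype.val ⁻¹' S.seg v)
    (fun e => Subtype.val ⁻¹' S.cstrip e)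
  have hF : LocallyFinite F := locallyFinite_of_finite F
  refine hF.continuous ?_ ?_ ?_
  · refine eq_univ_of_forall fun z => mem_iUnion.2 ?_
    rcases (hS.cover z).1 z.2 with ⟨v, hv⟩ | ⟨e, he⟩
    exacts [⟨.inl v, hv⟩, ⟨.inr e, strip_subset_cstrip e he⟩]
  · rintro (v | e)
    exacts [(isClosed_seg v).preimage continuous_subtype_val,
      (hS.isClosed_cstrip e).preimage continuous_subtype_val]
  · rintro (v | e)
    · exact continuousOn_const.congr fun z hz => hS.toRealization_seg z hz
    · refine ContinuousOn.congr (Continuous.continuousOn ?_)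
        fun z hz => hS.toRealization_cstrip z hz
      exact (T.continuous_edgePoint e).comp ((S.continuous_param e).comp
        ((continuous_coord 0).comp continuous_subtype_val))

end StripData

theorem SSRegion.toReeb_eq_iff (R : SSRegion) (i : Fin 2) (z w : closure R.domain) :
    R.toReeb i z = R.toReeb i w ↔ R.levelComponent i z = R.levelComponent i w := by
  refine Quotient.eq.trans ?_
  exact Iff.rfl

theorem SSRegion.continuous_toReeb (R : SSRegion) (i : Fin 2) : Continuous (R.toReeb i) :=
  continuous_quotient_mk'

theorem SSRegion.mem_levelComponent (R : SSRegion) (i : Fin 2) (z : closure R.domain) :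
    (z : Plane) ∈ R.levelComponent i z := mem_connectedComponentIn ⟨z.2, rfl⟩

theorem SSRegion.levelComponent_subset (R : SSRegion) (i : Fin 2) (z : closure R.domain) :
    R.levelComponent i z ⊆ closure R.domain ∩ {w : Plane | w i = (z : Plane) i} :=
  connectedComponentIn_subset _ _

namespace StripData

variable {T : FGraph} {S : StripData T} {R : SSRegion} (hS : S.Covers (closure R.domain))
include hS

theorem Covers.toReeb_eq {z w : closure R.domain} {c : T.V ⊕ T.E}
    (hz : (z : Plane) ∈ S.cellAt ((z : Plane) 0) c)
    (hw : (w : Plane) ∈ S.cellAt ((w : Plane) 0) c) (h : (z : Plane) 0 = (w : Plane) 0) :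
    R.toReeb 0 z = R.toReeb 0 w := by
  rw [R.toReeb_eq_iff]
  refine (hS.component_eq hz).trans (Eq.trans ?_ (hS.component_eq hw).symm)
  rw [h]

theorem Covers.toReeb_seg {z w : closure R.domain} {v : T.V} (hz : (z : Plane) ∈ S.seg v)
    (hw : (w : Plane) ∈ S.seg v) : R.toReeb 0 z = R.toReeb 0 w :=
  hS.toReeb_eq (c := .inl v) ⟨hz, rfl⟩ ⟨hw, rfl⟩ (hz.1.trans hw.1.symm)

theorem Covers.toReeb_strip {z w : closure R.domain} {e : T.E} (hz : (z : Plane) ∈ S.strip e)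
    (hw : (w : Plane) ∈ S.strip e) (h : (z : Plane) 0 = (w : Plane) 0) :
    R.toReeb 0 z = R.toReeb 0 w :=
  hS.toReeb_eq (c := .inr e) ⟨hz, rfl⟩ ⟨hw, rfl⟩ h

theorem Covers.toRealization_eq {z w : closure R.domain} (h : R.toReeb 0 z = R.toReeb 0 w) :
    hS.toRealization z = hS.toRealization w := by
  rw [R.toReeb_eq_iff] at h
  obtain ⟨c, hc⟩ := hS.exists_cellAt z.2
  have hw := R.mem_levelComponent 0 w
  rw [← h] at hw
  have h0 : (w : Plane) 0 = (z : Plane) 0 := (R.levelComponent_subset 0 z hw).2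
  have hw' : (w : Plane) ∈ S.cellAt ((z : Plane) 0) c := (hS.component_eq hc).subset hw
  have hw'' := hw'
  rw [← h0] at hw''
  rw [hS.toRealization_of_cellAt z hc, hS.toRealization_of_cellAt w hw'', h0]

/-- A point of the segment of a vertex. -/
def Covers.vertexRep (v : T.V) : closure R.domain :=
  ⟨pt (S.x v) (S.bot v), hS.seg_subset v ⟨pt_zero _ _, (pt_one _ _).ge,
    (pt_one _ _).trans_le (hS.bot_le_top v)⟩⟩

theorem Covers.vertexRep_mem (v : T.V) : (hS.vertexRep v : Plane) ∈ S.seg v :=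
  ⟨pt_zero _ _, (pt_one _ _).ge, (pt_one _ _).trans_le (hS.bot_le_top v)⟩

omit hS in
/-- The middle point of a strip at a level. -/
def mid (S : StripData T) (e : T.E) (t : unitInterval) : Plane :=
  let a := S.x (T.src e) + t * (S.x (T.tgt e) - S.x (T.src e))
  pt a ((S.lo e a + S.hi e a) / 2)

omit hS in
theorem mid_zero (S : StripData T) (e : T.E) (t : unitInterval) :
    S.mid e t 0 = S.x (T.src e) + t * (S.x (T.tgt e) - S.x (T.src e)) := pt_zero _ _

omit hS in
theorem Covers.level_mem {K : Set Plane} (hS : S.Covers K) (e : T.E) (t : unitInterval) :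
    S.x (T.src e) + t * (S.x (T.tgt e) - S.x (T.src e)) ∈
      Icc (S.x (T.src e)) (S.x (T.tgt e)) := by
  have h := sub_pos.2 (hS.lt e)
  have h0 := t.2.1
  have h1 := t.2.2
  constructor <;> nlinarith

theorem Covers.mid_mem (e : T.E) (t : unitInterval) : S.mid e t ∈ S.cstrip e := by
  have ha := hS.level_mem e t
  have h := hS.lo_le_hi e ha
  refine ⟨by rwa [mid_zero], ?_, ?_⟩ <;> rw [mid_zero] <;> simp only [mid, pt_one] <;> linarith

/-- The inverse map, from the geometric realization to the Poincaré-Reeb graph. -/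
def Covers.ofRealization : T.Realization → R.ReebSpace 0 :=
  Quot.lift (Sum.elim (fun v => R.toReeb 0 (hS.vertexRep v.1))
      (fun x => R.toReeb 0 ⟨S.mid x.1 x.2, hS.cstrip_subset _ (hS.mid_mem x.1 x.2)⟩)) (by
    rintro _ _ (e | e)
    · refine hS.toReeb_seg (v := T.src e) ?_ (hS.vertexRep_mem _)
      have h0 : S.mid e 0 0 = S.x (T.src e) := by simp [mid_zero]
      rcases hS.mem_cstrip e (hS.mid_mem e 0) with h | ⟨-, h⟩ | ⟨h, -⟩
      · exact absurd h0 h.1.1.ne'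
      · exact h
      · exact absurd (h0.symm.trans h) (hS.lt e).ne
    · refine hS.toReeb_seg (v := T.tgt e) ?_ (hS.vertexRep_mem _)
      have h0 : S.mid e 1 0 = S.x (T.tgt e) := by simp [mid_zero]
      rcases hS.mem_cstrip e (hS.mid_mem e 1) with h | ⟨h, -⟩ | ⟨-, h⟩
      · exact absurd h0 h.1.2.ne
      · exact absurd (h.symm.trans h0) (hS.lt e).ne
      · exact h)

theorem Covers.continuous_ofRealization : Continuous hS.ofRealization := by
  refine continuous_quot_lift _ (continuous_sumElim.2 ⟨?_, ?_⟩)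
  · exact continuous_sigma fun v => continuous_of_discreteTopology
  · refine continuous_sigma fun e => (R.continuous_toReeb 0).comp ?_
    refine Continuous.subtype_mk ?_ _
    have ha : Continuous (fun t : unitInterval =>
        S.x (T.src e) + t * (S.x (T.tgt e) - S.x (T.src e))) := by fun_prop
    have h1 := (hS.lo_cont e).comp_continuous ha (hS.level_mem e)
    have h2 := (hS.hi_cont e).comp_continuous ha (hS.level_mem e)
    exact continuous_pt.comp (ha.prodMk ((h1.add h2).div_const 2))

theorem Covers.ofRealization_toRealization (z : closure R.domain) :
    hS.ofRealization (hS.toRealization z) = R.toReeb 0 z := by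
  rcases (hS.cover z).1 z.2 with ⟨v, hv⟩ | ⟨e, he⟩
  · rw [hS.toRealization_seg z hv]
    exact hS.toReeb_seg (hS.vertexRep_mem v) hv
  · rw [hS.toRealization_cstrip z (strip_subset_cstrip e he)]
    have h0 : S.mid e (S.param e ((z : Plane) 0)) 0 = (z : Plane) 0 := by
      have h := he.1
      have hpos := sub_pos.2 (hS.lt e)
      rw [mid_zero, param, coe_projIcc, min_eq_right, max_eq_right]
      · field_simp
        ring
      · exact div_nonneg (sub_nonneg.2 h.1.le) hpos.le
      · rw [div_le_one hpos]
        exact sub_le_sub_right h.2.le _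
    refine hS.toReeb_strip ?_ he h0
    rcases hS.mem_cstrip e (hS.mid_mem e (S.param e ((z : Plane) 0))) with h | ⟨h, -⟩ | ⟨h, -⟩
    · exact h
    · exact absurd (h0.symm.trans h) he.1.1.ne'
    · exact absurd (h0.symm.trans h) he.1.2.ne

/-- The geometric realization is homeomorphic to the Poincaré-Reeb graph. -/
def Covers.homeo : T.Realization ≃ₜ R.ReebSpace 0 where
  toFun := hS.ofRealization
  invFun := Quotient.lift hS.toRealization fun z w h =>
    hS.toRealization_eq ((R.toReeb_eq_iff 0 z w).2 h)
  left_inv := by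
    rintro ⟨v | ⟨e, t⟩⟩
    · exact hS.toRealization_seg _ (hS.vertexRep_mem _)
    · refine (hS.toRealization_cstrip ⟨S.mid e t, _⟩ (hS.mid_mem e t)).trans ?_
      rw [mid_zero, hS.param_level]
      rfl
  right_inv := by
    rintro ⟨z⟩
    exact hS.ofRealization_toRealization z
  continuous_toFun := hS.continuous_ofRealization
  -- The Reeb space carries the quotient topology, so continuity can be checked on the closure of
  -- the region. With explicit continuous maps in both directions no compactness argument is needed.
  continuous_invFun := hS.continuous_toRealization.quotient_lift _

theorem Covers.hasPoincareReebGraph (hv : ∀ v, ∃ z ∈ S.seg v, R.IsSingular 0 z)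
    (hs : ∀ z, R.IsSingular 0 z → ∃ v, z ∈ S.seg v) : HasPoincareReebGraph R T := by
  refine ⟨hS.homeo, ?_⟩
  ext c
  constructor
  · rintro ⟨_, ⟨v, rfl⟩, rfl⟩
    obtain ⟨z, hz, hsing⟩ := hv v
    exact ⟨⟨z, hS.seg_subset v hz⟩, hsing, hS.toReeb_seg hz (hS.vertexRep_mem v)⟩
  · rintro ⟨z, hz, rfl⟩
    obtain ⟨v, hv⟩ := hs z hz
    exact ⟨_, ⟨v, rfl⟩, hS.toReeb_seg (hS.vertexRep_mem v) hv⟩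

end StripData

end SSRegions
end

/-! ### Operations on strip decompositions, and the inductive invariant -/

noncomputable section
namespace SSRegions

open Set

theorem FGraph.split_src_self (T : FGraph) (e : T.E) : (T.split e).src (some e) = none := by
  simp [FGraph.split]

theorem FGraph.split_src_of_ne (T : FGraph) {e f : T.E} (h : f ≠ e) :
    (T.split e).src (some f) = some (T.src f) := by
  simp [FGraph.split, h]

namespace StripData

variable {T : FGraph} (S : StripData T)

/-! ### Cutting a strip -/

/-- The strip of `e` is cut at the level `a`. -/
def split (e : T.E) (a : ℝ) : StripData (T.split e) where
  x := fun o => o.elim a S.x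
  bot := fun o => o.elim (S.lo e a) S.bot
  top := fun o => o.elim (S.hi e a) S.top
  lo := fun o => o.elim (S.lo e) S.lo
  hi := fun o => o.elim (S.hi e) S.hi

variable {S} {e : T.E} {a : ℝ}

theorem split_x_src_self : (S.split e a).x ((T.split e).src (some e)) = a := by
  rw [T.split_src_self]; rfl

theorem split_x_src_of_ne {f : T.E} (h : f ≠ e) :
    (S.split e a).x ((T.split e).src (some f)) = S.x (T.src f) := by
  rw [T.split_src_of_ne h]; rfl

theorem mem_split_strip_none (ha : a < S.x (T.tgt e)) {z : Plane} :
    z ∈ (S.split e a).strip none ↔ z ∈ S.strip e ∧ z 0 < a := by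
  constructor
  · rintro ⟨⟨h0, h1⟩, h⟩
    exact ⟨⟨⟨h0, lt_trans h1 ha⟩, h⟩, h1⟩
  · rintro ⟨⟨⟨h0, -⟩, h⟩, h1⟩
    exact ⟨⟨h0, h1⟩, h⟩

theorem mem_split_strip_self (ha : S.x (T.src e) < a) {z : Plane} :
    z ∈ (S.split e a).strip (some e) ↔ z ∈ S.strip e ∧ a < z 0 := by
  unfold strip
  simp only [mem_ofPred_eq, split_x_src_self]
  constructor
  · rintro ⟨⟨h0, h1⟩, h⟩
    exact ⟨⟨⟨ha.trans h0, h1⟩, h⟩, h0⟩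
  · rintro ⟨⟨⟨-, h0⟩, h⟩, h1⟩
    exact ⟨⟨h1, h0⟩, h⟩

theorem mem_split_strip_of_ne {f : T.E} (hf : f ≠ e) {z : Plane} :
    z ∈ (S.split e a).strip (some f) ↔ z ∈ S.strip f := by
  unfold strip
  simp only [mem_ofPred_eq, split_x_src_of_ne hf]
  exact Iff.rfl

theorem mem_split_seg_none (ha : a ∈ Ioo (S.x (T.src e)) (S.x (T.tgt e))) {z : Plane} :
    z ∈ (S.split e a).seg none ↔ z ∈ S.strip e ∧ z 0 = a := by
  constructor
  · rintro ⟨h0, h⟩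
    change z 0 = a at h0
    subst h0
    exact ⟨⟨ha, h⟩, rfl⟩
  · rintro ⟨⟨-, h⟩, rfl⟩
    exact ⟨rfl, h⟩

variable {K : Set Plane}

theorem Covers.split (hS : S.Covers K) (ha : a ∈ Ioo (S.x (T.src e)) (S.x (T.tgt e))) :
    (S.split e a).Covers K where
  bot_le_top := by
    rintro (_ | v)
    exacts [(hS.lo_lt_hi e a ha).le, hS.bot_le_top v]
  lt := by
    rintro (_ | f)
    · exact ha.1
    · by_cases hf : f = e
      · subst hf
        exact split_x_src_self.trans_lt ha.2
      · exact (split_x_src_of_ne hf).trans_lt (hS.lt f)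
  lo_cont := by
    rintro (_ | f)
    · exact (hS.lo_cont e).mono (Icc_subset_Icc_right ha.2.le)
    · by_cases hf : f = e
      · subst hf
        rw [split_x_src_self]
        exact (hS.lo_cont f).mono (Icc_subset_Icc_left ha.1.le)
      · rw [split_x_src_of_ne hf]
        exact hS.lo_cont f
  hi_cont := by
    rintro (_ | f)
    · exact (hS.hi_cont e).mono (Icc_subset_Icc_right ha.2.le)
    · by_cases hf : f = e
      · subst hf
        rw [split_x_src_self]
        exact (hS.hi_cont f).mono (Icc_subset_Icc_left ha.1.le)
      · rw [split_x_src_of_ne hf]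
        exact hS.hi_cont f
  lo_lt_hi := by
    rintro (_ | f) b hb
    · exact hS.lo_lt_hi e b ⟨hb.1, lt_trans hb.2 ha.2⟩
    · by_cases hf : f = e
      · subst hf
        rw [split_x_src_self] at hb
        exact hS.lo_lt_hi f b ⟨ha.1.trans hb.1, hb.2⟩
      · rw [split_x_src_of_ne hf] at hb
        exact hS.lo_lt_hi f b hb
  src_bot := by
    rintro (_ | f)
    · exact hS.src_bot e
    · by_cases hf : f = e
      · subst hf
        rw [T.split_src_self]
        exact le_rfl
      · rw [T.split_src_of_ne hf]
        exact hS.src_bot f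
  src_top := by
    rintro (_ | f)
    · exact hS.src_top e
    · by_cases hf : f = e
      · subst hf
        rw [T.split_src_self]
        exact le_rfl
      · rw [T.split_src_of_ne hf]
        exact hS.src_top f
  tgt_bot := by
    rintro (_ | f)
    exacts [le_rfl, hS.tgt_bot f]
  tgt_top := by
    rintro (_ | f)
    exacts [le_rfl, hS.tgt_top f]
  cover := by
    intro z
    rw [hS.cover]
    constructor
    · rintro (⟨v, hv⟩ | ⟨f, hf⟩)
      · exact .inl ⟨some v, hv⟩
      · by_cases hfe : f = e
        · subst hfe
          rcases lt_trichotomy (z 0) a with h | h | h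
          · exact .inr ⟨none, (mem_split_strip_none ha.2).2 ⟨hf, h⟩⟩
          · exact .inl ⟨none, (mem_split_seg_none ha).2 ⟨hf, h⟩⟩
          · exact .inr ⟨some f, (mem_split_strip_self ha.1).2 ⟨hf, h⟩⟩
        · exact .inr ⟨some f, (mem_split_strip_of_ne hfe).2 hf⟩
    · rintro (⟨_ | v, hv⟩ | ⟨_ | f, hf⟩)
      · exact .inr ⟨e, ((mem_split_seg_none ha).1 hv).1⟩
      · exact .inl ⟨v, hv⟩
      · exact .inr ⟨e, ((mem_split_strip_none ha.2).1 hf).1⟩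
      · by_cases hfe : f = e
        · subst hfe
          exact .inr ⟨f, ((mem_split_strip_self ha.1).1 hf).1⟩
        · exact .inr ⟨f, (mem_split_strip_of_ne hfe).1 hf⟩
  seg_disj := by
    rintro (_ | v) (_ | w) z hv hw
    · rfl
    · exact absurd ((mem_split_seg_none ha).1 hv).1 (hS.seg_strip _ _ _ hw)
    · exact absurd ((mem_split_seg_none ha).1 hw).1 (hS.seg_strip _ _ _ hv)
    · exact congrArg some (hS.seg_disj v w z hv hw)
  strip_disj := by
    have key : ∀ f z, z ∈ (S.split e a).strip (some f) → z ∈ S.strip f := by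
      intro f z h
      by_cases hfe : f = e
      · subst hfe
        exact ((mem_split_strip_self ha.1).1 h).1
      · exact (mem_split_strip_of_ne hfe).1 h
    have key' : ∀ f z, z ∈ (S.split e a).strip (some f) → z ∉ (S.split e a).strip none := by
      intro f z h h'
      obtain ⟨h1, h2⟩ := (mem_split_strip_none ha.2).1 h'
      obtain rfl := hS.strip_disj _ _ _ h1 (key f z h)
      exact lt_asymm h2 ((mem_split_strip_self ha.1).1 h).2
    rintro (_ | f) (_ | g) z hf hg
    · rfl
    · exact absurd hf (key' g z hg)
    · exact absurd hg (key' f z hf)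
    · exact congrArg some (hS.strip_disj _ _ z (key f z hf) (key g z hg))
  seg_strip := by
    have key : ∀ f z, z ∈ (S.split e a).strip f → ∃ g, z ∈ S.strip g := by
      rintro (_ | f) z h
      · exact ⟨e, ((mem_split_strip_none ha.2).1 h).1⟩
      · by_cases hfe : f = e
        · subst hfe
          exact ⟨f, ((mem_split_strip_self ha.1).1 h).1⟩
        · exact ⟨f, (mem_split_strip_of_ne hfe).1 h⟩
    rintro (_ | v) f z hv hf
    · obtain ⟨h1, h2⟩ := (mem_split_seg_none ha).1 hv
      rcases f with _ | f
      · exact ((mem_split_strip_none ha.2).1 hf).2.ne h2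
      · by_cases hfe : f = e
        · subst hfe
          exact ((mem_split_strip_self ha.1).1 hf).2.ne' h2
        · exact hfe (hS.strip_disj _ _ _ ((mem_split_strip_of_ne hfe).1 hf) h1)
    · obtain ⟨g, hg⟩ := key f z hf
      exact hS.seg_strip v g z hv hg

/-! ### Lowering the upper boundary of a strip -/

variable (S) in
open Classical in
/-- The upper boundary of the strip of `e` is replaced by the graph of `h`. -/
def lower (e : T.E) (h : ℝ → ℝ) : StripData T :=
  { S with hi := fun f => if f = e then h else S.hi f }

variable {h : ℝ → ℝ}

theorem lower_hi_self : (S.lower e h).hi e = h := by simp [lower]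

theorem lower_hi_of_ne {f : T.E} (hf : f ≠ e) : (S.lower e h).hi f = S.hi f := by simp [lower, hf]

theorem mem_lower_strip_self {z : Plane} : z ∈ (S.lower e h).strip e ↔
    z 0 ∈ Ioo (S.x (T.src e)) (S.x (T.tgt e)) ∧ S.lo e (z 0) ≤ z 1 ∧ z 1 ≤ h (z 0) := by
  unfold strip
  rw [lower_hi_self]
  exact Iff.rfl

theorem mem_lower_strip_of_ne {f : T.E} (hf : f ≠ e) {z : Plane} :
    z ∈ (S.lower e h).strip f ↔ z ∈ S.strip f := by
  unfold strip
  rw [lower_hi_of_ne hf]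
  exact Iff.rfl

/-- Only points of the open strip of `e` are deleted, so all other cells persist. The new boundary
may touch the old one, and at the corners it does. -/
theorem Covers.lower (hS : S.Covers K)
    (hc : ContinuousOn h (Icc (S.x (T.src e)) (S.x (T.tgt e))))
    (hlo : ∀ t ∈ Ioo (S.x (T.src e)) (S.x (T.tgt e)), S.lo e t < h t)
    (hle : ∀ t ∈ Icc (S.x (T.src e)) (S.x (T.tgt e)), h t ≤ S.hi e t) :
    (S.lower e h).Covers (K \ {z | z ∈ S.strip e ∧ h (z 0) < z 1}) := by
  have hsub : ∀ f z, z ∈ (S.lower e h).strip f → z ∈ S.strip f := by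
    intro f z hz
    by_cases hf : f = e
    · subst hf
      obtain ⟨h0, h1, h2⟩ := mem_lower_strip_self.1 hz
      exact ⟨h0, h1, h2.trans (hle _ (Ioo_subset_Icc_self h0))⟩
    · exact (mem_lower_strip_of_ne hf).1 hz
  have hin : ∀ f, (S.lower e h).hi f (S.x (T.src f)) ≤ S.hi f (S.x (T.src f)) ∧
      (S.lower e h).hi f (S.x (T.tgt f)) ≤ S.hi f (S.x (T.tgt f)) := by
    intro f
    by_cases hf : f = e
    · subst hf
      rw [lower_hi_self]
      exact ⟨hle _ ⟨le_rfl, (hS.lt f).le⟩, hle _ ⟨(hS.lt f).le, le_rfl⟩⟩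
    · rw [lower_hi_of_ne hf]
      exact ⟨le_rfl, le_rfl⟩
  refine ⟨hS.bot_le_top, hS.lt, hS.lo_cont, ?_, ?_, hS.src_bot, fun f =>
    (hin f).1.trans (hS.src_top f), hS.tgt_bot, fun f => (hin f).2.trans (hS.tgt_top f), ?_,
    hS.seg_disj, fun f g z hf hg => hS.strip_disj f g z (hsub f z hf) (hsub g z hg),
    fun v f z hv hf => hS.seg_strip v f z hv (hsub f z hf)⟩
  · intro f
    by_cases hf : f = e
    · subst hf
      rw [lower_hi_self]
      exact hc
    · rw [lower_hi_of_ne hf]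
      exact hS.hi_cont f
  · intro f
    by_cases hf : f = e
    · subst hf
      rw [lower_hi_self]
      exact hlo
    · rw [lower_hi_of_ne hf]
      exact hS.lo_lt_hi f
  · intro z
    rw [mem_sdiff, hS.cover]
    constructor
    · rintro ⟨⟨v, hv⟩ | ⟨f, hf⟩, hn⟩
      · exact .inl ⟨v, hv⟩
      · refine .inr ⟨f, ?_⟩
        by_cases hfe : f = e
        · subst hfe
          exact mem_lower_strip_self.2 ⟨hf.1, hf.2.1, not_lt.1 fun hlt => hn ⟨hf, hlt⟩⟩
        · exact (mem_lower_strip_of_ne hfe).2 hf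
    · rintro (⟨v, hv⟩ | ⟨f, hf⟩)
      · exact ⟨.inl ⟨v, hv⟩, fun hz => hS.seg_strip v e z hv hz.1⟩
      · refine ⟨.inr ⟨f, hsub f z hf⟩, fun hz => ?_⟩
        obtain rfl := hS.strip_disj _ _ _ (hsub f z hf) hz.1
        exact hz.2.not_ge (mem_lower_strip_self.1 hf).2.2

/-! ### Attaching a strip -/

variable (S) in
/-- A strip is attached to the segment of the vertex `v`. -/
def sprout (v : T.V) (b : ℝ) (f g : ℝ → ℝ) : StripData (T.sprout v) where
  x := fun o => o.elim b S.x
  bot := fun o => o.elim (f b) S.bot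
  top := fun o => o.elim (g b) S.top
  lo := fun o => o.elim f S.lo
  hi := fun o => o.elim g S.hi

/-- The added set is half open on the left: its left end is already part of the segment of `v`. The
right end `b` becomes the segment of the new leaf and may be a single point. -/
theorem Covers.sprout (hS : S.Covers K) (v : T.V) {b : ℝ} {f g : ℝ → ℝ} (hb : S.x v < b)
    (hf : ContinuousOn f (Icc (S.x v) b)) (hg : ContinuousOn g (Icc (S.x v) b))
    (hfg : ∀ t ∈ Ioo (S.x v) b, f t < g t) (hbot : S.bot v ≤ f (S.x v))
    (htop : g (S.x v) ≤ S.top v) (hfb : f b ≤ g b)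
    (hdisj : ∀ z : Plane, z 0 ∈ Ioc (S.x v) b → f (z 0) ≤ z 1 → z 1 ≤ g (z 0) → z ∉ K) :
    (S.sprout v b f g).Covers (K ∪ {z | z 0 ∈ Ioc (S.x v) b ∧ f (z 0) ≤ z 1 ∧ z 1 ≤ g (z 0)}) := by
  have hseg : ∀ z, z ∈ (S.sprout v b f g).seg none →
      z 0 ∈ Ioc (S.x v) b ∧ f (z 0) ≤ z 1 ∧ z 1 ≤ g (z 0) := by
    rintro z ⟨h0, h1⟩
    change z 0 = b at h0
    subst h0
    exact ⟨⟨hb, le_rfl⟩, h1⟩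
  have hstrip : ∀ z, z ∈ (S.sprout v b f g).strip none →
      z 0 ∈ Ioc (S.x v) b ∧ f (z 0) ≤ z 1 ∧ z 1 ≤ g (z 0) :=
    fun z hz => ⟨⟨hz.1.1, hz.1.2.le⟩, hz.2⟩
  refine ⟨?_, ?_, ?_, ?_, ?_, ?_, ?_, ?_, ?_, ?_, ?_, ?_, ?_⟩
  · rintro (_ | w)
    exacts [hfb, hS.bot_le_top w]
  · rintro (_ | e)
    exacts [hb, hS.lt e]
  · rintro (_ | e)
    exacts [hf, hS.lo_cont e]
  · rintro (_ | e)
    exacts [hg, hS.hi_cont e]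
  · rintro (_ | e)
    exacts [hfg, hS.lo_lt_hi e]
  · rintro (_ | e)
    exacts [hbot, hS.src_bot e]
  · rintro (_ | e)
    exacts [htop, hS.src_top e]
  · rintro (_ | e)
    exacts [le_rfl, hS.tgt_bot e]
  · rintro (_ | e)
    exacts [le_rfl, hS.tgt_top e]
  · intro z
    rw [mem_union, hS.cover]
    constructor
    · rintro ((⟨w, hw⟩ | ⟨e, he⟩) | ⟨h0, h1⟩)
      · exact .inl ⟨some w, hw⟩
      · exact .inr ⟨some e, he⟩
      · rcases h0.2.eq_or_lt with h | h
        · subst h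
          exact .inl ⟨none, rfl, h1⟩
        · exact .inr ⟨none, ⟨h0.1, h⟩, h1⟩
    · rintro (⟨_ | w, hw⟩ | ⟨_ | e, he⟩)
      · exact .inr (hseg z hw)
      · exact .inl (.inl ⟨w, hw⟩)
      · exact .inr (hstrip z he)
      · exact .inl (.inr ⟨e, he⟩)
  · rintro (_ | w) (_ | w') z hz hz'
    · rfl
    · obtain ⟨h0, h1, h2⟩ := hseg z hz
      exact absurd (hS.seg_subset w' hz') (hdisj z h0 h1 h2)
    · obtain ⟨h0, h1, h2⟩ := hseg z hz'
      exact absurd (hS.seg_subset w hz) (hdisj z h0 h1 h2)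
    · exact congrArg some (hS.seg_disj w w' z hz hz')
  · rintro (_ | w) (_ | w') z hz hz'
    · rfl
    · obtain ⟨h0, h1, h2⟩ := hstrip z hz
      exact absurd (hS.strip_subset w' hz') (hdisj z h0 h1 h2)
    · obtain ⟨h0, h1, h2⟩ := hstrip z hz'
      exact absurd (hS.strip_subset w hz) (hdisj z h0 h1 h2)
    · exact congrArg some (hS.strip_disj w w' z hz hz')
  · rintro (_ | w) (_ | w') z hz hz'
    · exact hz'.1.2.ne hz.1
    · obtain ⟨h0, h1, h2⟩ := hseg z hz
      exact absurd (hS.strip_subset w' hz') (hdisj z h0 h1 h2)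
    · obtain ⟨h0, h1, h2⟩ := hstrip z hz'
      exact absurd (hS.seg_subset w hz) (hdisj z h0 h1 h2)
    · exact hS.seg_strip w w' z hz hz'

end StripData

/-! ### Regions which are decomposed into strips -/

/-- The closure of the region `R` is decomposed into strips as in the graph `T`, and the vertices
are the components which contain singular points. -/
structure StripData.IsModel {T : FGraph} (S : StripData T) (R : SSRegion) : Prop where
  covers : S.Covers (closure R.domain)
  inner : ∀ e, S.ostrip e ⊆ R.domain
  dec : ∀ e, ∃ α β, S.x (T.src e) ≤ α ∧ α < β ∧ β ≤ S.x (T.tgt e) ∧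
    StrictAntiOn (S.hi e) (Icc α β)
  seg_sing : ∀ v, ∃ z ∈ S.seg v, R.IsSingular 0 z
  sing_seg : ∀ z, R.IsSingular 0 z → ∃ v, z ∈ S.seg v
  side : ∀ C ∈ R.circles, R.domain ⊆ openDisk C ∨ Disjoint R.domain (closedDisk C)

namespace StripData

variable {T H : FGraph}

/-- The decomposition for an isomorphic graph. -/
def map (S : StripData T) (φ : FGraph.Iso T H) : StripData H where
  x := fun v => S.x (φ.eV.symm v)
  bot := fun v => S.bot (φ.eV.symm v)
  top := fun v => S.top (φ.eV.symm v)
  lo := fun e => S.lo (φ.eE.symm e)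
  hi := fun e => S.hi (φ.eE.symm e)

theorem IsModel.map {S : StripData T} {R : SSRegion} (hS : S.IsModel R) (φ : FGraph.Iso T H) :
    (S.map φ).IsModel R := by
  have hsrc : ∀ e, φ.eV.symm (H.src e) = T.src (φ.eE.symm e) := by
    intro e
    rw [Equiv.symm_apply_eq, ← φ.src, Equiv.apply_symm_apply]
  have htgt : ∀ e, φ.eV.symm (H.tgt e) = T.tgt (φ.eE.symm e) := by
    intro e
    rw [Equiv.symm_apply_eq, ← φ.tgt, Equiv.apply_symm_apply]
  have xsrc : ∀ e, (S.map φ).x (H.src e) = S.x (T.src (φ.eE.symm e)) :=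
    fun e => congrArg S.x (hsrc e)
  have xtgt : ∀ e, (S.map φ).x (H.tgt e) = S.x (T.tgt (φ.eE.symm e)) :=
    fun e => congrArg S.x (htgt e)
  have hseg : ∀ v, (S.map φ).seg v = S.seg (φ.eV.symm v) := fun _ => rfl
  have hstrip : ∀ e, (S.map φ).strip e = S.strip (φ.eE.symm e) := by
    intro e
    unfold strip
    rw [xsrc, xtgt]
    rfl
  have hc := hS.covers
  refine ⟨⟨fun v => hc.bot_le_top _, ?_, ?_, ?_, ?_, ?_, ?_, ?_, ?_, ?_, ?_, ?_, ?_⟩, ?_, ?_,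
    fun v => hS.seg_sing _, ?_, hS.side⟩
  · intro e
    rw [xsrc, xtgt]
    exact hc.lt _
  · intro e
    rw [xsrc, xtgt]
    exact hc.lo_cont _
  · intro e
    rw [xsrc, xtgt]
    exact hc.hi_cont _
  · intro e
    rw [xsrc, xtgt]
    exact hc.lo_lt_hi _
  · intro e
    rw [xsrc]
    exact (congrArg S.bot (hsrc e)).trans_le (hc.src_bot _)
  · intro e
    rw [xsrc]
    exact (hc.src_top _).trans_eq (congrArg S.top (hsrc e)).symm
  · intro e
    rw [xtgt]
    exact (congrArg S.bot (htgt e)).trans_le (hc.tgt_bot _)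
  · intro e
    rw [xtgt]
    exact (hc.tgt_top _).trans_eq (congrArg S.top (htgt e)).symm
  · intro z
    rw [hc.cover]
    refine or_congr ⟨fun ⟨v, hv⟩ => ⟨φ.eV v, ?_⟩, fun ⟨v, hv⟩ => ⟨_, hv⟩⟩
      ⟨fun ⟨e, he⟩ => ⟨φ.eE e, ?_⟩, fun ⟨e, he⟩ => ⟨φ.eE.symm e, ?_⟩⟩
    · rwa [hseg, Equiv.symm_apply_apply]
    · rwa [hstrip, Equiv.symm_apply_apply]
    · rwa [← hstrip]
  · intro v w z hv hw
    exact φ.eV.symm.injective (hc.seg_disj _ _ z hv hw)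
  · intro e f z he hf
    rw [hstrip] at he hf
    exact φ.eE.symm.injective (hc.strip_disj _ _ z he hf)
  · intro v e z hv he
    rw [hstrip] at he
    exact hc.seg_strip _ _ z hv he
  · intro e
    unfold ostrip
    rw [xsrc, xtgt]
    exact hS.inner _
  · intro e
    rw [xsrc, xtgt]
    exact hS.dec _
  · intro z hz
    obtain ⟨v, hv⟩ := hS.sing_seg z hz
    refine ⟨φ.eV v, ?_⟩
    rwa [hseg, Equiv.symm_apply_apply]

end StripData

end SSRegions
end

noncomputable section
namespace SSRegions

open Set

/-! ### Circles in coordinates -/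

/-- The power of a point with respect to a circle. -/
def pw (C : Circ) (z : Plane) : ℝ :=
  (z 0 - C.center 0) ^ 2 + (z 1 - C.center 1) ^ 2 - C.radius ^ 2

theorem dist_sq_eq (z w : Plane) : dist z w ^ 2 = (z 0 - w 0) ^ 2 + (z 1 - w 1) ^ 2 := by
  rw [dist_eq_norm, EuclideanSpace.real_norm_sq_eq]
  simp [Fin.sum_univ_two]

theorem pw_eq (C : Circ) (z : Plane) : pw C z = dist z C.center ^ 2 - C.radius ^ 2 := by
  rw [dist_sq_eq, pw]

theorem continuous_pw (C : Circ) : Continuous (pw C) := by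
  unfold pw
  fun_prop

section

variable {C : Circ} (hC : 0 < C.radius) {z : Plane}
include hC

theorem mem_circ_iff : z ∈ C ↔ pw C z = 0 := by
  rw [EuclideanGeometry.mem_sphere, pw_eq, sub_eq_zero, sq_eq_sq₀ dist_nonneg hC.le]

theorem mem_openDisk_iff : z ∈ openDisk C ↔ pw C z < 0 := by
  rw [openDisk, Metric.mem_ball, pw_eq, sub_neg, sq_lt_sq₀ dist_nonneg hC.le]

theorem mem_closedDisk_iff : z ∈ closedDisk C ↔ pw C z ≤ 0 := by
  rw [closedDisk, Metric.mem_closedBall, pw_eq, sub_nonpos, sq_le_sq₀ dist_nonneg hC.le]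

end

theorem mem_tangentLine (C : Circ) (p v : Plane) : v ∈ tangentLine C p ↔
    (p 0 - C.center 0) * v 0 + (p 1 - C.center 1) * v 1 = 0 := by
  rw [tangentLine, Submodule.mem_orthogonal_singleton_iff_inner_right]
  simp [PiLp.inner_apply, Fin.sum_univ_two, mul_comm]

/-- The tangent is orthogonal to the radius, so the coordinate `i` is critical exactly where the
radius is parallel to the axis `i`. -/
theorem tangent_vertical_iff {C : Circ} (hC : 0 < C.radius) {p : Plane} (hp : p ∈ C) (i : Fin 2) :
    (∀ v ∈ tangentLine C p, v i = 0) ↔ p (1 - i) = C.center (1 - i) := by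
  have h := (mem_circ_iff hC).1 hp
  unfold pw at h
  have hr : 0 < C.radius ^ 2 := by positivity
  constructor
  · intro hv
    have := hv (pt (-(p 1 - C.center 1)) (p 0 - C.center 0))
      ((mem_tangentLine _ _ _).2 (by simp only [pt_zero, pt_one]; ring))
    fin_cases i
    · simp at this ⊢
      linarith
    · simp at this ⊢
      linarith
  · intro hv v hvt
    rw [mem_tangentLine] at hvt
    fin_cases i
    · simp at hv ⊢
      rw [hv] at hvt h
      have h0 : p 0 - C.center 0 ≠ 0 := by
        intro h0
        rw [h0] at h
        simp at h
        exact hC.ne' h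
      simpa [h0] using hvt
    · simp at hv ⊢
      rw [hv] at hvt h
      have h0 : p 1 - C.center 1 ≠ 0 := by
        intro h0
        rw [h0] at h
        simp at h
        exact hC.ne' h
      simpa [h0] using hvt

/-- The hypothesis is that the determinant of the two radii at `p` does not vanish; Cramer's rule
then decomposes any vector. -/
theorem isCompl_tangentLine {C C' : Circ} {p : Plane}
    (h : (p 0 - C.center 0) * (p 1 - C'.center 1) - (p 1 - C.center 1) * (p 0 - C'.center 0) ≠ 0) :
    IsCompl (tangentLine C p) (tangentLine C' p) := by
  constructor
  · rw [Submodule.disjoint_def]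
    intro v hv hv'
    rw [mem_tangentLine] at hv hv'
    apply plane_ext
    · refine (mul_eq_zero.1 (?_ : _ * v 0 = 0)).resolve_left h
      linear_combination (p 1 - C'.center 1) * hv - (p 1 - C.center 1) * hv'
    · refine (mul_eq_zero.1 (?_ : _ * v 1 = 0)).resolve_left h
      linear_combination -(p 0 - C'.center 0) * hv + (p 0 - C.center 0) * hv'
  · rw [codisjoint_iff, eq_top_iff]
    intro v _
    set d := (p 0 - C.center 0) * (p 1 - C'.center 1) - (p 1 - C.center 1) * (p 0 - C'.center 0)
    set s := ((p 0 - C'.center 0) * v 0 + (p 1 - C'.center 1) * v 1) / d with hs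
    set t := ((p 0 - C.center 0) * v 0 + (p 1 - C.center 1) * v 1) / d with ht
    rw [Submodule.mem_sup]
    refine ⟨pt (-(p 1 - C.center 1) * s) ((p 0 - C.center 0) * s), ?_,
      pt ((p 1 - C'.center 1) * t) (-(p 0 - C'.center 0) * t), ?_, ?_⟩
    · rw [mem_tangentLine, pt_zero, pt_one]
      ring
    · rw [mem_tangentLine, pt_zero, pt_one]
      ring
    · have hs' : s * d = (p 0 - C'.center 0) * v 0 + (p 1 - C'.center 1) * v 1 :=
        div_mul_cancel₀ _ h
      have ht' : t * d = (p 0 - C.center 0) * v 0 + (p 1 - C.center 1) * v 1 :=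
        div_mul_cancel₀ _ h
      apply plane_ext
      · simp only [PiLp.add_apply, pt_zero]
        refine mul_right_cancel₀ h (?_ : _ * d = _ * d)
        linear_combination -(p 1 - C.center 1) * hs' + (p 1 - C'.center 1) * ht'
      · simp only [PiLp.add_apply, pt_one]
        refine mul_right_cancel₀ h (?_ : _ * d = _ * d)
        linear_combination (p 0 - C.center 0) * hs' - (p 0 - C'.center 0) * ht'

theorem eq_zero_of_sq_add_sq_le {a b : ℝ} (h : a ^ 2 + b ^ 2 ≤ 0) : a = 0 ∧ b = 0 :=
  ⟨by nlinarith [sq_nonneg a, sq_nonneg b], by nlinarith [sq_nonneg a, sq_nonneg b]⟩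

/-- Two circles with two common points are transverse. -/
theorem isCompl_tangentLine_of_ne {C C' : Circ} (hC : 0 < C.radius) (hC' : 0 < C'.radius)
    (hne : C ≠ C') {p q : Plane} (hpq : p ≠ q) (hp : p ∈ C) (hp' : p ∈ C') (hq : q ∈ C)
    (hq' : q ∈ C') : IsCompl (tangentLine C p) (tangentLine C' p) := by
  have hcc : C.center ≠ C'.center := by
    intro h
    refine hne (EuclideanGeometry.Sphere.ext h ?_)
    rw [← EuclideanGeometry.mem_sphere.1 hp, ← EuclideanGeometry.mem_sphere.1 hp', h]
  rw [mem_circ_iff hC, pw] at hp hq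
  rw [mem_circ_iff hC', pw] at hp' hq'
  apply isCompl_tangentLine
  intro h
  -- The common chord is orthogonal to the line of centres.
  have hw : (C'.center 0 - C.center 0) * (q 0 - p 0) +
      (C'.center 1 - C.center 1) * (q 1 - p 1) = 0 := by
    linear_combination (1 / 2) * (hq - hp) - (1 / 2) * (hq' - hp')
  have hd : (q 0 - p 0) ^ 2 + (q 1 - p 1) ^ 2 =
      -2 * ((p 0 - C.center 0) * (q 0 - p 0) + (p 1 - C.center 1) * (q 1 - p 1)) := by
    linear_combination hq - hp
  have hW : 0 < (C'.center 0 - C.center 0) ^ 2 + (C'.center 1 - C.center 1) ^ 2 := by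
    by_contra hn
    obtain ⟨h0, h1⟩ := eq_zero_of_sq_add_sq_le (not_lt.1 hn)
    exact hcc (plane_ext (by linarith) (by linarith))
  -- If the radii at `p` were parallel, they would be parallel to the line of centres, so the chord
  -- would be orthogonal to the radius; by `hd` its length would be zero.
  have hz : (p 0 - C.center 0) * (q 0 - p 0) + (p 1 - C.center 1) * (q 1 - p 1) = 0 := by
    refine (mul_eq_zero.1 (?_ : ((C'.center 0 - C.center 0) ^ 2 +
      (C'.center 1 - C.center 1) ^ 2) * _ = 0)).resolve_left hW.ne'
    linear_combination ((C'.center 0 - C.center 0) * (p 0 - C.center 0) +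
      (C'.center 1 - C.center 1) * (p 1 - C.center 1)) * hw +
      ((C'.center 0 - C.center 0) * (q 1 - p 1) - (C'.center 1 - C.center 1) * (q 0 - p 0)) * h
  rw [hz, mul_zero] at hd
  obtain ⟨h0, h1⟩ := eq_zero_of_sq_add_sq_le hd.le
  exact hpq (plane_ext (by linarith) (by linarith))

theorem finite_inter_circ {C C' : Circ} (hne : C ≠ C') : {z : Plane | z ∈ C ∧ z ∈ C'}.Finite := by
  by_cases h : {z : Plane | z ∈ C ∧ z ∈ C'}.Subsingleton
  · exact h.finite
  · rw [not_subsingleton_iff] at h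
    obtain ⟨p, ⟨hp, hp'⟩, q, ⟨hq, hq'⟩, hpq⟩ := h
    refine ((finite_singleton q).insert p).subset ?_
    rintro z ⟨hz, hz'⟩
    exact EuclideanGeometry.eq_of_mem_sphere_of_mem_sphere_of_finrank_eq_two (by simp) hne hpq
      hp hq hz hp' hq' hz'

/-! ### Adding a circle -/

/-- If a connected set is covered by two open sets and one of them meets the other in a connected
set, then the other one is connected. -/
theorem isPreconnected_of_union {X : Type*} [TopologicalSpace X] {D D' U : Set X}
    (hD : IsPreconnected D) (hD' : IsOpen D') (hU : IsOpen U) (h : D = D' ∪ U)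
    (hUD : IsPreconnected (D' ∩ U)) : IsPreconnected D' := by
  rw [isPreconnected_iff_subset_of_disjoint]
  intro A B hA hB hAB hdisj
  have hsub := (isPreconnected_iff_subset_of_disjoint.1 hUD) A B hA hB
    (inter_subset_left.trans hAB) (by
      rw [← subset_empty_iff, ← hdisj]
      exact inter_subset_inter_left _ inter_subset_left)
  -- When the connected intersection lies in `A`, the set `U` can be added to the part in `A`, and a
  -- separation of `D'` becomes a separation of `D`.
  have key : ∀ A B : Set X, IsOpen A → IsOpen B → D' ⊆ A ∪ B → D' ∩ (A ∩ B) = ∅ → D' ∩ U ⊆ A →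
      D' ⊆ A ∨ D' ⊆ B := by
    intro A B hA hB hAB hdisj hsub
    have hcov : D ⊆ ((D' ∩ A) ∪ U) ∪ (D' ∩ B) := by
      rw [h]
      rintro z (hz | hz)
      · rcases hAB hz with hzA | hzB
        exacts [.inl (.inl ⟨hz, hzA⟩), .inr ⟨hz, hzB⟩]
      · exact .inl (.inr hz)
    have hdisj' : D ∩ (((D' ∩ A) ∪ U) ∩ (D' ∩ B)) = ∅ := by
      rw [← subset_empty_iff, ← hdisj]
      rintro z ⟨-, ⟨hz, hzA⟩ | hzU, hz', hzB⟩
      exacts [⟨hz, hzA, hzB⟩, ⟨hz', hsub ⟨hz', hzU⟩, hzB⟩]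
    rcases (isPreconnected_iff_subset_of_disjoint.1 hD) _ _ ((hD'.inter hA).union hU)
      (hD'.inter hB) hcov hdisj' with h1 | h1
    · left
      intro z hz
      rcases h1 (h.ge (.inl hz)) with h2 | h2
      exacts [h2.2, hsub ⟨hz, h2⟩]
    · right
      intro z hz
      exact (h1 (h.ge (.inl hz))).2
  rcases hsub with h1 | h1
  · exact key A B hA hB hAB hdisj h1
  · exact (key B A hB hA (by rwa [union_comm]) (by rwa [inter_comm B]) h1).symm

/-- The conditions under which the closed set `X` with the circle `C` can be removed from a
region. -/
structure Carving (R : SSRegion) (X : Set Plane) (C : Circ) : Prop where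
  isClosed : IsClosed X
  radius_pos : 0 < C.radius
  circ_subset : ∀ z ∈ C, z ∈ X
  isConnected : IsConnected (R.domain \ X)
  touch : ∀ z ∈ closure (R.domain \ X), z ∈ X → z ∈ C
  meets : ∃ z ∈ closure (R.domain \ X), z ∈ C
  meets_old : ∀ T ∈ R.circles, ∃ z ∈ closure (R.domain \ X), z ∈ T
  transverse : ∀ T ∈ R.circles, ∀ z ∈ closure (R.domain \ X), z ∈ C → z ∈ T →
    IsCompl (tangentLine C z) (tangentLine T z)
  unique : ∀ T ∈ R.circles, ∀ T' ∈ R.circles, ∀ z ∈ closure (R.domain \ X), z ∈ C → z ∈ T →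
    z ∈ T' → T = T'

namespace Carving

variable {R : SSRegion} {X : Set Plane} {C : Circ} (h : Carving R X C)
include h

theorem mem_closure {z : Plane} (hz : z ∈ closure R.domain) (hzX : z ∉ X) :
    z ∈ closure (R.domain \ X) := by
  have := h.isClosed.isOpen_compl.inter_closure (t := R.domain) ⟨hzX, hz⟩
  rwa [inter_comm, ← sdiff_eq] at this

omit h in
theorem closure_subset : closure (R.domain \ X) ⊆ closure R.domain := closure_mono sdiff_subset

theorem boundary_cases {z : Plane} (hz : z ∈ closure (R.domain \ X)) (hz' : z ∉ R.domain \ X) :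
    z ∈ C ∨ (z ∉ X ∧ z ∉ C ∧ z ∈ R.boundary) := by
  by_cases hX : z ∈ X
  · exact .inl (h.touch z hz hX)
  · exact .inr ⟨hX, fun hc => hX (h.circ_subset z hc), closure_subset hz, fun hD => hz' ⟨hD, hX⟩⟩

/-- The region with the new circle. -/
def region : SSRegion where
  domain := R.domain \ X
  circles := insert C R.circles
  isOpen_domain := R.isOpen_domain.sdiff h.isClosed
  isConnected_domain := h.isConnected
  circles_finite := R.circles_finite.insert C
  circles_nonempty := insert_nonempty _ _
  radius_pos := by
    rintro S (rfl | hS)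
    exacts [h.radius_pos, R.radius_pos S hS]
  boundary_subset := by
    rintro z ⟨hz, hz'⟩
    rcases h.boundary_cases hz hz' with hC | ⟨-, -, hb⟩
    · exact ⟨C, mem_insert _ _, hC⟩
    · obtain ⟨S, hS, hzS⟩ := R.boundary_subset hb
      exact ⟨S, mem_insert_of_mem _ hS, hzS⟩
  meets := by
    rintro S (rfl | hS)
    exacts [h.meets, h.meets_old S hS]
  transverse := by
    rintro S (rfl | hS) T (rfl | hT) hne z ⟨hz, hz'⟩ hzS hzT
    · exact absurd rfl hne
    · exact h.transverse T hT z hz hzS hzT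
    · exact (h.transverse S hS z hz hzT hzS).symm
    · rcases h.boundary_cases hz hz' with hC | ⟨-, -, hb⟩
      · exact absurd (h.unique S hS T hT z hz hC hzS hzT) hne
      · exact R.transverse S hS T hT hne z hb hzS hzT
  no_triple := by
    rintro S hS T hT U hU hST hSU hTU z ⟨hz, hz'⟩ ⟨hzS, hzT, hzU⟩
    rcases h.boundary_cases hz hz' with hC | ⟨-, hC, hb⟩
    · rcases hS with rfl | hS
      · exact hTU (h.unique T (hT.resolve_left hST.symm) U (hU.resolve_left hSU.symm) z hz hC hzT
          hzU)
      · rcases hT with rfl | hT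
        · exact hSU (h.unique S hS U (hU.resolve_left hTU.symm) z hz hC hzS hzU)
        · exact hST (h.unique S hS T hT z hz hC hzS hzT)
    · have hne : ∀ S, z ∈ S → S ≠ C := fun S hzS hSC => hC (hSC ▸ hzS)
      exact R.no_triple S (hS.resolve_left (hne S hzS)) T (hT.resolve_left (hne T hzT))
        U (hU.resolve_left (hne U hzU)) hST hSU hTU z hb ⟨hzS, hzT, hzU⟩

/-- The new circle is contained in `X`, so away from `X` neither the circles through a point nor its
membership in the boundary change. -/
theorem isSingular_iff {z : Plane} (hz : z ∉ X) (i : Fin 2) :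
    h.region.IsSingular i z ↔ R.IsSingular i z := by
  have hzC : z ∉ C := fun hc => hz (h.circ_subset z hc)
  have hc : ∀ S, (S ∈ insert C R.circles ∧ z ∈ S) ↔ S ∈ R.circles ∧ z ∈ S := by
    intro S
    constructor
    · rintro ⟨rfl | hS, hzS⟩
      exacts [absurd hzS hzC, ⟨hS, hzS⟩]
    · exact fun hS => ⟨.inr hS.1, hS.2⟩
  have ho : ∀ S, h.region.OnlyOn z S ↔ R.OnlyOn z S := by
    intro S
    constructor
    · rintro ⟨h1, h2, h3⟩
      exact ⟨((hc S).1 ⟨h1, h2⟩).1, h2, fun T hT => h3 T (.inr hT)⟩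
    · rintro ⟨h1, h2, h3⟩
      exact ⟨.inr h1, h2, fun T hT hzT => h3 T ((hc T).1 ⟨hT, hzT⟩).1 hzT⟩
  unfold SSRegion.IsSingular
  refine and_congr ⟨fun hb => ⟨closure_subset hb.1, fun hD => hb.2 ⟨hD, hz⟩⟩,
    fun hb => ⟨h.mem_closure hb.1 hz, fun hD => hb.2 hD.1⟩⟩ (or_congr ?_ ?_)
  · have : {S | S ∈ h.region.circles ∧ z ∈ S} = {S | S ∈ R.circles ∧ z ∈ S} := by
      ext S
      exact hc S
    rw [this]
  · exact exists_congr fun S => by rw [ho]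

theorem mem_boundary {z : Plane} (hz : z ∈ closure (R.domain \ X)) (hC : z ∈ C) :
    z ∈ h.region.boundary := ⟨hz, fun hD => hD.2 (h.circ_subset z hC)⟩

theorem isSingular_of_mem {z : Plane} (hz : z ∈ closure (R.domain \ X)) (hC : z ∈ C) {T : Circ}
    (hT : T ∈ R.circles) (hzT : z ∈ T) (hne : T ≠ C) (i : Fin 2) : h.region.IsSingular i z := by
  refine ⟨h.mem_boundary hz hC, .inl ?_⟩
  have : {S | S ∈ h.region.circles ∧ z ∈ S} = {T, C} := by
    ext S
    constructor
    · rintro ⟨rfl | hS, hzS⟩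
      · exact .inr rfl
      · exact .inl (h.unique S hS T hT z hz hC hzS hzT)
    · rintro (rfl | rfl)
      exacts [⟨.inr hT, hzT⟩, ⟨.inl rfl, hC⟩]
  rw [this, ncard_pair hne]

theorem isSingular_of_vertical {z : Plane} (hz : z ∈ closure (R.domain \ X)) (hC : z ∈ C)
    (hT : ∀ T ∈ R.circles, z ∉ T) {i : Fin 2} (hi : z (1 - i) = C.center (1 - i)) :
    h.region.IsSingular i z := by
  refine ⟨h.mem_boundary hz hC, .inr ⟨C, ⟨mem_insert _ _, hC, ?_⟩, ?_⟩⟩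
  · rintro S (rfl | hS) hzS
    exacts [rfl, absurd hzS (hT S hS)]
  · exact (tangent_vertical_iff h.radius_pos hC i).2 hi

/-- This bounds the new singular points: on the new circle only corners with old circles and the two
extremal points of the coordinate come into question. -/
theorem of_isSingular {z : Plane} {i : Fin 2} (hz : h.region.IsSingular i z) (hC : z ∈ C) :
    (∃ T ∈ R.circles, z ∈ T) ∨ z (1 - i) = C.center (1 - i) := by
  rcases hz.2 with h2 | ⟨S, ⟨hS, hzS, -⟩, hv⟩
  · left
    by_contra! hn
    have : {S | S ∈ h.region.circles ∧ z ∈ S} ⊆ {C} := by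
      rintro S ⟨rfl | hS, hzS⟩
      exacts [rfl, absurd hzS (hn S hS)]
    have := ncard_le_ncard this
    rw [h2, ncard_singleton] at this
    omega
  · rcases hS with rfl | hS
    · exact .inr ((tangent_vertical_iff h.radius_pos hC i).1 hv)
    · exact .inl ⟨S, hS, hzS⟩

end Carving

end SSRegions
end

noncomputable section
namespace SSRegions

open Set

/-! ### Finiteness of the set of exceptional points -/

theorem finite_extremal {C : Circ} (hC : 0 < C.radius) (i : Fin 2) :
    {z : Plane | z ∈ C ∧ z (1 - i) = C.center (1 - i)}.Finite := by
  have key : ∀ z : Plane, z ∈ C → z (1 - i) = C.center (1 - i) →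
      z i = C.center i + C.radius ∨ z i = C.center i - C.radius := by
    intro z hz hi
    rw [mem_circ_iff hC, pw] at hz
    have : (z i - C.center i) ^ 2 = C.radius ^ 2 := by
      fin_cases i
      · simp at hi ⊢
        rw [hi] at hz
        linarith
      · simp at hi ⊢
        rw [hi] at hz
        linarith
    rcases sq_eq_sq_iff_eq_or_eq_neg.1 this with h | h
    · exact .inl (by linarith)
    · exact .inr (by linarith)
  refine Finite.of_finite_image (f := fun z : Plane => z i)
    ((finite_singleton (C.center i - C.radius)).insert (C.center i + C.radius) |>.subset ?_) ?_
  · rintro _ ⟨z, ⟨hz, hi⟩, rfl⟩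
    exact key z hz hi
  · rintro z ⟨-, hz⟩ w ⟨-, hw⟩ hzw
    have h : z (1 - i) = w (1 - i) := hz.trans hw.symm
    fin_cases i
    · exact plane_ext hzw (by simpa using h)
    · exact plane_ext (by simpa using h) hzw

theorem SSRegion.finite_multiple (R : SSRegion) :
    {z : Plane | ∃ S ∈ R.circles, ∃ T ∈ R.circles, S ≠ T ∧ z ∈ S ∧ z ∈ T}.Finite := by
  have : {z : Plane | ∃ S ∈ R.circles, ∃ T ∈ R.circles, S ≠ T ∧ z ∈ S ∧ z ∈ T} ⊆
      ⋃ S ∈ R.circles, ⋃ T ∈ R.circles, {z | S ≠ T ∧ z ∈ S ∧ z ∈ T} := by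
    rintro z ⟨S, hS, T, hT, h⟩
    simp only [mem_iUnion]
    exact ⟨S, hS, T, hT, h⟩
  refine Finite.subset ?_ this
  refine R.circles_finite.biUnion fun S _ => R.circles_finite.biUnion fun T _ => ?_
  by_cases h : S = T
  · simp [h]
  · exact (finite_inter_circ h).subset fun z hz => hz.2

theorem SSRegion.finite_critical (R : SSRegion) (i : Fin 2) :
    {z : Plane | ∃ S ∈ R.circles, z ∈ S ∧ z (1 - i) = S.center (1 - i)}.Finite := by
  have : {z : Plane | ∃ S ∈ R.circles, z ∈ S ∧ z (1 - i) = S.center (1 - i)} ⊆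
      ⋃ S ∈ R.circles, {z | z ∈ S ∧ z (1 - i) = S.center (1 - i)} := by
    rintro z ⟨S, hS, h⟩
    simp only [mem_iUnion]
    exact ⟨S, hS, h⟩
  exact (R.circles_finite.biUnion fun S hS => finite_extremal (R.radius_pos S hS) i).subset this

theorem SSRegion.finite_singular (R : SSRegion) (i : Fin 2) :
    {z : Plane | R.IsSingular i z}.Finite := by
  refine (R.finite_multiple.union (R.finite_critical i)).subset ?_
  rintro z ⟨-, h2 | ⟨S, ⟨hS, hzS, -⟩, hv⟩⟩
  · left
    obtain ⟨S, T, hne, h⟩ := ncard_eq_two.1 h2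
    have hS : S ∈ {S | S ∈ R.circles ∧ z ∈ S} := h ▸ .inl rfl
    have hT : T ∈ {S | S ∈ R.circles ∧ z ∈ S} := h ▸ .inr rfl
    exact ⟨S, hS.1, T, hT.1, hne, hS.2, hT.2⟩
  · exact .inr ⟨S, hS, hzS, (tangent_vertical_iff (R.radius_pos S hS) hzS i).1 hv⟩

theorem exists_Icc_avoiding {F : Set ℝ} (hF : F.Finite) {a b : ℝ} (hab : a < b) :
    ∃ α β, a < α ∧ α < β ∧ β < b ∧ ∀ t ∈ Icc α β, t ∉ F := by
  obtain ⟨t, ht⟩ := ((Ioo_infinite hab).sdiff hF).nonempty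
  obtain ⟨ε, hε, hb⟩ := Metric.isOpen_iff.1 (isOpen_Ioo.sdiff hF.isClosed) t ht
  have key : ∀ s ∈ Icc (t - ε / 2) (t + ε / 2), s ∈ Ioo a b \ F := by
    intro s hs
    refine hb ?_
    rw [Metric.mem_ball, Real.dist_eq, abs_lt]
    exact ⟨by linarith [hs.1], by linarith [hs.2]⟩
  exact ⟨t - ε / 2, t + ε / 2, (key _ ⟨le_rfl, by linarith⟩).1.1, by linarith,
    (key _ ⟨by linarith, le_rfl⟩).1.2, fun s hs => (key s hs).2⟩

/-- A component lies in a single level, so it suffices to avoid the finitely many levels of singular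
points. -/
theorem SSRegion.toReeb_notMem (R : SSRegion) {i : Fin 2} {p : closure R.domain}
    (h : ∀ z, R.IsSingular i z → z i ≠ (p : Plane) i) : R.toReeb i p ∉ R.reebVertices i := by
  rintro ⟨q, hq, hqp⟩
  rw [R.toReeb_eq_iff] at hqp
  have := R.mem_levelComponent i q
  rw [hqp] at this
  exact h q hq (R.levelComponent_subset i p this).2

/-! ### Generic arcs -/

/-- The upper boundary of the strip of `e` over the interval from `α` to `β` is a strictly
decreasing generic arc of the circle `C`. The region lies inside `C` if `σ = 1`, and outside `C`
if `σ = -1`. -/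
structure Arc {T : FGraph} (S : StripData T) (R : SSRegion) (e : T.E) (C : Circ) (σ α β : ℝ) :
    Prop where
  lt : α < β
  left : S.x (T.src e) < α
  right : β < S.x (T.tgt e)
  anti : StrictAntiOn (S.hi e) (Icc α β)
  sign : σ = 1 ∨ σ = -1
  mem : C ∈ R.circles
  inside : ∀ z ∈ R.domain, σ * pw C z < 0
  boundary : ∀ t ∈ Icc α β, pt t (S.hi e t) ∈ R.boundary
  onlyOn : ∀ t ∈ Icc α β, R.OnlyOn (pt t (S.hi e t)) C
  generic : ∀ t ∈ Icc α β, ∀ (h : pt t (S.hi e t) ∈ closure R.domain) (i : Fin 2),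
    R.toReeb i ⟨_, h⟩ ∉ R.reebVertices i
  pos_x : ∀ t ∈ Icc α β, 0 < σ * (t - C.center 0)
  pos_y : ∀ t ∈ Icc α β, 0 < σ * (S.hi e t - C.center 1)

theorem Arc.mono {T : FGraph} {S : StripData T} {R : SSRegion} {e : T.E} {C : Circ}
    {σ α β α' β' : ℝ} (h : Arc S R e C σ α β) (hα : α ≤ α') (hlt : α' < β') (hβ : β' ≤ β) :
    Arc S R e C σ α' β' := by
  have hs : Icc α' β' ⊆ Icc α β := Icc_subset_Icc hα hβ
  exact ⟨hlt, h.left.trans_le hα, hβ.trans_lt h.right, h.anti.mono hs, h.sign, h.mem, h.inside,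
    fun t ht => h.boundary t (hs ht), fun t ht => h.onlyOn t (hs ht),
    fun t ht => h.generic t (hs ht), fun t ht => h.pos_x t (hs ht), fun t ht => h.pos_y t (hs ht)⟩

namespace StripData

variable {T : FGraph} {S : StripData T} {R : SSRegion}

theorem IsModel.hi_mem_strip (hS : S.IsModel R) (e : T.E) {t : ℝ}
    (ht : t ∈ Ioo (S.x (T.src e)) (S.x (T.tgt e))) : pt t (S.hi e t) ∈ S.strip e := by
  refine ⟨by rwa [pt_zero], ?_, ?_⟩ <;> rw [pt_zero, pt_one]
  exact (hS.covers.lo_lt_hi e t ht).le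

theorem dist_pt_self (t a b : ℝ) : dist (pt t a) (pt t b) = |a - b| := by
  have h := dist_sq_eq (pt t a) (pt t b)
  simp only [pt_zero, pt_one, sub_self] at h
  rw [← abs_of_nonneg (dist_nonneg (x := pt t a) (y := pt t b)), ← sq_eq_sq_iff_abs_eq_abs, h]
  ring

/-- Near a point of a strip the closure of the region consists of this strip only, and points
slightly above `hi` are outside the strip. -/
theorem IsModel.hi_mem_boundary (hS : S.IsModel R) (e : T.E) {t : ℝ}
    (ht : t ∈ Ioo (S.x (T.src e)) (S.x (T.tgt e))) : pt t (S.hi e t) ∈ R.boundary := by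
  have hst := hS.hi_mem_strip e ht
  refine ⟨hS.covers.strip_subset e hst, fun hD => ?_⟩
  obtain ⟨ε, hε, hb⟩ := Metric.isOpen_iff.1 R.isOpen_domain _ hD
  obtain ⟨δ, hδ, hb'⟩ := hS.covers.exists_ball hst
  set η := min ε δ / 2 with hη
  have hm : 0 < min ε δ := lt_min hε hδ
  have hd : dist (pt t (S.hi e t + η)) (pt t (S.hi e t)) < min ε δ := by
    rw [dist_pt_self, add_sub_cancel_left, abs_of_pos (by linarith)]
    linarith
  have hw := hb' _ (subset_closure (hb (hd.trans_le (min_le_left _ _))))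
    (hd.trans_le (min_le_right _ _))
  have := hw.2.2
  rw [pt_zero, pt_one] at this
  linarith

/-- The upper boundary of a strip contains a generic arc. -/
theorem IsModel.exists_arc (hS : S.IsModel R) (e : T.E) : ∃ C σ α β, Arc S R e C σ α β := by
  obtain ⟨α₀, β₀, hα₀, hlt₀, hβ₀, hanti⟩ := hS.dec e
  have hsub : ∀ t ∈ Ioo α₀ β₀, t ∈ Ioo (S.x (T.src e)) (S.x (T.tgt e)) :=
    fun t ht => ⟨hα₀.trans_lt ht.1, ht.2.trans_le hβ₀⟩
  have hinj : InjOn (S.hi e) (Ioo α₀ β₀) := (hanti.mono Ioo_subset_Icc_self).injOn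
  -- The excluded levels: points on several circles, vertical tangents, and points which share a
  -- first or second coordinate with a singular point of the respective projection. Strict
  -- monotonicity of `hi` makes the last set finite.
  let F : Set ℝ := ((fun t => pt t (S.hi e t)) ⁻¹'
      ({z : Plane | ∃ S ∈ R.circles, ∃ T ∈ R.circles, S ≠ T ∧ z ∈ S ∧ z ∈ T} ∪
      {z : Plane | ∃ S ∈ R.circles, z ∈ S ∧ z (1 - 0) = S.center (1 - 0)})) ∪
    (fun z : Plane => z 0) '' {z : Plane | R.IsSingular 0 z} ∪
    (Ioo α₀ β₀ ∩ S.hi e ⁻¹' ((fun z : Plane => z 1) '' {z : Plane | R.IsSingular 1 z}))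
  have hF : F.Finite := by
    refine ((Finite.preimage ?_ (R.finite_multiple.union (R.finite_critical 0))).union
      ((R.finite_singular 0).image _)).union ?_
    · intro s _ t _ hst
      simpa using congrArg (fun z : Plane => z 0) hst
    · refine Finite.of_finite_image (f := S.hi e) (((R.finite_singular 1).image (fun z : Plane => z 1)).subset ?_)
        (hinj.mono inter_subset_left)
      rintro _ ⟨t, ⟨-, ht⟩, rfl⟩
      exact ht
  obtain ⟨α₁, β₁, hα₁, hlt₁, hβ₁, hav⟩ := exists_Icc_avoiding hF hlt₀
  have hsub₁ : ∀ t ∈ Icc α₁ β₁, t ∈ Ioo α₀ β₀ :=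
    fun t ht => ⟨hα₁.trans_le ht.1, ht.2.trans_lt hβ₁⟩
  have hsub₂ : ∀ t ∈ Icc α₁ β₁, t ∈ Ioo (S.x (T.src e)) (S.x (T.tgt e)) :=
    fun t ht => hsub t (hsub₁ t ht)
  have hb : ∀ t ∈ Icc α₁ β₁, pt t (S.hi e t) ∈ R.boundary :=
    fun t ht => hS.hi_mem_boundary e (hsub₂ t ht)
  have hone : ∀ t ∈ Icc α₁ β₁, ∀ C ∈ R.circles, ∀ C' ∈ R.circles, pt t (S.hi e t) ∈ C →
      pt t (S.hi e t) ∈ C' → C = C' := by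
    intro t ht C hC C' hC' h h'
    by_contra hne
    exact hav t ht (.inl (.inl (.inl ⟨C, hC, C', hC', hne, h, h'⟩)))
  have hcont : ContinuousOn (fun t => pt t (S.hi e t)) (Icc α₁ β₁) :=
    continuousOn_pt continuousOn_id ((hS.covers.hi_cont e).mono fun t ht =>
      Ioo_subset_Icc_self (hsub₂ t ht))
  obtain ⟨C, hC, hC₁⟩ := R.boundary_subset (hb α₁ ⟨le_rfl, hlt₁.le⟩)
  have hCpos := R.radius_pos C hC
  have hcl : ∀ C' : Circ, IsClosed {z : Plane | z ∈ C'} := fun C' => Metric.isClosed_sphere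
  -- Over an interval the upper boundary is connected, and it is covered by finitely many closed
  -- circles no two of which share one of its points, so a single circle contains it.
  have hall : ∀ t ∈ Icc α₁ β₁, pt t (S.hi e t) ∈ C := by
    by_contra! hn
    obtain ⟨t, ht, htC⟩ := hn
    let Y : Set Plane := ⋃ C' ∈ R.circles \ {C}, {z : Plane | z ∈ C'}
    have hY : IsClosed Y := (R.circles_finite.sdiff).isClosed_biUnion fun C' _ => hcl C'
    have hcov : (fun t => pt t (S.hi e t)) '' Icc α₁ β₁ ⊆ {z : Plane | z ∈ C} ∪ Y := by
      rintro _ ⟨s, hs, rfl⟩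
      obtain ⟨C', hC', hsC'⟩ := R.boundary_subset (hb s hs)
      by_cases hCC : C' = C
      · exact .inl (hCC ▸ hsC')
      · exact .inr (mem_biUnion (x := C') ⟨hC', hCC⟩ hsC')
    obtain ⟨_, ⟨s, hs, rfl⟩, h1, h2⟩ := isPreconnected_closed_iff.1
      (isPreconnected_Icc.image _ hcont) _ _ (hcl C) hY hcov
      ⟨_, ⟨α₁, ⟨le_rfl, hlt₁.le⟩, rfl⟩, hC₁⟩
      ⟨_, ⟨t, ht, rfl⟩, (hcov ⟨t, ht, rfl⟩).resolve_left htC⟩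
    obtain ⟨C', hC', hsC'⟩ := mem_iUnion₂.1 h2
    exact hC'.2 (hone s hs C' hC'.1 C hC hsC' h1)
  obtain ⟨σ, hσ, hin⟩ : ∃ σ : ℝ, (σ = 1 ∨ σ = -1) ∧ ∀ z ∈ R.domain, σ * pw C z < 0 := by
    rcases hS.side C hC with h | h
    · refine ⟨1, .inl rfl, fun z hz => ?_⟩
      rw [one_mul, ← mem_openDisk_iff hCpos]
      exact h hz
    · refine ⟨-1, .inr rfl, fun z hz => ?_⟩
      have := disjoint_left.1 h hz
      rw [mem_closedDisk_iff hCpos] at this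
      linarith
  have hpw : ∀ t ∈ Icc α₁ β₁,
      (t - C.center 0) ^ 2 + (S.hi e t - C.center 1) ^ 2 - C.radius ^ 2 = 0 := by
    intro t ht
    have := (mem_circ_iff hCpos).1 (hall t ht)
    rwa [pw, pt_zero, pt_one] at this
  -- Points slightly below the arc belong to the region, hence lie on the side of `C` given by `σ`.
  -- The arc is therefore in the upper half of `C` for `σ = 1` and in the lower half for `σ = -1`.
  have hy : ∀ t ∈ Icc α₁ β₁, 0 < σ * (S.hi e t - C.center 1) := by
    intro t ht
    have hne : S.hi e t - C.center 1 ≠ 0 := by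
      intro h0
      refine hav t ht (.inl (.inl (.inr ⟨C, hC, hall t ht, ?_⟩)))
      simp only [sub_zero, pt_one]
      linarith
    by_contra hn
    have hneg : σ * (S.hi e t - C.center 1) < 0 := by
      refine lt_of_le_of_ne (not_lt.1 hn) (mul_ne_zero ?_ hne)
      rcases hσ with rfl | rfl <;> norm_num
    have hlh := hS.covers.lo_lt_hi e t (hsub₂ t ht)
    set η := min ((S.hi e t - S.lo e t) / 2) (-(σ * (S.hi e t - C.center 1))) with hη
    have hηpos : 0 < η := lt_min (by linarith) (by linarith)
    have h1 : η ≤ (S.hi e t - S.lo e t) / 2 := min_le_left _ _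
    have h2 : η ≤ -(σ * (S.hi e t - C.center 1)) := min_le_right _ _
    have hD : pt t (S.hi e t - η) ∈ R.domain := by
      refine hS.inner e ⟨by rw [pt_zero]; exact hsub₂ t ht, ?_, ?_⟩ <;> rw [pt_zero, pt_one] <;>
        linarith
    have h3 := hin _ hD
    rw [pw, pt_zero, pt_one] at h3
    have h4 := hpw t ht
    have h5 : σ * ((t - C.center 0) ^ 2 + (S.hi e t - η - C.center 1) ^ 2 - C.radius ^ 2) =
        η * (σ * η - 2 * (σ * (S.hi e t - C.center 1))) := by
      linear_combination σ * h4
    rw [h5] at h3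
    have h6 := neg_of_mul_neg_right h3 hηpos.le
    have h7 : -η ≤ σ * η := by rcases hσ with rfl | rfl <;> linarith
    linarith
  -- A falling secant of an upper arc has its midpoint to the right of the centre; for a lower arc
  -- it lies to the left.
  have hx : ∀ s ∈ Icc α₁ β₁, ∀ t ∈ Icc α₁ β₁, s < t →
      0 < σ * (s - C.center 0) + σ * (t - C.center 0) := by
    intro s hs t ht hst
    have h1 := hpw s hs
    have h2 := hpw t ht
    have h3 := hanti (Ioo_subset_Icc_self (hsub₁ s hs)) (Ioo_subset_Icc_self (hsub₁ t ht)) hst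
    have h4 : 0 < (S.hi e s - S.hi e t) *
        (σ * (S.hi e s - C.center 1) + σ * (S.hi e t - C.center 1)) :=
      mul_pos (sub_pos.2 h3) (add_pos (hy s hs) (hy t ht))
    have h5 : (S.hi e s - S.hi e t) *
        (σ * (S.hi e s - C.center 1) + σ * (S.hi e t - C.center 1)) =
        (t - s) * (σ * (s - C.center 0) + σ * (t - C.center 0)) := by
      linear_combination σ * (h1 - h2)
    rw [h5] at h4
    exact pos_of_mul_pos_right h4 (sub_pos.2 hst).le
  -- `hx` controls only sums, so the interval is shrunk to its middle third: a level there is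
  -- compared with `α₁` if `σ = 1` and with `β₁` if `σ = -1`.
  have hA : (2 * α₁ + β₁) / 3 < (α₁ + 2 * β₁) / 3 := by linarith
  have hsub₃ : ∀ t ∈ Icc ((2 * α₁ + β₁) / 3) ((α₁ + 2 * β₁) / 3), t ∈ Ioo α₁ β₁ :=
    fun t ht => ⟨by linarith [ht.1], by linarith [ht.2]⟩
  refine ⟨C, σ, (2 * α₁ + β₁) / 3, (α₁ + 2 * β₁) / 3, hA, ?_, ?_, ?_, hσ, hC, hin, ?_, ?_, ?_, ?_,
    ?_⟩
  · linarith
  · linarith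
  · exact hanti.mono fun t ht => Ioo_subset_Icc_self (hsub₁ t (Ioo_subset_Icc_self (hsub₃ t ht)))
  · exact fun t ht => hb t (Ioo_subset_Icc_self (hsub₃ t ht))
  · intro t ht
    have ht' := Ioo_subset_Icc_self (hsub₃ t ht)
    exact ⟨hC, hall t ht', fun C' hC' h => hone t ht' C' hC' C hC h (hall t ht')⟩
  · intro t ht hK i
    have ht' := Ioo_subset_Icc_self (hsub₃ t ht)
    apply R.toReeb_notMem
    intro z hz hzi
    fin_cases i
    · exact hav t ht' (.inl (.inr ⟨z, hz, by simpa using hzi⟩))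
    · exact hav t ht' (.inr ⟨hsub₁ t ht', ⟨z, hz, by simpa using hzi⟩⟩)
  · intro t ht
    have ht' := hsub₃ t ht
    rcases hσ with rfl | rfl
    · have := hx α₁ ⟨le_rfl, hlt₁.le⟩ t (Ioo_subset_Icc_self ht') ht'.1
      linarith [ht'.1]
    · have := hx t (Ioo_subset_Icc_self ht') β₁ ⟨hlt₁.le, le_rfl⟩ ht'.2
      linarith [ht'.2]
  · exact fun t ht => hy t (Ioo_subset_Icc_self (hsub₃ t ht))

end StripData

end SSRegions
end

/-! ### The decomposition after two cuts of a strip, and local control near a generic arc -/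

noncomputable section
namespace SSRegions

open Set

namespace StripData

variable {T : FGraph}

/-! ### Cutting a strip twice and lowering the part in the middle -/

/-- The strip of `e` is cut at the levels `a` and `b`, and the upper boundary of the part between
them is replaced by the graph of `h`. -/
def pairData (S : StripData T) (e : T.E) (a b : ℝ) (h : ℝ → ℝ) : StripData (T.splitPair e) :=
  StripData.lower (T := T.splitPair e) ((S.split e a).split (some e) b) none h

variable {S : StripData T} {e : T.E} {a b : ℝ} {h : ℝ → ℝ}

theorem pairData_x_src_none :
    (S.pairData e a b h).x ((T.splitPair e).src none) = a :=
  congrArg (S.pairData e a b h).x (T.splitPair_src_none e)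

theorem pairData_x_src_some_none :
    (S.pairData e a b h).x ((T.splitPair e).src (some none)) = S.x (T.src e) :=
  congrArg (S.pairData e a b h).x (T.splitPair_src_some_none e)

theorem pairData_x_src_self :
    (S.pairData e a b h).x ((T.splitPair e).src (some (some e))) = b :=
  congrArg (S.pairData e a b h).x (T.splitPair_src_self e)

theorem pairData_x_src_of_ne {f : T.E} (hf : f ≠ e) :
    (S.pairData e a b h).x ((T.splitPair e).src (some (some f))) = S.x (T.src f) :=
  congrArg (S.pairData e a b h).x (T.splitPair_src_of_ne hf)

theorem pairData_hi_none : (S.pairData e a b h).hi none = h :=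
  lower_hi_self (T := T.splitPair e)

theorem pairData_hi_some_none : (S.pairData e a b h).hi (some none) = S.hi e :=
  lower_hi_of_ne (T := T.splitPair e) (Option.some_ne_none _)

theorem pairData_hi_some_some (f : T.E) : (S.pairData e a b h).hi (some (some f)) = S.hi f :=
  lower_hi_of_ne (T := T.splitPair e) (Option.some_ne_none _)

variable {K : Set Plane}

theorem Covers.pairData (hS : S.Covers K) (ha : S.x (T.src e) < a) (hab : a < b)
    (hb : b < S.x (T.tgt e)) (hc : ContinuousOn h (Icc a b)) (hlo : ∀ t ∈ Ioo a b, S.lo e t < h t)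
    (hle : ∀ t ∈ Icc a b, h t ≤ S.hi e t) : (S.pairData e a b h).Covers
      (K \ {z | z ∈ S.strip e ∧ z 0 ∈ Ioo a b ∧ h (z 0) < z 1}) := by
  have ha' : a ∈ Ioo (S.x (T.src e)) (S.x (T.tgt e)) := ⟨ha, hab.trans hb⟩
  have h1 : (S.split e a).Covers K := hS.split ha'
  have h2 : ((S.split e a).split (some e) b).Covers K := by
    refine h1.split ?_
    rw [split_x_src_self]
    exact ⟨hab, hb⟩
  have hx : ((S.split e a).split (some e) b).x ((T.splitPair e).src none) = a :=
    pairData_x_src_none (b := b) (h := h)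
  have h3 := Covers.lower (T := T.splitPair e) (S := (S.split e a).split (some e) b) (e := none)
    (h := h) h2 (by rw [hx]; exact hc) (by rw [hx]; exact hlo) (by rw [hx]; exact hle)
  have key : ∀ z : Plane, z ∈ ((S.split e a).split (some e) b).strip none ↔
      (z ∈ S.strip e ∧ a < z 0) ∧ z 0 < b := by
    intro z
    refine (mem_split_strip_none (S := S.split e a) (e := some e) (a := b) hb).trans ?_
    rw [mem_split_strip_self ha]
  have hset : {z | z ∈ S.strip e ∧ z 0 ∈ Ioo a b ∧ h (z 0) < z 1} =
      {z : Plane | z ∈ ((S.split e a).split (some e) b).strip none ∧ h (z 0) < z 1} := by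
    ext z
    constructor
    · rintro ⟨hz, ⟨h1, h2⟩, h3⟩
      exact ⟨(key z).2 ⟨⟨hz, h1⟩, h2⟩, h3⟩
    · rintro ⟨hz, h3⟩
      obtain ⟨⟨hz, h1⟩, h2⟩ := (key z).1 hz
      exact ⟨hz, ⟨h1, h2⟩, h3⟩
  rw [hset]
  exact h3

/-- The restriction on the level in the case `g = e` shows that the two outer parts of the cut strip
avoid whatever is removed over `Icc a b`. -/
theorem mem_pairData_ostrip (ha : S.x (T.src e) < a) (hab : a < b) (hb : b < S.x (T.tgt e))
    {f : (T.splitPair e).E} {z : Plane} (hz : z ∈ (S.pairData e a b h).ostrip f) :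
    z ∈ obetween a b (S.lo e) h ∨ ∃ g, z ∈ S.ostrip g ∧ (g = e → z 0 < a ∨ b < z 0) := by
  unfold ostrip at hz
  rcases f with _ | _ | f
  · rw [pairData_x_src_none, pairData_hi_none] at hz
    exact .inl hz
  · rw [pairData_x_src_some_none, pairData_hi_some_none] at hz
    exact .inr ⟨e, ⟨⟨hz.1.1, hz.1.2.trans (hab.trans hb)⟩, hz.2⟩, fun _ => .inl hz.1.2⟩
  · by_cases hf : f = e
    · subst hf
      rw [pairData_x_src_self, pairData_hi_some_some] at hz
      exact .inr ⟨f, ⟨⟨(ha.trans hab).trans hz.1.1, hz.1.2⟩, hz.2⟩, fun _ => .inr hz.1.1⟩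
    · rw [pairData_x_src_of_ne hf, pairData_hi_some_some] at hz
      exact .inr ⟨f, hz, fun h => absurd h hf⟩

theorem pairData_dec
    (hdec : ∀ e, ∃ α β, S.x (T.src e) ≤ α ∧ α < β ∧ β ≤ S.x (T.tgt e) ∧
      StrictAntiOn (S.hi e) (Icc α β))
    (h₀ : ∃ α β, S.x (T.src e) ≤ α ∧ α < β ∧ β ≤ a ∧ StrictAntiOn (S.hi e) (Icc α β))
    (h₁ : ∃ α β, a ≤ α ∧ α < β ∧ β ≤ b ∧ StrictAntiOn h (Icc α β))
    (h₂ : ∃ α β, b ≤ α ∧ α < β ∧ β ≤ S.x (T.tgt e) ∧ StrictAntiOn (S.hi e) (Icc α β))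
    (f : (T.splitPair e).E) : ∃ α β, (S.pairData e a b h).x ((T.splitPair e).src f) ≤ α ∧ α < β ∧
      β ≤ (S.pairData e a b h).x ((T.splitPair e).tgt f) ∧
      StrictAntiOn ((S.pairData e a b h).hi f) (Icc α β) := by
  rcases f with _ | _ | f
  · rw [pairData_x_src_none, pairData_hi_none]
    exact h₁
  · rw [pairData_x_src_some_none, pairData_hi_some_none]
    exact h₀
  · rw [pairData_hi_some_some]
    by_cases hf : f = e
    · subst hf
      rw [pairData_x_src_self]
      exact h₂
    · rw [pairData_x_src_of_ne hf]
      exact hdec f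

variable {R : SSRegion}

theorem IsModel.notMem_circ (hS : S.IsModel R) {z : Plane} (hz : z ∈ R.domain) {C : Circ}
    (hC : C ∈ R.circles) : z ∉ C := by
  have hr := R.radius_pos C hC
  intro hzC
  rw [mem_circ_iff hr] at hzC
  rcases hS.side C hC with h | h
  · exact ((mem_openDisk_iff hr).1 (h hz)).ne hzC
  · exact disjoint_left.1 h hz ((mem_closedDisk_iff hr).2 hzC.le)

/-- The levels of a generic arc lie in the open interval of its edge. -/
theorem _root_.SSRegions.Arc.mem_Ioo {C : Circ} {σ α β : ℝ} (A : Arc S R e C σ α β) {t : ℝ}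
    (ht : t ∈ Icc α β) : t ∈ Ioo (S.x (T.src e)) (S.x (T.tgt e)) :=
  ⟨A.left.trans_le ht.1, ht.2.trans_lt A.right⟩

/-- A point of a circle on the part of a strip below a generic arc is a point of the arc. -/
theorem IsModel.eq_of_mem_circ (hS : S.IsModel R) {C : Circ} {σ α β : ℝ}
    (A : Arc S R e C σ α β) {z : Plane} (h0 : z 0 ∈ Icc α β) (h1 : S.lo e (z 0) < z 1)
    (h2 : z 1 ≤ S.hi e (z 0)) {C' : Circ} (hC' : C' ∈ R.circles) (hz : z ∈ C') :
    z 1 = S.hi e (z 0) ∧ C' = C := by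
  have h3 : z 1 = S.hi e (z 0) := by
    by_contra hne
    exact hS.notMem_circ (hS.inner e ⟨A.mem_Ioo h0, h1, lt_of_le_of_ne h2 hne⟩) hC' hz
  refine ⟨h3, (A.onlyOn (z 0) h0).2.2 C' hC' ?_⟩
  rwa [← h3, pt_eta]

theorem _root_.SSRegions.Arc.pw_le {C : Circ} {σ α β : ℝ} (A : Arc S R e C σ α β) {z : Plane}
    (hz : z ∈ closure R.domain) : σ * pw C z ≤ 0 := by
  have : closure R.domain ⊆ {z | σ * pw C z ≤ 0} :=
    closure_minimal (fun z hz => (A.inside z hz).le)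
      (isClosed_le (continuous_const.mul (continuous_pw C)) continuous_const)
  exact this hz

theorem _root_.SSRegions.Arc.continuousOn {C : Circ} {σ α β : ℝ} (A : Arc S R e C σ α β)
    (hS : S.IsModel R) : ContinuousOn (S.hi e) (Icc α β) ∧ ContinuousOn (S.lo e) (Icc α β) :=
  ⟨(hS.covers.hi_cont e).mono fun _ ht => Ioo_subset_Icc_self (A.mem_Ioo ht),
    (hS.covers.lo_cont e).mono fun _ ht => Ioo_subset_Icc_self (A.mem_Ioo ht)⟩

/-- Near an interior point of a generic arc the arc is short and lies above the lower boundary of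
the strip. -/
theorem _root_.SSRegions.Arc.exists_near {C : Circ} {σ α β : ℝ} (A : Arc S R e C σ α β)
    (hS : S.IsModel R) {a : ℝ} (ha : a ∈ Ioo α β) {δ : ℝ} (hδ : 0 < δ) : ∃ η > 0,
    ∀ t ∈ Icc (a - η) (a + η), t ∈ Ioo α β ∧
      dist (pt a (S.hi e a)) (pt t (S.hi e t)) < δ ∧
      ∀ s ∈ Icc (a - η) (a + η), S.lo e s < S.hi e t - η := by
  obtain ⟨hhi, hlo⟩ := A.continuousOn hS
  have hnhds : Icc α β ∈ nhds a := Icc_mem_nhds ha.1 ha.2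
  have hhi' := hhi.continuousAt hnhds
  have hlo' := hlo.continuousAt hnhds
  have hlt := hS.covers.lo_lt_hi e a (A.mem_Ioo (Ioo_subset_Icc_self ha))
  -- A quarter of the height leaves room: nearby `lo` stays below `lo a + g`, and `hi`, diminished
  -- by a further amount of at most `g`, stays above `hi a - 2 * g`.
  set g := (S.hi e a - S.lo e a) / 4 with hg
  have hgpos : 0 < g := by linarith
  have hP : ContinuousAt (fun t => pt t (S.hi e t)) a :=
    continuous_pt.continuousAt.comp (continuousAt_id.prodMk hhi')
  have hd : ContinuousAt (fun t => dist (pt a (S.hi e a)) (pt t (S.hi e t))) a :=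
    continuousAt_const.dist hP
  have h1 : ∀ᶠ t in nhds a, dist (pt a (S.hi e a)) (pt t (S.hi e t)) < δ :=
    hd.eventually_lt continuousAt_const (by simpa using hδ)
  have h2 : ∀ᶠ t in nhds a, S.hi e a - g < S.hi e t :=
    continuousAt_const.eventually_lt hhi' (by linarith)
  have h3 : ∀ᶠ t in nhds a, S.lo e t < S.lo e a + g :=
    hlo'.eventually_lt continuousAt_const (by linarith)
  obtain ⟨η, hη, hb⟩ := Metric.eventually_nhds_iff.1
    (((h1.and h2).and h3).and (Ioo_mem_nhds ha.1 ha.2))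
  have hm : 0 < min (η / 2) g := lt_min (by linarith) hgpos
  have key : ∀ t ∈ Icc (a - min (η / 2) g) (a + min (η / 2) g), dist t a < η := by
    intro t ht
    have := min_le_left (η / 2) g
    rw [Real.dist_eq, abs_lt]
    exact ⟨by linarith [ht.1], by linarith [ht.2]⟩
  refine ⟨_, hm, fun t ht => ?_⟩
  obtain ⟨⟨⟨ht1, ht2⟩, -⟩, ht4⟩ := hb (key t ht)
  refine ⟨ht4, ht1, fun s hs => ?_⟩
  have hs3 := (hb (key s hs)).1.2
  have := min_le_right (η / 2) g
  linarith

end StripData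

end SSRegions
end

noncomputable section
namespace SSRegions

open Set

/-! ### Thin lenses and lunes -/

/-- A difference of squares along a vertical line through a point of the circle. Where the second
factor is positive, the sign of the power only says whether the point is above or below the arc. -/
theorem pw_pt_eq {A : Circ} {t h : ℝ} (hh : pw A (pt t h) = 0) (σ y : ℝ) :
    σ * pw A (pt t y) = (y - h) * (σ * (y - A.center 1) + σ * (h - A.center 1)) := by
  simp only [pw, pt_zero, pt_one] at hh ⊢
  linear_combination σ * hh

/-- The difference of two circle equations is the formula for the slope of a secant; it turns
information on quadrants into monotonicity and back. -/
theorem slope_eq {A : Circ} {s t h k : ℝ} (hs : pw A (pt s h) = 0) (ht : pw A (pt t k) = 0)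
    (σ : ℝ) : (h - k) * (σ * (h - A.center 1) + σ * (k - A.center 1)) =
      (t - s) * (σ * (s - A.center 0) + σ * (t - A.center 0)) := by
  simp only [pw, pt_zero, pt_one] at hs ht
  linear_combination σ * hs - σ * ht

/-- A disk minus a half plane through two points of a quadrant is contained in the box between the
two points. -/
theorem chord_left {u₀ u₁ w₀ w₁ x y : ℝ} (_ : 0 < u₀) (_ : 0 < u₁) (h₀ : u₀ < w₀)
    (h₁ : w₁ < u₁) (hw₁ : 0 < w₁) (hn : u₀ ^ 2 + u₁ ^ 2 = w₀ ^ 2 + w₁ ^ 2)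
    (hz : x ^ 2 + y ^ 2 ≤ u₀ ^ 2 + u₁ ^ 2)
    (hc : 0 ≤ (u₁ - w₁) * (x - u₀) + (w₀ - u₀) * (y - u₁)) : u₀ ≤ x := by
  by_contra! hx
  have hn₁ : 0 < w₀ - u₀ := sub_pos.2 h₀
  have h2 : 0 < (u₁ - w₁) * (u₀ - x) := mul_pos (sub_pos.2 h₁) (sub_pos.2 hx)
  have hy : 0 < y - u₁ := pos_of_mul_pos_right (by linarith : 0 < (w₀ - u₀) * (y - u₁)) hn₁.le
  have h3 : (y - u₁) * (y + u₁) ≤ (u₀ - x) * (u₀ + x) := by nlinarith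
  have h4 : (y - u₁) * (2 * u₁) ≤ (u₀ - x) * (2 * u₀) := by nlinarith
  have h5 : (u₁ - w₁) * (u₀ - x) * (2 * u₁) ≤ (w₀ - u₀) * ((u₀ - x) * (2 * u₀)) := by
    calc (u₁ - w₁) * (u₀ - x) * (2 * u₁) ≤ (w₀ - u₀) * (y - u₁) * (2 * u₁) := by
          apply mul_le_mul_of_nonneg_right _ (by linarith)
          linarith
      _ = (w₀ - u₀) * ((y - u₁) * (2 * u₁)) := by ring
      _ ≤ _ := mul_le_mul_of_nonneg_left h4 hn₁.le
  have h6 : 0 < u₀ - x := sub_pos.2 hx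
  -- A point left of the box would force this inequality. Equal norms give `(u₁ - w₁) * (u₁ + w₁) =
  -- (w₀ - u₀) * (w₀ + u₀)`, which with `w₁ < u₁` and `u₀ < w₀` implies the strict opposite.
  have h7 : (u₁ - w₁) * u₁ ≤ (w₀ - u₀) * u₀ := by
    by_contra! h8
    nlinarith [mul_lt_mul_of_pos_left h8 h6]
  nlinarith [mul_pos (sub_pos.2 h₀) (sub_pos.2 h₀), mul_pos (sub_pos.2 h₁) (sub_pos.2 h₁)]

theorem chord_box {u₀ u₁ w₀ w₁ x y : ℝ} (hu₀ : 0 < u₀) (hu₁ : 0 < u₁) (h₀ : u₀ < w₀)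
    (h₁ : w₁ < u₁) (hw₁ : 0 < w₁) (hn : u₀ ^ 2 + u₁ ^ 2 = w₀ ^ 2 + w₁ ^ 2)
    (hz : x ^ 2 + y ^ 2 ≤ u₀ ^ 2 + u₁ ^ 2)
    (hc : 0 ≤ (u₁ - w₁) * (x - u₀) + (w₀ - u₀) * (y - u₁)) :
    x ∈ Icc u₀ w₀ ∧ y ∈ Icc w₁ u₁ := by
  have hx := chord_left hu₀ hu₁ h₀ h₁ hw₁ hn hz hc
  have hy : w₁ ≤ y := by
    refine chord_left (x := y) (y := x) hw₁ (hu₀.trans h₀) h₁ h₀ hu₀ (by linarith) (by linarith) ?_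
    linarith
  refine ⟨⟨hx, ?_⟩, hy, ?_⟩
  · by_contra! h
    nlinarith
  · by_contra! h
    nlinarith

/-- Two points of an open quarter of the circle `C`, and a small number `τ` which determines
another circle through the two points. -/
structure Lens (C : Circ) (σ τ a₁ a₂ b₁ b₂ : ℝ) : Prop where
  lt : a₁ < a₂
  gt : b₂ < b₁
  radius_pos : 0 < C.radius
  mem₁ : pw C (pt a₁ b₁) = 0
  mem₂ : pw C (pt a₂ b₂) = 0
  sign : σ = 1 ∨ σ = -1
  tau_pos : 0 < τ
  x₁ : τ * (b₁ - b₂) / 2 < σ * (a₁ - C.center 0)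
  x₂ : τ * (b₁ - b₂) / 2 < σ * (a₂ - C.center 0)
  y₁ : τ * (a₂ - a₁) / 2 < σ * (b₁ - C.center 1)
  y₂ : τ * (a₂ - a₁) / 2 < σ * (b₂ - C.center 1)

/-- The new circle through the points with coordinates `a₁, b₁` and `a₂, b₂`. -/
def lensCirc (C : Circ) (τ a₁ a₂ b₁ b₂ : ℝ) : Circ :=
  ⟨pt (C.center 0 - τ * (b₁ - b₂) / 2) (C.center 1 - τ * (a₂ - a₁) / 2),
    dist (pt a₁ b₁) (pt (C.center 0 - τ * (b₁ - b₂) / 2) (C.center 1 - τ * (a₂ - a₁) / 2))⟩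

/-- The arc of the new circle as a graph. -/
def lensArc (C : Circ) (σ τ a₁ a₂ b₁ b₂ t : ℝ) : ℝ :=
  (lensCirc C τ a₁ a₂ b₁ b₂).center 1 + σ * √((lensCirc C τ a₁ a₂ b₁ b₂).radius ^ 2 -
    (t - (lensCirc C τ a₁ a₂ b₁ b₂).center 0) ^ 2)

namespace Lens

variable {C : Circ} {σ τ a₁ a₂ b₁ b₂ : ℝ} (L : Lens C σ τ a₁ a₂ b₁ b₂)
include L

/-- The new circle is a member of the pencil spanned by `C` and the line of the chord: a multiple of
a linear form which vanishes on the chord and is positive above it is added to the power. This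
identity governs everything about the lens. -/
theorem pw_lens (z : Plane) : pw (lensCirc C τ a₁ a₂ b₁ b₂) z =
    pw C z + τ * ((b₁ - b₂) * (z 0 - a₁) + (a₂ - a₁) * (z 1 - b₁)) := by
  have h := L.mem₁
  rw [pw_eq]
  simp only [lensCirc]
  rw [dist_sq_eq, dist_sq_eq]
  simp only [pw, pt_zero, pt_one] at h ⊢
  linear_combination -h

theorem pw_lens₁ : pw (lensCirc C τ a₁ a₂ b₁ b₂) (pt a₁ b₁) = 0 := by
  rw [L.pw_lens, L.mem₁, pt_zero, pt_one]
  ring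

theorem pw_lens₂ : pw (lensCirc C τ a₁ a₂ b₁ b₂) (pt a₂ b₂) = 0 := by
  rw [L.pw_lens, L.mem₂, pt_zero, pt_one]
  ring

omit L in
theorem center_zero : (lensCirc C τ a₁ a₂ b₁ b₂).center 0 = C.center 0 - τ * (b₁ - b₂) / 2 :=
  pt_zero _ _

omit L in
theorem center_one : (lensCirc C τ a₁ a₂ b₁ b₂).center 1 = C.center 1 - τ * (a₂ - a₁) / 2 :=
  pt_one _ _

theorem center_lt₀ : 0 < τ * (b₁ - b₂) / 2 :=
  div_pos (mul_pos L.tau_pos (sub_pos.2 L.gt)) two_pos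

theorem center_lt₁ : 0 < τ * (a₂ - a₁) / 2 :=
  div_pos (mul_pos L.tau_pos (sub_pos.2 L.lt)) two_pos

theorem pos_x {t : ℝ} (ht : t ∈ Icc a₁ a₂) : 0 < σ * (t - (lensCirc C τ a₁ a₂ b₁ b₂).center 0) := by
  have h0 := L.center_lt₀
  have h1 := L.x₁
  have h2 := L.x₂
  rw [center_zero]
  rcases L.sign with h | h <;> rw [h] at h1 h2 ⊢ <;> linarith [ht.1, ht.2]

theorem pos_x' {t : ℝ} (ht : t ∈ Icc a₁ a₂) : 0 < σ * (t - C.center 0) := by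
  have h0 := L.center_lt₀
  have h1 := L.x₁
  have h2 := L.x₂
  rcases L.sign with h | h <;> rw [h] at h1 h2 ⊢ <;> linarith [ht.1, ht.2]

theorem pos_y {t : ℝ} (ht : t ∈ Icc b₂ b₁) : 0 < σ * (t - (lensCirc C τ a₁ a₂ b₁ b₂).center 1) := by
  have h0 := L.center_lt₁
  have h1 := L.y₁
  have h2 := L.y₂
  rw [center_one]
  rcases L.sign with h | h <;> rw [h] at h1 h2 ⊢ <;> linarith [ht.1, ht.2]

theorem pos_y' {t : ℝ} (ht : t ∈ Icc b₂ b₁) : 0 < σ * (t - C.center 1) := by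
  have h0 := L.center_lt₁
  have h1 := L.y₁
  have h2 := L.y₂
  rcases L.sign with h | h <;> rw [h] at h1 h2 ⊢ <;> linarith [ht.1, ht.2]

theorem radius_sq : (lensCirc C τ a₁ a₂ b₁ b₂).radius ^ 2 =
    (a₁ - (lensCirc C τ a₁ a₂ b₁ b₂).center 0) ^ 2 +
      (b₁ - (lensCirc C τ a₁ a₂ b₁ b₂).center 1) ^ 2 := by
  have h := L.pw_lens₁
  simp only [pw, pt_zero, pt_one] at h
  linarith

theorem radius_sq₂ : (lensCirc C τ a₁ a₂ b₁ b₂).radius ^ 2 =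
    (a₂ - (lensCirc C τ a₁ a₂ b₁ b₂).center 0) ^ 2 +
      (b₂ - (lensCirc C τ a₁ a₂ b₁ b₂).center 1) ^ 2 := by
  have h := L.pw_lens₂
  simp only [pw, pt_zero, pt_one] at h
  linarith

theorem lens_radius_pos : 0 < (lensCirc C τ a₁ a₂ b₁ b₂).radius := by
  have h0 : 0 ≤ (lensCirc C τ a₁ a₂ b₁ b₂).radius := dist_nonneg
  refine lt_of_le_of_ne h0 fun h => ?_
  have h1 := L.radius_sq
  rw [← h] at h1
  have h2 := L.pos_x (left_mem_Icc.2 L.lt.le)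
  obtain ⟨h3, -⟩ := eq_zero_of_sq_add_sq_le (h1.symm.trans_le (by norm_num))
  rw [h3, mul_zero] at h2
  exact h2.false

theorem ne_lens : C ≠ lensCirc C τ a₁ a₂ b₁ b₂ := by
  intro h
  have h1 := congrArg (fun A : Circ => A.center 0) h
  have h2 := center_zero (C := C) (τ := τ) (a₁ := a₁) (a₂ := a₂) (b₁ := b₁) (b₂ := b₂)
  have h3 := L.center_lt₀
  simp only at h1
  linarith

/-- A point between the two circles lies on a definite side of the chord, because the two powers
differ by the linear form. It thus belongs to a cap of a disk over a chord with ends in one open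
quadrant, and `chord_box` applies. -/
theorem box {z : Plane} (h1 : σ * pw C z ≤ 0) (h2 : 0 ≤ σ * pw (lensCirc C τ a₁ a₂ b₁ b₂) z) :
    z 0 ∈ Icc a₁ a₂ ∧ z 1 ∈ Icc b₂ b₁ := by
  have hlt := L.lt
  have hgt := L.gt
  have hm : 0 ≤ σ * ((b₁ - b₂) * (z 0 - a₁) + (a₂ - a₁) * (z 1 - b₁)) := by
    rw [L.pw_lens] at h2
    refine nonneg_of_mul_nonneg_right (?_ : (0 : ℝ) ≤ τ * _) L.tau_pos
    linarith
  have l1 := left_mem_Icc.2 hlt.le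
  have r1 := right_mem_Icc.2 hlt.le
  have l2 := left_mem_Icc.2 hgt.le
  have r2 := right_mem_Icc.2 hgt.le
  rcases L.sign with hσ | hσ
  · have x1 := L.pos_x' l1
    have y1 := L.pos_y' r2
    have y2 := L.pos_y' l2
    have e1 := L.mem₁
    have e2 := L.mem₂
    rw [hσ, one_mul] at h1 h2 hm x1 y1 y2
    simp only [pw, pt_zero, pt_one] at h1 e1 e2
    obtain ⟨⟨k1, k2⟩, k3, k4⟩ := chord_box (x := z 0 - C.center 0) (y := z 1 - C.center 1) x1 y1
      (w₀ := a₂ - C.center 0) (by linarith) (w₁ := b₂ - C.center 1) (by linarith) y2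
      (by linarith) (by linarith) (by linarith)
    exact ⟨⟨by linarith, by linarith⟩, by linarith, by linarith⟩
  -- For `σ = -1` the cap belongs to the new disk, and it is turned into the first quadrant by a
  -- half turn about the new centre. The margins in `Lens` keep the chord in the lower left quadrant
  -- with respect to the moved centre.
  · have x2 := L.pos_x r1
    have y1 := L.pos_y r2
    have y2 := L.pos_y l2
    have e1 := L.pw_lens₁
    have e2 := L.pw_lens₂
    rw [hσ] at h1 h2 hm x2 y1 y2
    simp only [pw, pt_zero, pt_one] at h2 e1 e2
    set c₀ := (lensCirc C τ a₁ a₂ b₁ b₂).center 0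
    set c₁ := (lensCirc C τ a₁ a₂ b₁ b₂).center 1
    obtain ⟨⟨k1, k2⟩, k3, k4⟩ := chord_box (x := c₀ - z 0) (y := c₁ - z 1) (u₀ := c₀ - a₂)
      (u₁ := c₁ - b₂) (w₀ := c₀ - a₁) (w₁ := c₁ - b₁) (by linarith) (by linarith) (by linarith)
      (by linarith) (by linarith) (by linarith) (by linarith) (by linarith)
    exact ⟨⟨by linarith, by linarith⟩, by linarith, by linarith⟩

/-- Among the levels of the chord, the horizontal distance from the new centre is largest at `a₂` if
`σ = 1` and at `a₁` if `σ = -1`; there the circle passes through an end of the chord, at a height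
different from that of the centre. -/
theorem radicand_pos {t : ℝ} (ht : t ∈ Icc a₁ a₂) : 0 < (lensCirc C τ a₁ a₂ b₁ b₂).radius ^ 2 -
    (t - (lensCirc C τ a₁ a₂ b₁ b₂).center 0) ^ 2 := by
  have h1 := L.radius_sq
  have h2 := L.radius_sq₂
  have hgt := L.gt
  have y1 := L.pos_y (right_mem_Icc.2 hgt.le)
  have y2 := L.pos_y (left_mem_Icc.2 hgt.le)
  have xt := L.pos_x ht
  have x1 := L.pos_x (left_mem_Icc.2 L.lt.le)
  have x2 := L.pos_x (right_mem_Icc.2 L.lt.le)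
  set c₀ := (lensCirc C τ a₁ a₂ b₁ b₂).center 0
  set c₁ := (lensCirc C τ a₁ a₂ b₁ b₂).center 1
  rcases L.sign with hσ | hσ <;> rw [hσ] at y1 y2 xt x1 x2
  · rw [h2]
    nlinarith [ht.2]
  · rw [h1]
    nlinarith [ht.1]

theorem sign_sq : σ * σ = 1 := by
  rcases L.sign with h | h <;> rw [h] <;> norm_num

theorem pw_arc {t : ℝ} (ht : t ∈ Icc a₁ a₂) :
    pw (lensCirc C τ a₁ a₂ b₁ b₂) (pt t (lensArc C σ τ a₁ a₂ b₁ b₂ t)) = 0 := by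
  have h := Real.mul_self_sqrt (L.radicand_pos ht).le
  have hs := L.sign_sq
  simp only [pw, pt_zero, pt_one, lensArc]
  linear_combination σ * σ * h + ((lensCirc C τ a₁ a₂ b₁ b₂).radius ^ 2 -
    (t - (lensCirc C τ a₁ a₂ b₁ b₂).center 0) ^ 2) * hs

theorem arc_pos {t : ℝ} (ht : t ∈ Icc a₁ a₂) :
    0 < σ * (lensArc C σ τ a₁ a₂ b₁ b₂ t - (lensCirc C τ a₁ a₂ b₁ b₂).center 1) := by
  have h := Real.sqrt_pos.2 (L.radicand_pos ht)
  have hs := L.sign_sq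
  rw [lensArc, add_sub_cancel_left, ← mul_assoc, hs, one_mul]
  exact h

omit L in
theorem continuous_lensArc : Continuous (lensArc C σ τ a₁ a₂ b₁ b₂) := by
  unfold lensArc
  fun_prop

theorem arc_anti : StrictAntiOn (lensArc C σ τ a₁ a₂ b₁ b₂) (Icc a₁ a₂) := by
  intro s hs t ht hst
  have h := slope_eq (L.pw_arc hs) (L.pw_arc ht) σ
  have h1 : 0 < (lensArc C σ τ a₁ a₂ b₁ b₂ s - lensArc C σ τ a₁ a₂ b₁ b₂ t) * _ :=
    h.ge.trans_lt' (mul_pos (sub_pos.2 hst) (add_pos (L.pos_x hs) (L.pos_x ht)))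
  exact sub_pos.1 (pos_of_mul_pos_left h1 (add_pos (L.arc_pos hs) (L.arc_pos ht)).le)

theorem arc_eq {t y : ℝ} (ht : t ∈ Icc a₁ a₂) (hy : y ∈ Icc b₂ b₁)
    (h : pw (lensCirc C τ a₁ a₂ b₁ b₂) (pt t y) = 0) : lensArc C σ τ a₁ a₂ b₁ b₂ t = y := by
  have h1 := pw_pt_eq (L.pw_arc ht) σ y
  rw [h, mul_zero] at h1
  have h2 := add_pos (L.pos_y hy) (L.arc_pos ht)
  have := (mul_eq_zero.1 h1.symm).resolve_right h2.ne'
  linarith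

theorem arc₁ : lensArc C σ τ a₁ a₂ b₁ b₂ a₁ = b₁ :=
  L.arc_eq (left_mem_Icc.2 L.lt.le) (right_mem_Icc.2 L.gt.le) L.pw_lens₁

theorem arc₂ : lensArc C σ τ a₁ a₂ b₁ b₂ a₂ = b₂ :=
  L.arc_eq (right_mem_Icc.2 L.lt.le) (left_mem_Icc.2 L.gt.le) L.pw_lens₂

theorem arc_mem {t : ℝ} (ht : t ∈ Icc a₁ a₂) : lensArc C σ τ a₁ a₂ b₁ b₂ t ∈ Icc b₂ b₁ := by
  have h := L.arc_anti.antitoneOn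
  exact ⟨L.arc₂.ge.trans (h ht (right_mem_Icc.2 L.lt.le) ht.2),
    (h (left_mem_Icc.2 L.lt.le) ht ht.1).trans L.arc₁.le⟩

theorem nonneg_iff {t y : ℝ} (ht : t ∈ Icc a₁ a₂) (hy : y ∈ Icc b₂ b₁) :
    0 ≤ σ * pw (lensCirc C τ a₁ a₂ b₁ b₂) (pt t y) ↔ lensArc C σ τ a₁ a₂ b₁ b₂ t ≤ y := by
  rw [pw_pt_eq (L.pw_arc ht) σ y, mul_nonneg_iff_of_pos_right
    (add_pos (L.pos_y hy) (L.arc_pos ht)), sub_nonneg]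

theorem pos_iff {t y : ℝ} (ht : t ∈ Icc a₁ a₂) (hy : y ∈ Icc b₂ b₁) :
    0 < σ * pw (lensCirc C τ a₁ a₂ b₁ b₂) (pt t y) ↔ lensArc C σ τ a₁ a₂ b₁ b₂ t < y := by
  rw [pw_pt_eq (L.pw_arc ht) σ y, mul_pos_iff_of_pos_right
    (add_pos (L.pos_y hy) (L.arc_pos ht)), sub_pos]

/-- The new arc lies below the old one. -/
theorem arc_lt {t y : ℝ} (ht : t ∈ Ioo a₁ a₂) (hy : y ∈ Ioo b₂ b₁) (h : pw C (pt t y) = 0) :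
    lensArc C σ τ a₁ a₂ b₁ b₂ t < y := by
  rw [← L.pos_iff (Ioo_subset_Icc_self ht) (Ioo_subset_Icc_self hy), L.pw_lens, h, zero_add,
    pt_zero, pt_one]
  have s1 := slope_eq L.mem₁ h σ
  have s2 := slope_eq h L.mem₂ σ
  have x1 := L.pos_x' (left_mem_Icc.2 L.lt.le)
  have x2 := L.pos_x' (right_mem_Icc.2 L.lt.le)
  have xt := L.pos_x' (Ioo_subset_Icc_self ht)
  have y1 := L.pos_y' (right_mem_Icc.2 L.gt.le)
  have y2 := L.pos_y' (left_mem_Icc.2 L.gt.le)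
  have yt := L.pos_y' (Ioo_subset_Icc_self hy)
  have hs := L.sign_sq
  set c₀ := C.center 0
  set c₁ := C.center 1
  have hP : 0 < (σ * (y - c₁) + σ * (b₂ - c₁)) * (σ * (b₁ - c₁) + σ * (y - c₁)) :=
    mul_pos (add_pos yt y2) (add_pos y1 yt)
  have hAB : 0 < (t - a₁) * (a₂ - t) := mul_pos (sub_pos.2 ht.1) (sub_pos.2 ht.2)
  -- On `C` the new power is `τ` times the linear form. Multiplied by the denominators of the secant
  -- slopes before and after `t`, it becomes a comparison of these slopes, whose sign is that of the
  -- convexity of the arc.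
  have key : σ * (τ * ((b₁ - b₂) * (t - a₁) + (a₂ - a₁) * (y - b₁))) *
      ((σ * (y - c₁) + σ * (b₂ - c₁)) * (σ * (b₁ - c₁) + σ * (y - c₁))) =
      τ * ((t - a₁) * (a₂ - t)) * (σ * ((σ * (t - c₀) + σ * (a₂ - c₀)) *
        (σ * (b₁ - c₁) + σ * (y - c₁)) - (σ * (a₁ - c₀) + σ * (t - c₀)) *
        (σ * (y - c₁) + σ * (b₂ - c₁)))) := by
    linear_combination σ * τ * (t - a₁) * (σ * (b₁ - c₁) + σ * (y - c₁)) * s2 -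
      σ * τ * (a₂ - t) * (σ * (y - c₁) + σ * (b₂ - c₁)) * s1
  have hbr : 0 < σ * ((σ * (t - c₀) + σ * (a₂ - c₀)) *
        (σ * (b₁ - c₁) + σ * (y - c₁)) - (σ * (a₁ - c₀) + σ * (t - c₀)) *
        (σ * (y - c₁) + σ * (b₂ - c₁))) := by
    have ht1 := ht.1
    have ht2 := ht.2
    have hy1 := hy.1
    have hy2 := hy.2
    rcases L.sign with hσ | hσ <;> rw [hσ] at x1 x2 xt y1 y2 yt ⊢
    · rw [one_mul, sub_pos]
      exact mul_lt_mul'' (by linarith) (by linarith) (by linarith) (by linarith)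
    · rw [neg_one_mul, neg_sub, sub_pos]
      exact mul_lt_mul'' (by linarith) (by linarith) (by linarith) (by linarith)
  refine pos_of_mul_pos_left (?_ : (0 : ℝ) < _ * _) hP.le
  rw [key]
  exact mul_pos (mul_pos L.tau_pos hAB) hbr

/-! ### The area -/

theorem of_le {τ' : ℝ} (h : 0 < τ') (hle : τ' ≤ τ) : Lens C σ τ' a₁ a₂ b₁ b₂ := by
  have h1 : τ' * (b₁ - b₂) / 2 ≤ τ * (b₁ - b₂) / 2 := by
    have := mul_le_mul_of_nonneg_right hle (sub_pos.2 L.gt).le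
    linarith
  have h2 : τ' * (a₂ - a₁) / 2 ≤ τ * (a₂ - a₁) / 2 := by
    have := mul_le_mul_of_nonneg_right hle (sub_pos.2 L.lt).le
    linarith
  exact ⟨L.lt, L.gt, L.radius_pos, L.mem₁, L.mem₂, L.sign, h, h1.trans_lt L.x₁, h1.trans_lt L.x₂,
    h2.trans_lt L.y₁, h2.trans_lt L.y₂⟩

/-- The area between the two circles is small for small `τ`. -/
theorem exists_area_lt {V : ENNReal} (hV : 0 < V) : ∃ τ', Lens C σ τ' a₁ a₂ b₁ b₂ ∧
    volume {z | σ * pw C z ≤ 0 ∧ 0 ≤ σ * pw (lensCirc C τ' a₁ a₂ b₁ b₂) z} < V := by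
  let τ' : ℕ → ℝ := fun k => τ / (k + 1)
  have hpos : ∀ k, 0 < τ' k := fun k => div_pos L.tau_pos (by positivity)
  have hanti : Antitone τ' := fun j k hjk =>
    div_le_div_of_nonneg_left L.tau_pos.le (by positivity) (by simpa using hjk)
  have hle : ∀ k, τ' k ≤ τ := fun k => (hanti (Nat.zero_le k)).trans (by simp [τ'])
  have hL : ∀ k, Lens C σ (τ' k) a₁ a₂ b₁ b₂ := fun k => L.of_le (hpos k) (hle k)
  let Z : ℕ → Set Plane := fun k =>
    {z | σ * pw C z ≤ 0 ∧ 0 ≤ σ * pw (lensCirc C (τ' k) a₁ a₂ b₁ b₂) z}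
  have hcl : ∀ k, IsClosed (Z k) := fun k =>
    (isClosed_le (continuous_const.mul (continuous_pw C)) continuous_const).inter
      (isClosed_le continuous_const (continuous_const.mul (continuous_pw _)))
  have hZ : Antitone Z := by
    rintro j k hjk z ⟨h1, h2⟩
    refine ⟨h1, ?_⟩
    rw [(hL _).pw_lens] at h2 ⊢
    have h3 : 0 ≤ τ' k * (σ * ((b₁ - b₂) * (z 0 - a₁) + (a₂ - a₁) * (z 1 - b₁))) := by linarith
    have h4 := nonneg_of_mul_nonneg_right h3 (hpos k)
    have h5 := mul_le_mul_of_nonneg_right (hanti hjk) h4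
    linarith
  have hfin : volume (Z 0) ≠ ⊤ := by
    have : Z 0 ⊆ Metric.closedBall (pt a₁ b₁) ((a₂ - a₁) + (b₁ - b₂)) := by
      rintro z ⟨h1, h2⟩
      obtain ⟨h3, h4⟩ := (hL 0).box h1 h2
      have hl := sub_pos.2 L.lt
      have hg := sub_pos.2 L.gt
      rw [Metric.mem_closedBall, ← sq_le_sq₀ dist_nonneg (by linarith), dist_sq_eq, pt_zero,
        pt_one]
      nlinarith [h3.1, h3.2, h4.1, h4.2]
    exact ((Metric.isBounded_closedBall.subset this).measure_lt_top).ne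
  have hlim := tendsto_measure_iInter_atTop (μ := volume)
    (fun k => (hcl k).measurableSet.nullMeasurableSet) hZ ⟨0, hfin⟩
  -- In the limit `τ → 0` both inequalities concern `C` itself, so only points of the circle remain.
  -- Continuity from above for the decreasing bounded sets `Z k` gives a small area.
  have hzero : volume (⋂ k, Z k) = 0 := by
    refine measure_mono_null (t := Metric.sphere C.center C.radius) ?_
      (Measure.addHaar_sphere_of_ne_zero _ _ L.radius_pos.ne')
    intro z hz
    rw [mem_iInter] at hz
    change z ∈ C
    rw [mem_circ_iff L.radius_pos]
    have h1 := (hz 0).1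
    have hc : Filter.Tendsto (fun k => σ * (pw C z + τ' k *
        ((b₁ - b₂) * (z 0 - a₁) + (a₂ - a₁) * (z 1 - b₁)))) Filter.atTop
        (nhds (σ * (pw C z + 0 * ((b₁ - b₂) * (z 0 - a₁) + (a₂ - a₁) * (z 1 - b₁))))) := by
      have : Filter.Tendsto τ' Filter.atTop (nhds 0) :=
        tendsto_const_nhds.div_atTop (Filter.tendsto_atTop_add_const_right _ _
          tendsto_natCast_atTop_atTop)
      exact ((this.mul_const _).const_add _).const_mul _
    have h2 : 0 ≤ σ * (pw C z + 0 * ((b₁ - b₂) * (z 0 - a₁) + (a₂ - a₁) * (z 1 - b₁))) := by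
      refine ge_of_tendsto' hc fun k => ?_
      rw [← (hL k).pw_lens]
      exact (hz k).2
    rw [zero_mul, add_zero] at h2
    have h3 := le_antisymm h1 h2
    have hs := L.sign_sq
    calc pw C z = σ * (σ * pw C z) := by rw [← mul_assoc, hs, one_mul]
      _ = 0 := by rw [h3, mul_zero]
  rw [hzero] at hlim
  obtain ⟨k, hk⟩ := (hlim.eventually_lt_const hV).exists
  exact ⟨τ' k, hL k, hk⟩

end Lens

end SSRegions
end

noncomputable section
namespace SSRegions

open Set

/-! ### Cutting off a thin piece along a chord -/

/-- The situation in which a thin piece next to a generic arc is cut off by a new circle through two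
points of the arc. -/
structure LensCut {T : FGraph} (S : StripData T) (R : SSRegion) (e : T.E) (C : Circ)
    (σ τ α β a₁ a₂ : ℝ) : Prop where
  model : S.IsModel R
  arc : Arc S R e C σ α β
  lens : Lens C σ τ a₁ a₂ (S.hi e a₁) (S.hi e a₂)
  left : α < a₁
  right : a₂ < β
  low : ∀ t ∈ Icc a₁ a₂, S.lo e t < S.hi e a₂

namespace LensCut

variable {T : FGraph} {S : StripData T} {R : SSRegion} {e : T.E} {C : Circ} {σ τ α β a₁ a₂ : ℝ}

variable (S e C τ a₁ a₂) in
/-- The new circle. -/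
def circ : Circ := lensCirc C τ a₁ a₂ (S.hi e a₁) (S.hi e a₂)

variable (S e C σ τ a₁ a₂) in
/-- The arc of the new circle as a graph. -/
def graph (t : ℝ) : ℝ := lensArc C σ τ a₁ a₂ (S.hi e a₁) (S.hi e a₂) t

variable (S e C σ τ a₁ a₂) in
/-- The closed set which is removed. -/
def cut : Set Plane := {z | 0 ≤ σ * pw (circ S e C τ a₁ a₂) z}

variable (X : LensCut S R e C σ τ α β a₁ a₂)
include X

theorem sub {t : ℝ} (ht : t ∈ Icc a₁ a₂) : t ∈ Icc α β :=
  ⟨X.left.le.trans ht.1, ht.2.trans X.right.le⟩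

theorem a₁_mem : a₁ ∈ Icc a₁ a₂ := left_mem_Icc.2 X.lens.lt.le

theorem a₂_mem : a₂ ∈ Icc a₁ a₂ := right_mem_Icc.2 X.lens.lt.le

theorem hi_mem {t : ℝ} (ht : t ∈ Icc a₁ a₂) : S.hi e t ∈ Icc (S.hi e a₂) (S.hi e a₁) :=
  ⟨X.arc.anti.antitoneOn (X.sub ht) (X.sub X.a₂_mem) ht.2,
    X.arc.anti.antitoneOn (X.sub X.a₁_mem) (X.sub ht) ht.1⟩

theorem pw_hi {t : ℝ} (ht : t ∈ Icc a₁ a₂) : pw C (pt t (S.hi e t)) = 0 :=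
  (mem_circ_iff X.lens.radius_pos).1 (X.arc.onlyOn t (X.sub ht)).2.1

theorem graph_lt {t : ℝ} (ht : t ∈ Ioo a₁ a₂) : graph S e C σ τ a₁ a₂ t < S.hi e t := by
  have ht' := Ioo_subset_Icc_self ht
  exact X.lens.arc_lt ht ⟨X.arc.anti (X.sub ht') (X.sub X.a₂_mem) ht.2,
    X.arc.anti (X.sub X.a₁_mem) (X.sub ht') ht.1⟩ (X.pw_hi ht')

theorem graph₁ : graph S e C σ τ a₁ a₂ a₁ = S.hi e a₁ := X.lens.arc₁

theorem graph₂ : graph S e C σ τ a₁ a₂ a₂ = S.hi e a₂ := X.lens.arc₂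

omit X in
theorem ends {t : ℝ} (ht : t ∈ Icc a₁ a₂) : t = a₁ ∨ t = a₂ ∨ t ∈ Ioo a₁ a₂ := by
  rcases ht.1.eq_or_lt with h | h
  · exact .inl h.symm
  · rcases ht.2.eq_or_lt with h' | h'
    exacts [.inr (.inl h'), .inr (.inr ⟨h, h'⟩)]

theorem graph_le {t : ℝ} (ht : t ∈ Icc a₁ a₂) : graph S e C σ τ a₁ a₂ t ≤ S.hi e t := by
  rcases ends ht with rfl | rfl | h
  exacts [X.graph₁.le, X.graph₂.le, (X.graph_lt h).le]

theorem lo_lt {t : ℝ} (ht : t ∈ Icc a₁ a₂) : S.lo e t < graph S e C σ τ a₁ a₂ t :=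
  (X.low t ht).trans_le (X.lens.arc_mem ht).1

theorem mem_cut_iff {z : Plane} (h0 : z 0 ∈ Icc a₁ a₂) (h1 : S.hi e a₂ ≤ z 1)
    (h2 : z 1 ≤ S.hi e (z 0)) :
    z ∈ cut S e C σ τ a₁ a₂ ↔ graph S e C σ τ a₁ a₂ (z 0) ≤ z 1 := by
  have := X.lens.nonneg_iff h0 ⟨h1, h2.trans (X.hi_mem h0).2⟩
  rwa [pt_eta] at this

theorem pos_of_lt {z : Plane} (h0 : z 0 ∈ Icc a₁ a₂) (h1 : graph S e C σ τ a₁ a₂ (z 0) < z 1)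
    (h2 : z 1 ≤ S.hi e (z 0)) : 0 < σ * pw (circ S e C τ a₁ a₂) z := by
  have := (X.lens.pos_iff h0 ⟨(X.lens.arc_mem h0).1.trans h1.le, h2.trans (X.hi_mem h0).2⟩).2 h1
  rwa [pt_eta] at this

/-- The removed points lie in the strip, between the two arcs. -/
theorem of_mem_cut {z : Plane} (hK : z ∈ closure R.domain) (hz : z ∈ cut S e C σ τ a₁ a₂) :
    z 0 ∈ Icc a₁ a₂ ∧ graph S e C σ τ a₁ a₂ (z 0) ≤ z 1 ∧ z 1 ≤ S.hi e (z 0) := by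
  have hpw := X.arc.pw_le hK
  obtain ⟨h0, h1⟩ := X.lens.box hpw hz
  have h2 : z 1 ≤ S.hi e (z 0) := by
    have h3 := pw_pt_eq (X.pw_hi h0) σ (z 1)
    rw [pt_eta] at h3
    rw [h3] at hpw
    have h4 := add_pos (X.lens.pos_y' h1) (X.lens.pos_y' (X.hi_mem h0))
    exact sub_nonpos.1 (nonpos_of_mul_nonpos_left hpw h4)
  exact ⟨h0, (X.mem_cut_iff h0 h1.1 h2).1 hz, h2⟩

theorem mem_strip {z : Plane} (h0 : z 0 ∈ Icc a₁ a₂) (h1 : graph S e C σ τ a₁ a₂ (z 0) ≤ z 1)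
    (h2 : z 1 ≤ S.hi e (z 0)) : z ∈ S.strip e :=
  ⟨X.arc.mem_Ioo (X.sub h0), (X.lo_lt h0).le.trans h1, h2⟩

omit X in
theorem isClosed_cut : IsClosed (cut S e C σ τ a₁ a₂) :=
  isClosed_le continuous_const (continuous_const.mul (continuous_pw _))

theorem circ_pos : 0 < (circ S e C τ a₁ a₂).radius := X.lens.lens_radius_pos

theorem mem_circ_iff' {z : Plane} : z ∈ circ S e C τ a₁ a₂ ↔ σ * pw (circ S e C τ a₁ a₂) z = 0 := by
  rw [mem_circ_iff X.circ_pos]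
  have hs := X.lens.sign_sq
  constructor
  · intro h
    rw [h, mul_zero]
  · intro h
    rw [← one_mul (pw _ z), ← hs, mul_assoc, h, mul_zero]

theorem circ_subset {z : Plane} (hz : z ∈ circ S e C τ a₁ a₂) : z ∈ cut S e C σ τ a₁ a₂ :=
  (X.mem_circ_iff'.1 hz).ge

theorem low_subset : obetween a₁ a₂ (S.lo e) (graph S e C σ τ a₁ a₂) ⊆
    R.domain \ cut S e C σ τ a₁ a₂ := by
  rintro z ⟨h0, h1, h2⟩
  have h0' := Ioo_subset_Icc_self h0
  have hD : z ∈ R.domain := X.model.inner e ⟨X.arc.mem_Ioo (X.sub h0'), h1, h2.trans_le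
    (X.graph_le h0')⟩
  exact ⟨hD, fun hz => h2.not_ge (X.of_mem_cut (subset_closure hD) hz).2.1⟩

omit X in
theorem nonpos_of_mem_closure {z : Plane} (hz : z ∈ closure (R.domain \ cut S e C σ τ a₁ a₂)) :
    σ * pw (circ S e C τ a₁ a₂) z ≤ 0 := by
  have : closure (R.domain \ cut S e C σ τ a₁ a₂) ⊆ {z | σ * pw (circ S e C τ a₁ a₂) z ≤ 0} :=
    closure_minimal (fun z hz => (not_le.1 (fun h => hz.2 h) : σ * pw _ z < 0).le)
      (isClosed_le (continuous_const.mul (continuous_pw _)) continuous_const)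
  exact this hz

/-- Points strictly above the new arc have a neighbourhood inside the removed set, while points of
the new arc, including both corners, are limits from the part of the strip below it. -/
theorem closure_eq : closure (R.domain \ cut S e C σ τ a₁ a₂) = closure R.domain \
    {z | z ∈ S.strip e ∧ z 0 ∈ Ioo a₁ a₂ ∧ graph S e C σ τ a₁ a₂ (z 0) < z 1} := by
  ext z
  constructor
  · intro hz
    refine ⟨closure_mono sdiff_subset hz, ?_⟩
    rintro ⟨h1, h2, h3⟩
    exact (nonpos_of_mem_closure hz).not_gt (X.pos_of_lt (Ioo_subset_Icc_self h2) h3 h1.2.2)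
  · rintro ⟨hK, hn⟩
    by_cases hz : z ∈ cut S e C σ τ a₁ a₂
    · obtain ⟨h0, h1, h2⟩ := X.of_mem_cut hK hz
      have hst := X.mem_strip h0 h1 h2
      have h3 : z 1 ≤ graph S e C σ τ a₁ a₂ (z 0) := by
        rcases ends h0 with h | h | h
        · rw [h, X.graph₁, ← h]
          exact h2
        · rw [h, X.graph₂, ← h]
          exact h2
        · exact not_lt.1 fun hlt => hn ⟨hst, h, hlt⟩
      have hsub : Icc a₁ a₂ ⊆ Icc α β := fun t ht => X.sub ht
      exact closure_mono X.low_subset (cbetween_subset_closure X.lens.lt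
        ((X.arc.continuousOn X.model).2.mono hsub) Lens.continuous_lensArc.continuousOn
        (fun t ht => X.lo_lt (Ioo_subset_Icc_self ht)) ⟨h0, hst.2.1, h3⟩)
    · have := isClosed_cut.isOpen_compl.inter_closure (t := R.domain) ⟨hz, hK⟩
      rwa [inter_comm, ← sdiff_eq] at this

theorem corner {z : Plane} (hK : z ∈ closure R.domain) (hz : z ∈ cut S e C σ τ a₁ a₂) {C' : Circ}
    (hC' : C' ∈ R.circles) (hzC : z ∈ C') : z 1 = S.hi e (z 0) ∧ C' = C := by
  obtain ⟨h0, h1, h2⟩ := X.of_mem_cut hK hz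
  exact X.model.eq_of_mem_circ X.arc (X.sub h0) ((X.lo_lt h0).trans_le h1) h2 hC' hzC

theorem end_mem_closure {t : ℝ} (ht : t = a₁ ∨ t = a₂) :
    pt t (S.hi e t) ∈ closure (R.domain \ cut S e C σ τ a₁ a₂) := by
  have ht' : t ∈ Icc a₁ a₂ := by
    rcases ht with rfl | rfl
    exacts [X.a₁_mem, X.a₂_mem]
  rw [X.closure_eq]
  refine ⟨(X.arc.boundary t (X.sub ht')).1, ?_⟩
  rintro ⟨-, h, -⟩
  rw [pt_zero] at h
  rcases ht with rfl | rfl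
  exacts [h.1.false, h.2.false]

theorem end_mem_circ {t : ℝ} (ht : t = a₁ ∨ t = a₂) : pt t (S.hi e t) ∈ circ S e C τ a₁ a₂ := by
  rw [mem_circ_iff X.circ_pos]
  rcases ht with rfl | rfl
  exacts [X.lens.pw_lens₁, X.lens.pw_lens₂]

theorem end_mem_old {t : ℝ} (ht : t = a₁ ∨ t = a₂) : pt t (S.hi e t) ∈ C := by
  rw [mem_circ_iff X.lens.radius_pos]
  rcases ht with rfl | rfl
  exacts [X.lens.mem₁, X.lens.mem₂]

theorem continuousOn : ContinuousOn (S.hi e) (Icc a₁ a₂) ∧ ContinuousOn (S.lo e) (Icc a₁ a₂) := by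
  have hsub : Icc a₁ a₂ ⊆ Icc α β := fun t ht => X.sub ht
  exact ⟨(X.arc.continuousOn X.model).1.mono hsub, (X.arc.continuousOn X.model).2.mono hsub⟩

/-- All removed points of the region lie in the open strip over the chord, and what remains of that
strip is the connected region below the new arc; `isPreconnected_of_union` applies. -/
theorem isConnected : IsConnected (R.domain \ cut S e C σ τ a₁ a₂) := by
  have hne : (obetween a₁ a₂ (S.lo e) (graph S e C σ τ a₁ a₂)).Nonempty := by
    have hm : (a₁ + a₂) / 2 ∈ Ioo a₁ a₂ := ⟨by linarith [X.lens.lt], by linarith [X.lens.lt]⟩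
    have := X.lo_lt (Ioo_subset_Icc_self hm)
    refine ⟨pt ((a₁ + a₂) / 2) ((S.lo e ((a₁ + a₂) / 2) +
      graph S e C σ τ a₁ a₂ ((a₁ + a₂) / 2)) / 2), ?_, ?_, ?_⟩ <;> simp only [pt_zero, pt_one]
    · exact hm
    · linarith
    · linarith
  obtain ⟨hhi, hlo⟩ := X.continuousOn
  refine ⟨hne.mono X.low_subset, ?_⟩
  refine isPreconnected_of_union (U := obetween a₁ a₂ (S.lo e) (S.hi e))
    R.isConnected_domain.isPreconnected (R.isOpen_domain.sdiff isClosed_cut)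
    (isOpen_obetween (hlo.mono Ioo_subset_Icc_self) (hhi.mono Ioo_subset_Icc_self)) ?_ ?_
  · apply Subset.antisymm
    · intro z hz
      by_cases hzc : z ∈ cut S e C σ τ a₁ a₂
      · obtain ⟨h0, h1, h2⟩ := X.of_mem_cut (subset_closure hz) hzc
        have hlt : z 1 < S.hi e (z 0) := by
          refine lt_of_le_of_ne h2 fun h => ?_
          have := (X.arc.boundary (z 0) (X.sub h0)).2
          rw [← h, pt_eta] at this
          exact this hz
        right
        rcases ends h0 with h | h | h
        · rw [h, X.graph₁, ← h] at h1
          exact absurd h1 hlt.not_ge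
        · rw [h, X.graph₂, ← h] at h1
          exact absurd h1 hlt.not_ge
        · exact ⟨h, (X.lo_lt h0).trans_le h1, hlt⟩
      · exact .inl ⟨hz, hzc⟩
    · rintro z (hz | hz)
      · exact hz.1
      · exact X.model.inner e ⟨X.arc.mem_Ioo (X.sub (Ioo_subset_Icc_self hz.1)), hz.2⟩
  · have : (R.domain \ cut S e C σ τ a₁ a₂) ∩ obetween a₁ a₂ (S.lo e) (S.hi e) =
        obetween a₁ a₂ (S.lo e) (graph S e C σ τ a₁ a₂) := by
      ext z
      constructor
      · rintro ⟨⟨hD, hz⟩, h0, h1, h2⟩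
        refine ⟨h0, h1, not_le.1 fun hle => hz ?_⟩
        have h0' := Ioo_subset_Icc_self h0
        exact (X.mem_cut_iff h0' ((X.lens.arc_mem h0').1.trans hle) h2.le).2 hle
      · intro hz
        exact ⟨X.low_subset hz, hz.1, hz.2.1, hz.2.2.trans_le
          (X.graph_le (Ioo_subset_Icc_self hz.1))⟩
    rw [this]
    exact isPreconnected_obetween (hlo.mono Ioo_subset_Icc_self)
      Lens.continuous_lensArc.continuousOn fun t ht => X.lo_lt (Ioo_subset_Icc_self ht)

/-- A common point of the new circle and an old one is an end point of the chord. -/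
theorem end_of_mem {z : Plane} (hz : z ∈ closure (R.domain \ cut S e C σ τ a₁ a₂))
    (hzS : z ∈ circ S e C τ a₁ a₂) {C' : Circ} (hC' : C' ∈ R.circles) (hzC : z ∈ C') :
    (z 0 = a₁ ∨ z 0 = a₂) ∧ z = pt (z 0) (S.hi e (z 0)) ∧ C' = C := by
  rw [X.closure_eq] at hz
  have hcut := X.circ_subset hzS
  obtain ⟨h0, h1, h2⟩ := X.of_mem_cut hz.1 hcut
  obtain ⟨h3, h4⟩ := X.corner hz.1 hcut hC' hzC
  refine ⟨?_, ?_, h4⟩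
  · rcases ends h0 with h | h | h
    · exact .inl h
    · exact .inr h
    · refine absurd ⟨X.mem_strip h0 h1 h2, h, ?_⟩ hz.2
      rw [h3]
      exact X.graph_lt h
  · rw [← h3, pt_eta]

theorem carving : Carving R (cut S e C σ τ a₁ a₂) (circ S e C τ a₁ a₂) where
  isClosed := isClosed_cut
  radius_pos := X.circ_pos
  circ_subset := fun z hz => X.circ_subset hz
  isConnected := X.isConnected
  touch := fun z hz hzX => X.mem_circ_iff'.2 (le_antisymm (nonpos_of_mem_closure hz) hzX)
  meets := ⟨_, X.end_mem_closure (.inl rfl), X.end_mem_circ (.inl rfl)⟩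
  meets_old := by
    intro C' hC'
    obtain ⟨z, hz, hzC⟩ := R.meets C' hC'
    by_cases hzX : z ∈ cut S e C σ τ a₁ a₂
    · obtain ⟨-, rfl⟩ := X.corner hz hzX hC' hzC
      exact ⟨_, X.end_mem_closure (.inl rfl), X.end_mem_old (.inl rfl)⟩
    · have := isClosed_cut.isOpen_compl.inter_closure (t := R.domain) ⟨hzX, hz⟩
      rw [inter_comm, ← sdiff_eq] at this
      exact ⟨z, this, hzC⟩
  transverse := by
    intro C' hC' z hz hzS hzC
    obtain ⟨h0, h1, rfl⟩ := X.end_of_mem hz hzS hC' hzC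
    have hne := X.lens.lt.ne
    rcases h0 with h | h
    · rw [h] at h1
      rw [h1]
      refine isCompl_tangentLine_of_ne X.circ_pos X.lens.radius_pos X.lens.ne_lens.symm
        (q := pt a₂ (S.hi e a₂)) ?_ (X.end_mem_circ (.inl rfl)) (X.end_mem_old (.inl rfl))
        (X.end_mem_circ (.inr rfl)) (X.end_mem_old (.inr rfl))
      intro hp
      exact hne (by simpa using congrArg (fun z : Plane => z 0) hp)
    · rw [h] at h1
      rw [h1]
      refine isCompl_tangentLine_of_ne X.circ_pos X.lens.radius_pos X.lens.ne_lens.symm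
        (q := pt a₁ (S.hi e a₁)) ?_ (X.end_mem_circ (.inr rfl)) (X.end_mem_old (.inr rfl))
        (X.end_mem_circ (.inl rfl)) (X.end_mem_old (.inl rfl))
      intro hp
      exact hne.symm (by simpa using congrArg (fun z : Plane => z 0) hp)
  unique := by
    intro C' hC' C'' hC'' z hz hzS h h'
    rw [(X.end_of_mem hz hzS hC' h).2.2, (X.end_of_mem hz hzS hC'' h').2.2]

/-- The decomposition of the new region into strips. -/
theorem isModel : (S.pairData e a₁ a₂ (graph S e C σ τ a₁ a₂)).IsModel X.carving.region := by
  have ha₁ : S.x (T.src e) < a₁ := X.arc.left.trans X.left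
  have ha₂ : a₂ < S.x (T.tgt e) := X.right.trans X.arc.right
  have hlt := X.lens.lt
  have hK : ∀ z, z ∈ closure R.domain → z ∈ cut S e C σ τ a₁ a₂ → z ∈ S.strip e := by
    intro z hz hzX
    obtain ⟨h0, h1, h2⟩ := X.of_mem_cut hz hzX
    exact X.mem_strip h0 h1 h2
  have hlh : ∀ t ∈ Icc a₁ a₂, S.lo e t ≤ S.hi e t := fun t ht =>
    (X.lo_lt ht).le.trans (X.graph_le ht)
  have hseg₁ : pt a₁ (S.hi e a₁) ∈
      (S.pairData e a₁ a₂ (graph S e C σ τ a₁ a₂)).seg (some none) :=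
    ⟨pt_zero _ _, (hlh a₁ X.a₁_mem).trans_eq (pt_one _ _).symm, (pt_one _ _).le⟩
  have hseg₂ : pt a₂ (S.hi e a₂) ∈
      (S.pairData e a₁ a₂ (graph S e C σ τ a₁ a₂)).seg none :=
    ⟨pt_zero _ _, (hlh a₂ X.a₂_mem).trans_eq (pt_one _ _).symm, (pt_one _ _).le⟩
  have hends : ∀ t, (t = a₁ ∨ t = a₂) → X.carving.region.IsSingular 0 (pt t (S.hi e t)) :=
    fun t ht => X.carving.isSingular_of_mem (X.end_mem_closure ht) (X.end_mem_circ ht) X.arc.mem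
      (X.end_mem_old ht) X.lens.ne_lens 0
  refine ⟨?_, ?_, ?_, ?_, ?_, ?_⟩
  · have := X.model.covers.pairData ha₁ hlt ha₂ (h := graph S e C σ τ a₁ a₂)
      Lens.continuous_lensArc.continuousOn (fun t ht => X.lo_lt (Ioo_subset_Icc_self ht))
      (fun t ht => X.graph_le ht)
    rw [← X.closure_eq] at this
    exact this
  · intro f z hz
    rcases StripData.mem_pairData_ostrip ha₁ hlt ha₂ hz with h | ⟨g, hg, hge⟩
    · exact X.low_subset h
    · refine ⟨X.model.inner g hg, fun hzX => ?_⟩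
      have hzK := subset_closure (X.model.inner g hg)
      have hst := hK z hzK hzX
      have h0 := (X.of_mem_cut hzK hzX).1
      obtain rfl := X.model.covers.strip_disj g e z ⟨hg.1, hg.2.1.le, hg.2.2.le⟩ hst
      rcases hge rfl with h | h
      exacts [h.not_ge h0.1, h.not_ge h0.2]
  · refine StripData.pairData_dec X.model.dec ⟨α, a₁, X.arc.left.le, X.left, le_rfl, ?_⟩
      ⟨a₁, a₂, le_rfl, hlt, le_rfl, X.lens.arc_anti⟩ ⟨a₂, β, le_rfl, X.right, X.arc.right.le, ?_⟩
    · exact X.arc.anti.mono (Icc_subset_Icc_right (hlt.trans X.right).le)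
    · exact X.arc.anti.mono (Icc_subset_Icc_left (X.left.trans hlt).le)
  · rintro (_ | _ | v)
    · exact ⟨_, hseg₂, hends _ (.inr rfl)⟩
    · exact ⟨_, hseg₁, hends _ (.inl rfl)⟩
    · obtain ⟨z, hz, hs⟩ := X.model.seg_sing v
      refine ⟨z, hz, (X.carving.isSingular_iff (fun hzX => ?_) 0).2 hs⟩
      exact X.model.covers.seg_strip v e z hz (hK z hs.1.1 hzX)
  · intro z hz
    by_cases hzX : z ∈ cut S e C σ τ a₁ a₂
    · have hzcl : z ∈ closure (R.domain \ cut S e C σ τ a₁ a₂) := hz.1.1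
      have hzS := X.carving.touch z hzcl hzX
      have hzK : z ∈ closure R.domain := Carving.closure_subset hzcl
      obtain ⟨h0, h1, h2⟩ := X.of_mem_cut hzK hzX
      have hcorner : (z 0 = a₁ ∨ z 0 = a₂) → z 1 = S.hi e (z 0) := by
        intro h
        refine le_antisymm h2 ?_
        rcases h with h | h
        · rw [h, X.graph₁] at h1
          rw [h]
          exact h1
        · rw [h, X.graph₂] at h1
          rw [h]
          exact h1
      have hdone : (z 0 = a₁ ∨ z 0 = a₂) → ∃ v,
          z ∈ (S.pairData e a₁ a₂ (graph S e C σ τ a₁ a₂)).seg v := by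
        intro h
        have hz1 := hcorner h
        have hz' : z = pt (z 0) (S.hi e (z 0)) := by rw [← hz1, pt_eta]
        rcases h with h | h
        · rw [h] at hz'
          exact ⟨some none, hz' ▸ hseg₁⟩
        · rw [h] at hz'
          exact ⟨none, hz' ▸ hseg₂⟩
      rcases X.carving.of_isSingular hz hzS with ⟨C', hC', hzC⟩ | hv
      · exact hdone (X.end_of_mem hzcl hzS hC' hzC).1
      -- The new arc stays strictly on one side of the height of its centre, so it has no vertical
      -- tangent and the corners are the only new singular points.
      · have hy := X.lens.pos_y (t := z 1) ⟨(X.lens.arc_mem h0).1.trans h1,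
          h2.trans (X.hi_mem h0).2⟩
        simp only [sub_zero] at hv
        refine absurd hy ?_
        change ¬ 0 < σ * (z 1 - (circ S e C τ a₁ a₂).center 1)
        rw [hv, sub_self, mul_zero]
        exact lt_irrefl _
    · obtain ⟨v, hv⟩ := X.model.sing_seg z ((X.carving.isSingular_iff hzX 0).1 hz)
      exact ⟨some (some v), hv⟩
  · rintro C' (rfl | hC')
    · rcases X.lens.sign with h | h
      · left
        rintro z ⟨-, hz⟩
        rw [mem_openDisk_iff X.circ_pos]
        have : σ * pw (circ S e C τ a₁ a₂) z < 0 := not_le.1 fun h => hz h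
        rwa [h, one_mul] at this
      · right
        rw [disjoint_left]
        rintro z ⟨-, hz⟩ hz'
        rw [mem_closedDisk_iff X.circ_pos] at hz'
        have : σ * pw (circ S e C τ a₁ a₂) z < 0 := not_le.1 fun h => hz h
        rw [h] at this
        linarith
    · rcases X.model.side C' hC' with h | h
      exacts [.inl (sdiff_subset.trans h), .inr (h.mono_left sdiff_subset)]

/-- An inner point of the new arc lies in the old region, which meets none of the old circles. -/
theorem circ_notMem : circ S e C τ a₁ a₂ ∉ R.circles := by
  intro hmem
  have hm : (a₁ + a₂) / 2 ∈ Ioo a₁ a₂ := ⟨by linarith [X.lens.lt], by linarith [X.lens.lt]⟩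
  set t := (a₁ + a₂) / 2
  have ht := Ioo_subset_Icc_self hm
  refine X.model.notMem_circ (z := pt t (graph S e C σ τ a₁ a₂ t)) ?_ hmem
    ((mem_circ_iff X.circ_pos).2 (X.lens.pw_arc ht))
  refine X.model.inner e ⟨?_, ?_, ?_⟩ <;> simp only [pt_zero, pt_one]
  exacts [X.arc.mem_Ioo (X.sub ht), X.lo_lt ht, X.graph_lt hm]

/-- The linear form of the pencil vanishes on the chord, so both powers agree there, and they are
nonpositive because a disk is convex. -/
theorem pw_chord {z : Plane} (hz : z ∈ segment ℝ (pt a₁ (S.hi e a₁)) (pt a₂ (S.hi e a₂))) :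
    pw (circ S e C τ a₁ a₂) z = pw C z ∧ pw C z ≤ 0 ∧ z 0 ∈ Icc a₁ a₂ ∧
      z 1 ∈ Icc (S.hi e a₂) (S.hi e a₁) := by
  obtain ⟨s, t, hs, ht, hst, rfl⟩ := hz
  have hlt := X.lens.lt
  have hgt := X.lens.gt
  have hpw := X.lens.pw_lens (s • pt a₁ (S.hi e a₁) + t • pt a₂ (S.hi e a₂))
  have e1 := X.lens.mem₁
  have e2 := X.lens.mem₂
  obtain rfl : s = 1 - t := by linarith
  simp only [pw, pt_zero, pt_one] at e1 e2
  refine ⟨hpw.trans ?_, ?_, ?_, ?_⟩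
  · simp only [PiLp.add_apply, PiLp.smul_apply, pt_zero, pt_one, smul_eq_mul]
    ring
  · simp only [pw, PiLp.add_apply, PiLp.smul_apply, pt_zero, pt_one, smul_eq_mul]
    have h1 : ((1 - t) * a₁ + t * a₂ - C.center 0) ^ 2 +
        ((1 - t) * S.hi e a₁ + t * S.hi e a₂ - C.center 1) ^ 2 - C.radius ^ 2 =
        -((1 - t) * t * ((a₂ - a₁) ^ 2 + (S.hi e a₁ - S.hi e a₂) ^ 2)) := by
      linear_combination (1 - t) * e1 + t * e2
    rw [h1]
    have := mul_nonneg (mul_nonneg hs ht) (add_nonneg (sq_nonneg (a₂ - a₁))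
      (sq_nonneg (S.hi e a₁ - S.hi e a₂)))
    linarith
  · simp only [PiLp.add_apply, PiLp.smul_apply, pt_zero, smul_eq_mul]
    constructor <;> nlinarith
  · simp only [PiLp.add_apply, PiLp.smul_apply, pt_one, smul_eq_mul]
    constructor <;> nlinarith

theorem pw_open_chord {z : Plane}
    (hz : z ∈ openSegment ℝ (pt a₁ (S.hi e a₁)) (pt a₂ (S.hi e a₂))) : pw C z < 0 := by
  obtain ⟨s, t, hs, ht, hst, rfl⟩ := hz
  have e1 := X.lens.mem₁
  have e2 := X.lens.mem₂
  obtain rfl : s = 1 - t := by linarith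
  simp only [pw, pt_zero, pt_one] at e1 e2
  simp only [pw, PiLp.add_apply, PiLp.smul_apply, pt_zero, pt_one, smul_eq_mul]
  have h1 : ((1 - t) * a₁ + t * a₂ - C.center 0) ^ 2 +
      ((1 - t) * S.hi e a₁ + t * S.hi e a₂ - C.center 1) ^ 2 - C.radius ^ 2 =
      -((1 - t) * t * ((a₂ - a₁) ^ 2 + (S.hi e a₁ - S.hi e a₂) ^ 2)) := by
    linear_combination (1 - t) * e1 + t * e2
  rw [h1]
  have := mul_pos (mul_pos hs ht) (add_pos_of_pos_of_nonneg (pow_pos (sub_pos.2 X.lens.lt) 2)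
    (sq_nonneg (S.hi e a₁ - S.hi e a₂)))
  linarith

/-- The addition is of type A-2 if the region lies inside `C` and of type B if it lies outside; type
A-1 is not needed. The image of the arc in each Reeb space is connected and avoids the vertices by
genericity, which puts both end points into one edge. -/
theorem sscc (ε : Smallness)
    (hlen : dist (pt a₁ (S.hi e a₁)) (pt a₂ (S.hi e a₂)) < ε.length R (pt a₁ (S.hi e a₁)))
    (harea : volume {z | σ * pw C z ≤ 0 ∧ 0 ≤ σ * pw (circ S e C τ a₁ a₂) z} <
      ENNReal.ofReal (ε.area R (pt a₁ (S.hi e a₁)) (pt a₂ (S.hi e a₂)))) :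
    SSCC ε R X.carving.region := by
  have hb : ∀ t ∈ Icc a₁ a₂, pt t (S.hi e t) ∈ R.boundary := fun t ht => X.arc.boundary t (X.sub ht)
  have hcont : ContinuousOn (fun t => pt t (S.hi e t)) (Icc a₁ a₂) :=
    continuousOn_pt continuousOn_id X.continuousOn.1
  have hZ : IsClosed {z | σ * pw C z ≤ 0 ∧ 0 ≤ σ * pw (circ S e C τ a₁ a₂) z} :=
    (isClosed_le (continuous_const.mul (continuous_pw C)) continuous_const).inter
      (isClosed_le continuous_const (continuous_const.mul (continuous_pw _)))
  refine ⟨⟨_, (hb a₁ X.a₁_mem).1⟩, ⟨_, (hb a₂ X.a₂_mem).1⟩, C, circ S e C τ a₁ a₂, ?_,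
    hb a₁ X.a₁_mem, hb a₂ X.a₂_mem, X.arc.onlyOn a₁ (X.sub X.a₁_mem),
    X.arc.onlyOn a₂ (X.sub X.a₂_mem), ?_, ?_, hlen, X.circ_pos, X.end_mem_circ (.inl rfl),
    X.end_mem_circ (.inr rfl), X.circ_notMem, rfl, ?_⟩
  · intro h
    exact X.lens.lt.ne (by simpa using congrArg (fun z : Plane => z 0) h)
  · refine ⟨(fun t => pt t (S.hi e t)) '' Icc a₁ a₂, (isConnected_Icc X.lens.lt.le).image _ hcont,
      ?_, ⟨a₁, X.a₁_mem, rfl⟩, ⟨a₂, X.a₂_mem, rfl⟩⟩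
    rintro _ ⟨t, ht, rfl⟩
    exact ⟨(hb t ht).1, (X.arc.onlyOn t (X.sub ht)).2.1⟩
  · intro i
    let f : Icc a₁ a₂ → closure R.domain := fun t => ⟨pt t (S.hi e t), (hb t t.2).1⟩
    have hf : Continuous f := Continuous.subtype_mk (continuousOn_iff_continuous_domRestrict.1 hcont) _
    have : PreconnectedSpace (Icc a₁ a₂) :=
      isPreconnected_iff_preconnectedSpace.1 isPreconnected_Icc
    refine ⟨range fun t => R.toReeb i (f t), isPreconnected_range
      ((R.continuous_toReeb i).comp hf), ?_, ⟨⟨a₁, X.a₁_mem⟩, rfl⟩, ⟨⟨a₂, X.a₂_mem⟩, rfl⟩⟩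
    rw [disjoint_left]
    rintro _ ⟨t, rfl⟩
    exact X.arc.generic t (X.sub t.2) _ i
  · right
    rcases X.lens.sign with h | h
    · left
      refine ⟨?_, ?_, ?_, ?_⟩
      · intro z hz
        obtain ⟨-, h1, h0, h2⟩ := X.pw_chord hz
        refine X.model.covers.strip_subset e ⟨X.arc.mem_Ioo (X.sub h0),
          ((X.low _ h0).trans_le h2.1).le, ?_⟩
        have h3 := pw_pt_eq (X.pw_hi h0) σ (z 1)
        rw [pt_eta] at h3
        have h4 := add_pos (X.lens.pos_y' h2) (X.lens.pos_y' (X.hi_mem h0))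
        have h5 : σ * pw C z ≤ 0 := by rw [h, one_mul]; exact h1
        rw [h3] at h5
        exact sub_nonpos.1 (nonpos_of_mul_nonpos_left h5 h4)
      · rw [disjoint_left]
        rintro z hz ⟨-, hzn⟩
        obtain ⟨h1, h2, -⟩ := X.pw_chord hz
        exact hzn ((mem_closedDisk_iff X.circ_pos).2 (h1.trans_le h2))
      · refine (measure_mono (closure_minimal ?_ hZ)).trans_lt harea
        rintro z ⟨h1, h2⟩
        rw [mem_openDisk_iff X.lens.radius_pos] at h1
        rw [mem_closedDisk_iff X.circ_pos, not_le] at h2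
        constructor <;> rw [h, one_mul]
        exacts [h1.le, h2.le]
      · ext z
        change z ∈ R.domain \ cut S e C σ τ a₁ a₂ ↔ _
        refine and_congr_right fun _ => ?_
        rw [mem_openDisk_iff X.circ_pos, cut, mem_ofPred_eq, h, one_mul, not_le]
    · right
      refine ⟨?_, ?_, ?_⟩
      · rw [disjoint_left]
        intro z hz hK
        have h1 := X.pw_open_chord hz
        have h2 := X.arc.pw_le hK
        rw [h] at h2
        linarith
      · refine (measure_mono (closure_minimal ?_ hZ)).trans_lt harea
        rintro z ⟨h1, h2⟩
        rw [mem_openDisk_iff X.circ_pos] at h1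
        rw [mem_closedDisk_iff X.lens.radius_pos, not_le] at h2
        constructor <;> rw [h] <;> linarith
      · ext z
        change z ∈ R.domain \ cut S e C σ τ a₁ a₂ ↔ _
        refine and_congr_right fun _ => not_congr ?_
        rw [mem_closedDisk_iff X.circ_pos, cut, mem_ofPred_eq, h, neg_one_mul, neg_nonneg]

end LensCut

/-- Two vertices can be added in an edge by cutting off a thin piece. -/
theorem StripData.IsModel.exists_sscc {T : FGraph} {S : StripData T} {R : SSRegion}
    (hS : S.IsModel R) (ε : Smallness) (e : T.E) :
    ∃ (R' : SSRegion) (S' : StripData (T.splitPair e)), SSCC ε R R' ∧ S'.IsModel R' := by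
  obtain ⟨C, σ, α, β, A⟩ := hS.exists_arc e
  have hαβ := A.lt
  -- The bound on the length depends on the first end point, so `a₁` is fixed before `a₂`; the bound
  -- on the area depends on both, so `τ` is chosen last.
  set a₁ := (α + β) / 2 with ha₁
  obtain ⟨η, hη, hnear⟩ := A.exists_near hS (a := a₁) ⟨by linarith, by linarith⟩
    (ε.length_pos R (pt a₁ (S.hi e a₁)))
  set a₂ := a₁ + η with ha₂
  have hm₁ : a₁ ∈ Icc (a₁ - η) (a₁ + η) := ⟨by linarith, by linarith⟩
  have hm₂ : a₂ ∈ Icc (a₁ - η) (a₁ + η) := ⟨by linarith, le_rfl⟩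
  obtain ⟨hin₁, -, -⟩ := hnear a₁ hm₁
  obtain ⟨hin₂, hd, hlow⟩ := hnear a₂ hm₂
  have h₁ := Ioo_subset_Icc_self hin₁
  have h₂ := Ioo_subset_Icc_self hin₂
  have hlt : a₁ < a₂ := by linarith
  have hgt : S.hi e a₂ < S.hi e a₁ := A.anti h₁ h₂ hlt
  have hr := R.radius_pos C A.mem
  set M := min (min (σ * (a₁ - C.center 0)) (σ * (a₂ - C.center 0)))
    (min (σ * (S.hi e a₁ - C.center 1)) (σ * (S.hi e a₂ - C.center 1))) with hM
  have hMpos : 0 < M := lt_min (lt_min (A.pos_x _ h₁) (A.pos_x _ h₂))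
    (lt_min (A.pos_y _ h₁) (A.pos_y _ h₂))
  have hM₁ : M ≤ σ * (a₁ - C.center 0) := (min_le_left _ _).trans (min_le_left _ _)
  have hM₂ : M ≤ σ * (a₂ - C.center 0) := (min_le_left _ _).trans (min_le_right _ _)
  have hM₃ : M ≤ σ * (S.hi e a₁ - C.center 1) := (min_le_right _ _).trans (min_le_left _ _)
  have hM₄ : M ≤ σ * (S.hi e a₂ - C.center 1) := (min_le_right _ _).trans (min_le_right _ _)
  have hN : 0 < (S.hi e a₁ - S.hi e a₂) + (a₂ - a₁) := by linarith
  -- With this `τ` the two shifts of the centre add up to `M / 2`, so each stays below the distance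
  -- `M` of both end points from the axes of `C`.
  have hτ : 0 < M / ((S.hi e a₁ - S.hi e a₂) + (a₂ - a₁)) := div_pos hMpos hN
  set τ := M / ((S.hi e a₁ - S.hi e a₂) + (a₂ - a₁)) with hτ'
  have hτM : τ * (S.hi e a₁ - S.hi e a₂) + τ * (a₂ - a₁) = M := by
    rw [← mul_add]
    exact div_mul_cancel₀ _ hN.ne'
  have hp₁ : 0 < τ * (S.hi e a₁ - S.hi e a₂) := mul_pos hτ (sub_pos.2 hgt)
  have hp₂ : 0 < τ * (a₂ - a₁) := mul_pos hτ (sub_pos.2 hlt)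
  have L : Lens C σ τ a₁ a₂ (S.hi e a₁) (S.hi e a₂) :=
    ⟨hlt, hgt, hr, (mem_circ_iff hr).1 (A.onlyOn _ h₁).2.1, (mem_circ_iff hr).1 (A.onlyOn _ h₂).2.1,
      A.sign, hτ, by linarith, by linarith, by linarith, by linarith⟩
  obtain ⟨τ', L', harea⟩ := L.exists_area_lt (ENNReal.ofReal_pos.2
    (ε.area_pos R (pt a₁ (S.hi e a₁)) (pt a₂ (S.hi e a₂))))
  have X : LensCut S R e C σ τ' α β a₁ a₂ :=
    ⟨hS, A, L', hin₁.1, hin₂.2, fun t ht =>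
      (hlow t ⟨by linarith [ht.1], ht.2⟩).trans (sub_lt_self _ hη)⟩
  exact ⟨_, _, X.sscc ε hd harea, X.isModel⟩


end SSRegions
end

noncomputable section
namespace SSRegions

open Set

/-! ### Half circles as graphs -/

/-- The upper half of the circle of radius `ρ` over the interval with centre `a`. -/
def arch (a ρ t : ℝ) : ℝ := √(ρ ^ 2 - (t - a) ^ 2)

theorem continuous_arch (a ρ : ℝ) : Continuous (arch a ρ) := by
  unfold arch
  fun_prop

theorem arch_nonneg (a ρ t : ℝ) : 0 ≤ arch a ρ t := Real.sqrt_nonneg _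

section

variable {a ρ : ℝ} (hρ : 0 < ρ)
include hρ

theorem arch_le (t : ℝ) : arch a ρ t ≤ ρ :=
  Real.sqrt_le_iff.2 ⟨hρ.le, by linarith [sq_nonneg (t - a)]⟩

omit hρ in
theorem arch_sq {t : ℝ} (ht : t ∈ Icc (a - ρ) (a + ρ)) : arch a ρ t ^ 2 = ρ ^ 2 - (t - a) ^ 2 := by
  refine Real.sq_sqrt ?_
  nlinarith [ht.1, ht.2]

omit hρ in
-- The square root of a negative number is 0 by convention, so the graphs of both half circles
-- continue to the left as the horizontal line through the centre. This lets the strips below and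
-- above the disk be extended to its left and overlap the untouched part there.
theorem arch_eq_zero {t : ℝ} (ht : t ≤ a - ρ) (hρ : 0 < ρ) : arch a ρ t = 0 := by
  refine Real.sqrt_eq_zero_of_nonpos ?_
  nlinarith

theorem arch_self : arch a ρ a = ρ := by
  rw [arch, sub_self, zero_pow two_ne_zero, sub_zero, Real.sqrt_sq hρ.le]

omit hρ in
theorem arch_right : arch a ρ (a + ρ) = 0 := by
  refine Real.sqrt_eq_zero_of_nonpos ?_
  nlinarith

omit hρ in
theorem arch_pos {t : ℝ} (ht : t ∈ Ioo (a - ρ) (a + ρ)) : 0 < arch a ρ t := by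
  refine Real.sqrt_pos.2 ?_
  nlinarith [ht.1, ht.2]

theorem strictMonoOn_arch : StrictMonoOn (arch a ρ) (Icc (a - ρ) a) := by
  intro s hs t ht hst
  refine Real.sqrt_lt_sqrt ?_ ?_
  · nlinarith [hs.1, hs.2]
  · nlinarith [ht.2]

theorem strictAntiOn_arch : StrictAntiOn (arch a ρ) (Icc a (a + ρ)) := by
  intro s hs t ht hst
  refine Real.sqrt_lt_sqrt ?_ ?_
  · nlinarith [ht.1, ht.2]
  · nlinarith [hs.1]

/-- A strictly decreasing graph through the centre of a circle meets the circle in two points. -/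
theorem exists_corners {f : ℝ → ℝ} (hf : ContinuousOn f (Icc (a - ρ) (a + ρ)))
    (hanti : StrictAntiOn f (Icc (a - ρ) (a + ρ))) :
    ∃ x₁ ∈ Ioo (a - ρ) a, ∃ x₂ ∈ Ioo a (a + ρ),
      f x₁ = f a + arch a ρ x₁ ∧ f x₂ = f a - arch a ρ x₂ ∧
      (∀ t ∈ Ico (a - ρ) x₁, f a + arch a ρ t < f t) ∧
      (∀ t ∈ Ioc x₁ (a + ρ), f t < f a + arch a ρ t) ∧
      (∀ t ∈ Ico (a - ρ) x₂, f a - arch a ρ t < f t) ∧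
      (∀ t ∈ Ioc x₂ (a + ρ), f t < f a - arch a ρ t) := by
  have hl : a - ρ ∈ Icc (a - ρ) (a + ρ) := ⟨le_rfl, by linarith⟩
  have hm : a ∈ Icc (a - ρ) (a + ρ) := ⟨by linarith, by linarith⟩
  have hr : a + ρ ∈ Icc (a - ρ) (a + ρ) := ⟨by linarith, le_rfl⟩
  have hlm : Icc (a - ρ) a ⊆ Icc (a - ρ) (a + ρ) := Icc_subset_Icc_right (by linarith)
  have hmr : Icc a (a + ρ) ⊆ Icc (a - ρ) (a + ρ) := Icc_subset_Icc_left (by linarith)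
  have hc := (continuous_arch a ρ)
  -- On the left half `f - arch` falls strictly, on the right half `f + arch` does; the intermediate
  -- value theorem gives one crossing each. On the opposite halves the comparison with `f a`
  -- suffices.
  have hG : StrictAntiOn (fun t => f t - arch a ρ t) (Icc (a - ρ) a) := fun s hs t ht hst => by
    have h1 := hanti (hlm hs) (hlm ht) hst
    have h2 := strictMonoOn_arch hρ hs ht hst
    simp only
    linarith
  have hH : StrictAntiOn (fun t => f t + arch a ρ t) (Icc a (a + ρ)) := fun s hs t ht hst => by
    have h1 := hanti (hmr hs) (hmr ht) hst
    have h2 := strictAntiOn_arch hρ hs ht hst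
    simp only
    linarith
  have f1 := hanti hl hm (by linarith)
  have f2 := hanti hm hr (by linarith)
  have z1 := arch_eq_zero (a := a) le_rfl hρ
  have z2 := arch_right (a := a) (ρ := ρ)
  have z3 := arch_self (a := a) hρ
  obtain ⟨x₁, hx₁, e₁⟩ := intermediate_value_Ioo' (by linarith : a - ρ ≤ a)
    ((hf.mono hlm).sub hc.continuousOn)
    (show f a ∈ Ioo (f a - arch a ρ a) (f (a - ρ) - arch a ρ (a - ρ)) from
      ⟨by linarith, by linarith⟩)
  obtain ⟨x₂, hx₂, e₂⟩ := intermediate_value_Ioo' (by linarith : a ≤ a + ρ)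
    ((hf.mono hmr).add hc.continuousOn)
    (show f a ∈ Ioo (f (a + ρ) + arch a ρ (a + ρ)) (f a + arch a ρ a) from
      ⟨by linarith, by linarith⟩)
  rw [Pi.sub_apply] at e₁
  rw [Pi.add_apply] at e₂
  refine ⟨x₁, hx₁, x₂, hx₂, by linarith, by linarith, ?_, ?_, ?_, ?_⟩
  · intro t ht
    have := hG ⟨ht.1, (ht.2.trans hx₁.2).le⟩ (Ioo_subset_Icc_self hx₁) ht.2
    simp only at this
    linarith
  · intro t ht
    rcases le_or_gt t a with h | h
    · have := hG (Ioo_subset_Icc_self hx₁) ⟨hx₁.1.le.trans ht.1.le, h⟩ ht.1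
      simp only at this
      linarith
    · have := hanti hm ⟨hx₁.1.le.trans ht.1.le, ht.2⟩ h
      linarith [arch_nonneg a ρ t]
  · intro t ht
    rcases lt_trichotomy t a with h | h | h
    · have := hanti ⟨ht.1, by linarith⟩ hm h
      linarith [arch_nonneg a ρ t]
    · rw [h]
      linarith
    · have := hH ⟨h.le, (ht.2.trans hx₂.2).le⟩ (Ioo_subset_Icc_self hx₂) ht.2
      simp only at this
      linarith
  · intro t ht
    have := hH (Ioo_subset_Icc_self hx₂) ⟨hx₂.1.le.trans ht.1.le, ht.2⟩ ht.1
    simp only at this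
    linarith

end

/-! ### Cutting off a disk centred at a boundary point -/

/-- The situation in which a disk centred at a point of a generic arc is removed. -/
structure DiskCut {T : FGraph} (S : StripData T) (R : SSRegion) (e : T.E) (C : Circ)
    (σ α β a ρ x₁ x₂ : ℝ) : Prop where
  model : S.IsModel R
  arc : Arc S R e C σ α β
  rho_pos : 0 < ρ
  left : α < a - ρ
  right : a + ρ < β
  low : ∀ t ∈ Icc α β, S.lo e t < S.hi e a - ρ
  near : ∀ z ∈ closure R.domain, dist z (pt a (S.hi e a)) ≤ ρ → z ∈ S.strip e
  x₁_mem : x₁ ∈ Ioo (a - ρ) a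
  x₂_mem : x₂ ∈ Ioo a (a + ρ)
  eq₁ : S.hi e x₁ = S.hi e a + arch a ρ x₁
  eq₂ : S.hi e x₂ = S.hi e a - arch a ρ x₂
  gt₁ : ∀ t ∈ Ico (a - ρ) x₁, S.hi e a + arch a ρ t < S.hi e t
  lt₁ : ∀ t ∈ Ioc x₁ (a + ρ), S.hi e t < S.hi e a + arch a ρ t
  gt₂ : ∀ t ∈ Ico (a - ρ) x₂, S.hi e a - arch a ρ t < S.hi e t
  lt₂ : ∀ t ∈ Ioc x₂ (a + ρ), S.hi e t < S.hi e a - arch a ρ t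

namespace DiskCut

variable {T : FGraph} {S : StripData T} {R : SSRegion} {e : T.E} {C : Circ}
  {σ α β a ρ x₁ x₂ : ℝ}

variable (S e a ρ) in
/-- The new circle. -/
def circ : Circ := ⟨pt a (S.hi e a), ρ⟩

variable (S e a ρ) in
/-- The lower half of the new circle as a graph. -/
def lower (t : ℝ) : ℝ := S.hi e a - arch a ρ t

variable (S e a ρ) in
/-- The upper half of the new circle as a graph. -/
def upper (t : ℝ) : ℝ := S.hi e a + arch a ρ t

theorem continuous_lower : Continuous (lower S e a ρ) := continuous_const.sub (continuous_arch a ρ)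

theorem continuous_upper : Continuous (upper S e a ρ) := continuous_const.add (continuous_arch a ρ)

variable (X : DiskCut S R e C σ α β a ρ x₁ x₂)
include X

theorem a_mem : a ∈ Icc α β :=
  ⟨by linarith [X.left, X.rho_pos], by linarith [X.right, X.rho_pos]⟩

omit X in
theorem pw_circ (z : Plane) :
    pw (circ S e a ρ) z = (z 0 - a) ^ 2 + (z 1 - S.hi e a) ^ 2 - ρ ^ 2 := by
  simp [pw, circ]

theorem level_of_mem {z : Plane} (hz : z ∈ closedDisk (circ S e a ρ)) :
    z 0 ∈ Icc (a - ρ) (a + ρ) := by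
  rw [mem_closedDisk_iff X.rho_pos, pw_circ] at hz
  have h := abs_le_of_sq_le_sq' (by nlinarith [sq_nonneg (z 1 - S.hi e a)] :
    (z 0 - a) ^ 2 ≤ ρ ^ 2) X.rho_pos.le
  exact ⟨by linarith [h.1], by linarith [h.2]⟩

theorem mem_disk_iff {z : Plane} (h0 : z 0 ∈ Icc (a - ρ) (a + ρ)) :
    z ∈ closedDisk (circ S e a ρ) ↔ lower S e a ρ (z 0) ≤ z 1 ∧ z 1 ≤ upper S e a ρ (z 0) := by
  have hs := arch_sq h0
  have hn := arch_nonneg a ρ (z 0)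
  rw [mem_closedDisk_iff X.rho_pos, pw_circ, lower, upper]
  constructor
  · intro h
    have h' := abs_le_of_sq_le_sq' (by linarith : (z 1 - S.hi e a) ^ 2 ≤ arch a ρ (z 0) ^ 2) hn
    exact ⟨by linarith [h'.1], by linarith [h'.2]⟩
  · rintro ⟨h1, h2⟩
    nlinarith

omit X in
theorem pw_neg_iff {z : Plane} (h0 : z 0 ∈ Icc (a - ρ) (a + ρ)) :
    pw (circ S e a ρ) z < 0 ↔ lower S e a ρ (z 0) < z 1 ∧ z 1 < upper S e a ρ (z 0) := by
  have hs := arch_sq h0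
  have hn := arch_nonneg a ρ (z 0)
  rw [pw_circ, lower, upper]
  constructor
  · intro h
    have h' := abs_lt_of_sq_lt_sq' (by linarith : (z 1 - S.hi e a) ^ 2 < arch a ρ (z 0) ^ 2) hn
    exact ⟨by linarith [h'.1], by linarith [h'.2]⟩
  · rintro ⟨h1, h2⟩
    nlinarith

theorem x₁_lt_x₂ : x₁ < x₂ := X.x₁_mem.2.trans X.x₂_mem.1

theorem sub {t : ℝ} (ht : t ∈ Icc (a - ρ) (a + ρ)) : t ∈ Icc α β :=
  ⟨X.left.le.trans ht.1, ht.2.trans X.right.le⟩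

theorem sub₂ {t : ℝ} (ht : t ∈ Icc α x₂) : t ∈ Icc α β :=
  ⟨ht.1, (ht.2.trans X.x₂_mem.2.le).trans X.right.le⟩

theorem arc_level {t : ℝ} (ht : t ∈ Icc (a - ρ) x₂) : t ∈ Icc (a - ρ) (a + ρ) :=
  ⟨ht.1, ht.2.trans X.x₂_mem.2.le⟩

theorem lo_lt_lower {t : ℝ} (ht : t ∈ Icc α β) : S.lo e t < lower S e a ρ t := by
  have := arch_le (a := a) X.rho_pos t
  have := X.low t ht
  rw [lower]
  linarith

omit X in
theorem lower_le_upper (t : ℝ) : lower S e a ρ t ≤ upper S e a ρ t := by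
  have := arch_nonneg a ρ t
  rw [lower, upper]
  linarith

theorem lower_lt_hi {t : ℝ} (ht : t ∈ Ico α x₂) : lower S e a ρ t < S.hi e t := by
  rcases le_or_gt (a - ρ) t with h | h
  · exact X.gt₂ t ⟨h, ht.2⟩
  · rw [lower, arch_eq_zero h.le X.rho_pos, sub_zero]
    exact X.arc.anti ⟨ht.1, (X.sub₂ ⟨ht.1, ht.2.le⟩).2⟩ X.a_mem (by linarith [X.rho_pos])

theorem upper_lt_hi {t : ℝ} (ht : t ∈ Ico α x₁) : upper S e a ρ t < S.hi e t := by
  rcases le_or_gt (a - ρ) t with h | h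
  · exact X.gt₁ t ⟨h, ht.2⟩
  · rw [upper, arch_eq_zero h.le X.rho_pos, add_zero]
    exact X.arc.anti ⟨ht.1, (X.sub₂ ⟨ht.1, (ht.2.trans X.x₁_lt_x₂).le⟩).2⟩ X.a_mem
      (by linarith [X.rho_pos])

theorem mem_strip {z : Plane} (hK : z ∈ closure R.domain) (hz : z ∈ closedDisk (circ S e a ρ)) :
    z ∈ S.strip e := X.near z hK hz

/-- The removed points lie above the lower half of the circle, and below the arc. -/
theorem of_mem {z : Plane} (hK : z ∈ closure R.domain) (hz : z ∈ closedDisk (circ S e a ρ)) :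
    z 0 ∈ Icc (a - ρ) x₂ ∧ lower S e a ρ (z 0) ≤ z 1 ∧ z 1 ≤ upper S e a ρ (z 0) ∧
      z 1 ≤ S.hi e (z 0) ∧ S.lo e (z 0) < z 1 := by
  have h0 := X.level_of_mem hz
  obtain ⟨h1, h2⟩ := (X.mem_disk_iff h0).1 hz
  have h3 := (X.mem_strip hK hz).2.2
  refine ⟨⟨h0.1, ?_⟩, h1, h2, h3, (X.lo_lt_lower (X.sub h0)).trans_le h1⟩
  by_contra! h
  exact (h1.trans h3).not_gt (X.lt₂ _ ⟨h, h0.2⟩)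

theorem low_subset : obetween α x₂ (S.lo e) (lower S e a ρ) ⊆
    R.domain \ closedDisk (circ S e a ρ) := by
  rintro z ⟨h0, h1, h2⟩
  refine ⟨X.model.inner e ⟨X.arc.mem_Ioo (X.sub₂ (Ioo_subset_Icc_self h0)), h1,
    h2.trans (X.lower_lt_hi (Ioo_subset_Ico_self h0))⟩, fun hz => ?_⟩
  exact h2.not_ge ((X.mem_disk_iff (X.level_of_mem hz)).1 hz).1

theorem up_subset : obetween α x₁ (upper S e a ρ) (S.hi e) ⊆
    R.domain \ closedDisk (circ S e a ρ) := by
  rintro z ⟨h0, h1, h2⟩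
  have h0' := X.sub₂ ⟨h0.1.le, (h0.2.trans X.x₁_lt_x₂).le⟩
  refine ⟨X.model.inner e ⟨X.arc.mem_Ioo h0', ((X.lo_lt_lower h0').trans_le
    (lower_le_upper _)).trans h1, h2⟩, fun hz => ?_⟩
  exact h1.not_ge ((X.mem_disk_iff (X.level_of_mem hz)).1 hz).2

omit X in
theorem isClosed_disk : IsClosed (closedDisk (circ S e a ρ)) := Metric.isClosed_closedBall

theorem nonneg_of_mem_closure {z : Plane}
    (hz : z ∈ closure (R.domain \ closedDisk (circ S e a ρ))) : 0 ≤ pw (circ S e a ρ) z := by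
  have : closure (R.domain \ closedDisk (circ S e a ρ)) ⊆ {z | 0 ≤ pw (circ S e a ρ) z} :=
    closure_minimal (fun z hz => (not_le.1 fun h => hz.2 ((mem_closedDisk_iff X.rho_pos).2 h) :
      0 < pw (circ S e a ρ) z).le) (isClosed_le continuous_const (continuous_pw _))
  exact this hz

theorem continuousOn : ContinuousOn (S.hi e) (Icc α β) ∧ ContinuousOn (S.lo e) (Icc α β) :=
  X.arc.continuousOn X.model

/-- The form matches the two operations on strips: everything above the lower half circle between
the leftmost point and the lower corner is deleted, and the part between the upper half circle and
the old arc is given back as a new strip. -/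
theorem closure_eq : closure (R.domain \ closedDisk (circ S e a ρ)) = (closure R.domain \
    {z | z ∈ S.strip e ∧ z 0 ∈ Ioo (a - ρ) x₂ ∧ lower S e a ρ (z 0) < z 1}) ∪
    {z | z 0 ∈ Ioc (a - ρ) x₁ ∧ upper S e a ρ (z 0) ≤ z 1 ∧ z 1 ≤ S.hi e (z 0)} := by
  obtain ⟨hhi, hlo⟩ := X.continuousOn
  ext z
  constructor
  · intro hz
    have hK := closure_mono sdiff_subset hz
    by_cases hr : z ∈ S.strip e ∧ z 0 ∈ Ioo (a - ρ) x₂ ∧ lower S e a ρ (z 0) < z 1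
    · right
      obtain ⟨hst, h0, h1⟩ := hr
      have h0' := X.arc_level (Ioo_subset_Icc_self h0)
      have h2 : upper S e a ρ (z 0) ≤ z 1 := by
        by_contra! h2
        exact (X.nonneg_of_mem_closure hz).not_gt ((pw_neg_iff h0').2 ⟨h1, h2⟩)
      refine ⟨⟨h0.1, ?_⟩, h2, hst.2.2⟩
      by_contra! h3
      exact (h2.trans hst.2.2).not_gt (X.lt₁ _ ⟨h3, h0'.2⟩)
    · exact .inl ⟨hK, hr⟩
  · rintro (⟨hK, hn⟩ | ⟨h0, h1, h2⟩)
    · by_cases hz : z ∈ closedDisk (circ S e a ρ)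
      · obtain ⟨h0, h1, h2, h3, h4⟩ := X.of_mem hK hz
        have h5 : z 1 ≤ lower S e a ρ (z 0) := by
          rcases h0.1.eq_or_lt with h | h
          · rw [upper, arch_eq_zero h.ge X.rho_pos] at h2
            rw [lower, arch_eq_zero h.ge X.rho_pos]
            linarith
          · rcases h0.2.eq_or_lt with h' | h'
            · rw [h'] at h3 ⊢
              exact h3.trans X.eq₂.le
            · exact not_lt.1 fun hlt => hn ⟨X.mem_strip hK hz, ⟨h, h'⟩, hlt⟩
        have hsub : Icc α x₂ ⊆ Icc α β := fun t ht => X.sub₂ ht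
        refine closure_mono X.low_subset (cbetween_subset_closure ?_ (hlo.mono hsub)
          continuous_lower.continuousOn (fun t ht => X.lo_lt_lower
            (X.sub₂ (Ioo_subset_Icc_self ht))) ⟨⟨X.left.le.trans h0.1, h0.2⟩, h4.le, h5⟩)
        exact X.left.trans_le (h0.1.trans h0.2)
      · have := isClosed_disk.isOpen_compl.inter_closure (t := R.domain) ⟨hz, hK⟩
        rwa [inter_comm, ← sdiff_eq] at this
    · have hsub : Icc α x₁ ⊆ Icc α β := fun t ht => X.sub₂ ⟨ht.1, ht.2.trans X.x₁_lt_x₂.le⟩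
      exact closure_mono X.up_subset (cbetween_subset_closure (X.left.trans (h0.1.trans_le h0.2))
        continuous_upper.continuousOn (hhi.mono hsub)
        (fun t ht => X.upper_lt_hi (Ioo_subset_Ico_self ht)) ⟨⟨(X.left.trans h0.1).le, h0.2⟩, h1, h2⟩)

theorem corner {z : Plane} (hK : z ∈ closure R.domain) (hz : z ∈ closedDisk (circ S e a ρ))
    {C' : Circ} (hC' : C' ∈ R.circles) (hzC : z ∈ C') : z 1 = S.hi e (z 0) ∧ C' = C := by
  obtain ⟨h0, h1, h2, h3, h4⟩ := X.of_mem hK hz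
  exact X.model.eq_of_mem_circ X.arc (X.sub (X.arc_level h0)) h4 h3 hC' hzC

theorem end_level {t : ℝ} (ht : t = x₁ ∨ t = x₂) : t ∈ Icc (a - ρ) (a + ρ) := by
  have h₁ := X.x₁_mem
  have h₂ := X.x₂_mem
  have := X.rho_pos
  rcases ht with rfl | rfl
  exacts [⟨h₁.1.le, by linarith [h₁.2]⟩, ⟨by linarith [h₂.1], h₂.2.le⟩]

theorem end_mem_closure {t : ℝ} (ht : t = x₁ ∨ t = x₂) :
    pt t (S.hi e t) ∈ closure (R.domain \ closedDisk (circ S e a ρ)) := by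
  rw [X.closure_eq]
  have h := X.end_level ht
  rcases ht with rfl | rfl
  · right
    refine ⟨?_, ?_, ?_⟩ <;> simp only [pt_zero, pt_one]
    exacts [⟨X.x₁_mem.1, le_rfl⟩, X.eq₁.ge, le_rfl]
  · left
    refine ⟨(X.arc.boundary t (X.sub h)).1, ?_⟩
    rintro ⟨-, h, -⟩
    rw [pt_zero] at h
    exact h.2.false

theorem end_mem_circ {t : ℝ} (ht : t = x₁ ∨ t = x₂) : pt t (S.hi e t) ∈ circ S e a ρ := by
  have h := arch_sq (X.end_level ht)
  rw [mem_circ_iff X.rho_pos, pw_circ, pt_zero, pt_one]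
  rcases ht with rfl | rfl
  · rw [X.eq₁]
    linarith
  · rw [X.eq₂]
    linarith

theorem end_mem_old {t : ℝ} (ht : t = x₁ ∨ t = x₂) : pt t (S.hi e t) ∈ C :=
  (X.arc.onlyOn t (X.sub (X.end_level ht))).2.1

theorem ne_circ : C ≠ circ S e a ρ := by
  intro h
  have := (X.arc.onlyOn a X.a_mem).2.1
  rw [h, mem_circ_iff X.rho_pos, pw_circ, pt_zero, pt_one] at this
  have := X.rho_pos
  nlinarith

/-- Inside the open strip over `Ioo α x₂`, the complement of the disk is the union of the parts to
the left, below and above. The last two, continued by horizontal lines, overlap the first at the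
level `c` left of the disk, so the union is connected, and `isPreconnected_of_union` applies. -/
theorem isConnected : IsConnected (R.domain \ closedDisk (circ S e a ρ)) := by
  obtain ⟨hhi, hlo⟩ := X.continuousOn
  have hρ := X.rho_pos
  have hleft := X.left
  have hx₁ := X.x₁_mem
  have hlt := X.x₁_lt_x₂
  set c := (α + (a - ρ)) / 2 with hc
  have hcα : α < c := by linarith
  have hca : c < a - ρ := by linarith
  have hcβ : c ∈ Icc α β := X.sub₂ ⟨hcα.le, by linarith [hx₁.1]⟩
  have hz : arch a ρ c = 0 := arch_eq_zero hca.le hρ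
  have hclo := X.low c hcβ
  have hchi := X.lower_lt_hi (t := c) ⟨hcα.le, by linarith [hx₁.1]⟩
  rw [lower, hz, sub_zero] at hchi
  have hLz : pt c ((S.lo e c + S.hi e a) / 2) ∈ obetween α x₂ (S.lo e) (lower S e a ρ) := by
    refine ⟨?_, ?_, ?_⟩ <;> simp only [pt_zero, pt_one, lower, hz]
    exacts [⟨hcα, by linarith [hx₁.1]⟩, by linarith, by linarith]
  have hLB : pt c ((S.lo e c + S.hi e a) / 2) ∈ obetween α (a - ρ) (S.lo e) (S.hi e) := by
    refine ⟨?_, ?_, ?_⟩ <;> simp only [pt_zero, pt_one]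
    exacts [⟨hcα, hca⟩, by linarith, by linarith]
  have hUz : pt c ((S.hi e c + S.hi e a) / 2) ∈ obetween α x₁ (upper S e a ρ) (S.hi e) := by
    refine ⟨?_, ?_, ?_⟩ <;> simp only [pt_zero, pt_one, upper, hz]
    exacts [⟨hcα, by linarith [hx₁.1]⟩, by linarith, by linarith]
  have hUB : pt c ((S.hi e c + S.hi e a) / 2) ∈ obetween α (a - ρ) (S.lo e) (S.hi e) := by
    refine ⟨?_, ?_, ?_⟩ <;> simp only [pt_zero, pt_one]
    exacts [⟨hcα, hca⟩, by linarith, by linarith]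
  have hs₂ : Ioo α x₂ ⊆ Icc α β := fun t ht => X.sub₂ (Ioo_subset_Icc_self ht)
  have hs₁ : Ioo α x₁ ⊆ Icc α β := fun t ht => hs₂ ⟨ht.1, ht.2.trans hlt⟩
  have hs₀ : Ioo α (a - ρ) ⊆ Icc α β := fun t ht => hs₁ ⟨ht.1, ht.2.trans hx₁.1⟩
  refine ⟨⟨_, X.low_subset hLz⟩, ?_⟩
  refine isPreconnected_of_union (U := obetween α x₂ (S.lo e) (S.hi e))
    R.isConnected_domain.isPreconnected (R.isOpen_domain.sdiff isClosed_disk)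
    (isOpen_obetween (hlo.mono hs₂) (hhi.mono hs₂)) ?_ ?_
  · apply Subset.antisymm
    · intro z hz
      by_cases hzc : z ∈ closedDisk (circ S e a ρ)
      · obtain ⟨h0, h1, h2, h3, h4⟩ := X.of_mem (subset_closure hz) hzc
        have hlt : z 1 < S.hi e (z 0) := by
          refine lt_of_le_of_ne h3 fun h => ?_
          have := (X.arc.boundary (z 0) (X.sub (X.arc_level h0))).2
          rw [← h, pt_eta] at this
          exact this hz
        right
        refine ⟨⟨X.left.trans_le h0.1, lt_of_le_of_ne h0.2 fun h => ?_⟩, h4, hlt⟩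
        have := h1.trans_lt hlt
        rw [h, X.eq₂, lower] at this
        exact this.false
      · exact .inl ⟨hz, hzc⟩
    · rintro z (hz | hz)
      · exact hz.1
      · exact X.model.inner e ⟨X.arc.mem_Ioo (hs₂ hz.1), hz.2⟩
  · have : (R.domain \ closedDisk (circ S e a ρ)) ∩ obetween α x₂ (S.lo e) (S.hi e) =
        (obetween α (a - ρ) (S.lo e) (S.hi e) ∪ obetween α x₂ (S.lo e) (lower S e a ρ)) ∪
          obetween α x₁ (upper S e a ρ) (S.hi e) := by
      ext z
      constructor
      · rintro ⟨⟨hD, hz⟩, h0, h1, h2⟩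
        rcases lt_or_ge (z 0) (a - ρ) with h | h
        · exact .inl (.inl ⟨⟨h0.1, h⟩, h1, h2⟩)
        · have h0' := X.arc_level ⟨h, h0.2.le⟩
          rw [X.mem_disk_iff h0', not_and_or, not_le, not_le] at hz
          rcases hz with hz | hz
          · exact .inl (.inr ⟨h0, h1, hz⟩)
          · refine .inr ⟨⟨h0.1, ?_⟩, hz, h2⟩
            by_contra! h3
            rcases h3.eq_or_lt with h4 | h4
            · have h5 := hz.trans h2
              rw [← h4, X.eq₁, upper] at h5
              exact h5.false
            · exact (hz.trans h2).not_gt (X.lt₁ _ ⟨h4, h0'.2⟩)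
      · rintro ((hz | hz) | hz)
        · refine ⟨⟨X.model.inner e ⟨X.arc.mem_Ioo (hs₀ hz.1), hz.2⟩, fun h => ?_⟩,
            ⟨hz.1.1, (hz.1.2.trans hx₁.1).trans hlt⟩, hz.2⟩
          exact hz.1.2.not_ge (X.level_of_mem h).1
        · exact ⟨X.low_subset hz, hz.1, hz.2.1, hz.2.2.trans
            (X.lower_lt_hi (Ioo_subset_Ico_self hz.1))⟩
        · exact ⟨X.up_subset hz, ⟨hz.1.1, hz.1.2.trans hlt⟩, ((X.lo_lt_lower (hs₁ hz.1)).trans_le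
            (lower_le_upper _)).trans hz.2.1, hz.2.2⟩
    rw [this]
    refine IsPreconnected.union _ (.inl hUB) hUz (IsPreconnected.union _ hLB hLz ?_ ?_) ?_
    · exact isPreconnected_obetween (hlo.mono hs₀) (hhi.mono hs₀) fun t ht =>
        X.model.covers.lo_lt_hi e t (X.arc.mem_Ioo (hs₀ ht))
    · exact isPreconnected_obetween (hlo.mono hs₂) continuous_lower.continuousOn fun t ht =>
        X.lo_lt_lower (hs₂ ht)
    · exact isPreconnected_obetween continuous_upper.continuousOn (hhi.mono hs₁) fun t ht =>
        X.upper_lt_hi (Ioo_subset_Ico_self ht)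

theorem carving : Carving R (closedDisk (circ S e a ρ)) (circ S e a ρ) where
  isClosed := isClosed_disk
  radius_pos := X.rho_pos
  circ_subset := fun z hz => Metric.sphere_subset_closedBall hz
  isConnected := X.isConnected
  touch := fun z hz hzX => (mem_circ_iff X.rho_pos).2
    (le_antisymm ((mem_closedDisk_iff X.rho_pos).1 hzX) (X.nonneg_of_mem_closure hz))
  meets := ⟨_, X.end_mem_closure (.inl rfl), X.end_mem_circ (.inl rfl)⟩
  meets_old := by
    intro C' hC'
    obtain ⟨z, hz, hzC⟩ := R.meets C' hC'
    by_cases hzX : z ∈ closedDisk (circ S e a ρ)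
    · obtain ⟨-, rfl⟩ := X.corner hz hzX hC' hzC
      exact ⟨_, X.end_mem_closure (.inl rfl), X.end_mem_old (.inl rfl)⟩
    · have := isClosed_disk.isOpen_compl.inter_closure (t := R.domain) ⟨hzX, hz⟩
      rw [inter_comm, ← sdiff_eq] at this
      exact ⟨z, this, hzC⟩
  transverse := by
    intro C' hC' z hz hzS hzC
    obtain ⟨h1, rfl⟩ := X.corner (closure_mono sdiff_subset hz)
      (Metric.sphere_subset_closedBall hzS) hC' hzC
    have hr := R.radius_pos C' hC'
    by_cases h : z = pt x₁ (S.hi e x₁)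
    · refine isCompl_tangentLine_of_ne X.rho_pos hr X.ne_circ.symm (q := pt x₂ (S.hi e x₂)) ?_ hzS
        hzC (X.end_mem_circ (.inr rfl)) (X.end_mem_old (.inr rfl))
      intro hp
      exact X.x₁_lt_x₂.ne (by simpa using congrArg (fun z : Plane => z 0) (h.symm.trans hp))
    · exact isCompl_tangentLine_of_ne X.rho_pos hr X.ne_circ.symm (q := pt x₁ (S.hi e x₁)) h hzS
        hzC (X.end_mem_circ (.inl rfl)) (X.end_mem_old (.inl rfl))
  unique := by
    intro C' hC' C'' hC'' z hz hzS h h'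
    have hK := closure_mono sdiff_subset hz
    have hX := Metric.sphere_subset_closedBall hzS
    rw [(X.corner hK hX hC' h).2, (X.corner hK hX hC'' h').2]

/-- The leftmost point of the new circle lies in the region. -/
theorem leftmost_mem : pt (a - ρ) (S.hi e a) ∈ R.domain := by
  have hρ := X.rho_pos
  have h : a - ρ ∈ Icc α β := ⟨X.left.le, by linarith [X.right]⟩
  have h1 := X.low _ h
  have h2 := X.arc.anti h X.a_mem (by linarith)
  refine X.model.inner e ⟨?_, ?_, ?_⟩ <;> simp only [pt_zero, pt_one]
  exacts [X.arc.mem_Ioo h, by linarith, h2]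

theorem leftmost_mem_circ : pt (a - ρ) (S.hi e a) ∈ circ S e a ρ := by
  rw [mem_circ_iff X.rho_pos, pw_circ, pt_zero, pt_one]
  ring

theorem leftmost_mem_closure :
    pt (a - ρ) (S.hi e a) ∈ closure (R.domain \ closedDisk (circ S e a ρ)) := by
  rw [X.closure_eq]
  refine .inl ⟨subset_closure X.leftmost_mem, ?_⟩
  rintro ⟨-, h, -⟩
  rw [pt_zero] at h
  exact h.1.false

variable (S e a ρ x₁ x₂) in
omit X in
/-- The decomposition of the new region into strips. -/
def data : StripData (T.fork e) :=
  StripData.sprout (T := T.splitPair e) (S.pairData e (a - ρ) x₂ (lower S e a ρ)) (some none) x₁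
    (upper S e a ρ) (S.hi e)

/-- Three singular points are new: the leftmost point of the circle, where the strip divides; the
upper corner, where the upper branch shrinks to a point; and the lower corner, which is passed by
the continuing strip. -/
theorem isModel : (data S e a ρ x₁ x₂).IsModel X.carving.region := by
  have hρ := X.rho_pos
  have hleft := X.left
  have hx₁ := X.x₁_mem
  have hx₂ := X.x₂_mem
  have hlt := X.x₁_lt_x₂
  obtain ⟨hhi, hlo⟩ := X.continuousOn
  have ha₁ : S.x (T.src e) < a - ρ := X.arc.left.trans hleft
  have ha₂ : x₂ < S.x (T.tgt e) := (hx₂.2.trans X.right).trans X.arc.right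
  have hab : a - ρ < x₂ := by linarith [hx₂.1]
  have hsub : Icc (a - ρ) x₂ ⊆ Icc α β := fun t ht => X.sub (X.arc_level ht)
  have hsub₁ : Icc (a - ρ) x₁ ⊆ Icc α β := fun t ht => hsub ⟨ht.1, ht.2.trans hlt.le⟩
  have hll := X.model.covers
  have hpair := hll.pairData ha₁ hab ha₂ (h := lower S e a ρ) continuous_lower.continuousOn
    (fun t ht => X.lo_lt_lower (hsub (Ioo_subset_Icc_self ht))) (fun t ht => by
      rcases ht.2.eq_or_lt with h | h
      · rw [h]
        exact X.eq₂.ge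
      · exact (X.lower_lt_hi ⟨hleft.le.trans ht.1, h⟩).le)
  have hcov : (data S e a ρ x₁ x₂).Covers (closure (R.domain \ closedDisk (circ S e a ρ))) := by
    rw [X.closure_eq]
    refine StripData.Covers.sprout (T := T.splitPair e) hpair (some none) hx₁.1
      continuous_upper.continuousOn (hhi.mono hsub₁)
      (fun t ht => X.upper_lt_hi ⟨(hleft.trans ht.1).le, ht.2⟩) ?_ le_rfl X.eq₁.ge ?_
    · have h := X.lo_lt_lower (hsub (left_mem_Icc.2 hab.le))
      exact h.le.trans (lower_le_upper _)
    · rintro z h0 h1 h2 ⟨hK, hn⟩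
      have h0' : z 0 ∈ Icc (a - ρ) x₂ := ⟨h0.1.le, h0.2.trans hlt.le⟩
      have h3 : lower S e a ρ (z 0) < upper S e a ρ (z 0) := by
        have := arch_pos (t := z 0) ⟨h0.1, by linarith [h0.2, hx₁.2]⟩
        rw [lower, upper]
        linarith
      exact hn ⟨⟨X.arc.mem_Ioo (hsub h0'), (X.lo_lt_lower (hsub h0')).le.trans (h3.le.trans h1), h2⟩,
        ⟨h0.1, h0.2.trans_lt hlt⟩, h3.trans_le h1⟩
  have hends : ∀ t, (t = x₁ ∨ t = x₂) → X.carving.region.IsSingular 0 (pt t (S.hi e t)) :=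
    fun t ht => X.carving.isSingular_of_mem (X.end_mem_closure ht) (X.end_mem_circ ht) X.arc.mem
      (X.end_mem_old ht) X.ne_circ 0
  have hseg₁ : pt x₁ (S.hi e x₁) ∈ (data S e a ρ x₁ x₂).seg none :=
    ⟨pt_zero _ _, X.eq₁.ge.trans_eq (pt_one _ _).symm, (pt_one _ _).le⟩
  have hseg₂ : pt x₂ (S.hi e x₂) ∈ (data S e a ρ x₁ x₂).seg (some none) :=
    ⟨pt_zero _ _, (hll.lo_le_hi e (Ioo_subset_Icc_self (X.arc.mem_Ioo
      (hsub (right_mem_Icc.2 hab.le))))).trans_eq (pt_one _ _).symm, (pt_one _ _).le⟩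
  have hseg₃ : pt (a - ρ) (S.hi e a) ∈ (data S e a ρ x₁ x₂).seg (some (some none)) := by
    have h := hsub (left_mem_Icc.2 hab.le)
    refine ⟨pt_zero _ _, le_trans ?_ (pt_one _ _).ge, (pt_one _ _).le.trans ?_⟩
    · exact (X.low _ h).le.trans (sub_le_self _ hρ.le)
    · exact X.arc.anti.antitoneOn h X.a_mem (by linarith)
  refine ⟨hcov, ?_, ?_, ?_, ?_, ?_⟩
  · rintro (_ | f) z hz
    · exact X.up_subset ⟨⟨hleft.trans hz.1.1, hz.1.2⟩, hz.2⟩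
    · rcases StripData.mem_pairData_ostrip (f := f) ha₁ hab ha₂ hz with h | ⟨g, hg, hge⟩
      · exact X.low_subset ⟨⟨hleft.trans h.1.1, h.1.2⟩, h.2⟩
      · refine ⟨X.model.inner g hg, fun hzX => ?_⟩
        have hzK := subset_closure (X.model.inner g hg)
        have h0 := (X.of_mem hzK hzX).1
        obtain rfl := hll.strip_disj g e z ⟨hg.1, hg.2.1.le, hg.2.2.le⟩ (X.mem_strip hzK hzX)
        rcases hge rfl with h | h
        exacts [h.not_ge h0.1, h.not_ge h0.2]
  · rintro (_ | f)
    · exact ⟨a - ρ, x₁, le_rfl, hx₁.1, le_rfl, X.arc.anti.mono hsub₁⟩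
    -- Below the disk the upper boundary is the lower half circle, which falls only up to its lowest
    -- point at the level `a`.
    · refine StripData.pairData_dec X.model.dec
        ⟨α, a - ρ, X.arc.left.le, hleft, le_rfl, ?_⟩ ⟨a - ρ, a, le_rfl, by linarith, hx₂.1.le, ?_⟩
        ⟨x₂, β, le_rfl, hx₂.2.trans X.right, X.arc.right.le, ?_⟩ f
      · exact X.arc.anti.mono (Icc_subset_Icc_right (by linarith [X.right]))
      · intro s hs t ht hst
        have := strictMonoOn_arch hρ hs ht hst
        simp only [lower]
        linarith
      · exact X.arc.anti.mono (Icc_subset_Icc_left (by linarith [hx₂.1]))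
  · rintro (_ | _ | _ | v)
    · exact ⟨_, hseg₁, hends _ (.inl rfl)⟩
    · exact ⟨_, hseg₂, hends _ (.inr rfl)⟩
    · refine ⟨_, hseg₃, X.carving.isSingular_of_vertical X.leftmost_mem_closure X.leftmost_mem_circ
        (fun C' hC' => X.model.notMem_circ X.leftmost_mem hC') ?_⟩
      simp [circ]
    · obtain ⟨z, hz, hs⟩ := X.model.seg_sing v
      refine ⟨z, hz, (X.carving.isSingular_iff (fun hzX => ?_) 0).2 hs⟩
      exact hll.seg_strip v e z hz (X.mem_strip hs.1.1 hzX)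
  · intro z hz
    by_cases hzX : z ∈ closedDisk (circ S e a ρ)
    · have hzcl : z ∈ closure (R.domain \ closedDisk (circ S e a ρ)) := hz.1.1
      have hzS := X.carving.touch z hzcl hzX
      have hzK : z ∈ closure R.domain := Carving.closure_subset hzcl
      obtain ⟨h0, h1, h2, h3, h4⟩ := X.of_mem hzK hzX
      rcases X.carving.of_isSingular hz hzS with ⟨C', hC', hzC⟩ | hv
      · have h5 := (X.corner hzK hzX hC' hzC).1
        have hz' : z = pt (z 0) (S.hi e (z 0)) := by rw [← h5, pt_eta]
        have h6 := X.arc_level h0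
        -- Strictly between the corners the old arc runs inside the open disk, and before the upper
        -- corner it runs above the disk, so only the corners themselves lie on both circles.
        have h7 : ¬ (lower S e a ρ (z 0) < z 1 ∧ z 1 < upper S e a ρ (z 0)) := by
          rw [← pw_neg_iff h6]
          exact (X.nonneg_of_mem_closure hzcl).not_gt
        rcases lt_trichotomy (z 0) x₁ with h | h | h
        · have := X.gt₁ _ ⟨h0.1, h⟩
          rw [← h5] at this
          exact absurd this h2.not_gt
        · rw [h] at hz'
          exact ⟨none, hz' ▸ hseg₁⟩
        · rcases h0.2.eq_or_lt with h' | h'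
          · rw [h'] at hz'
            exact ⟨some none, hz' ▸ hseg₂⟩
          · have h8 := X.lt₁ _ ⟨h, h6.2⟩
            have h9 := X.gt₂ _ ⟨h0.1, h'⟩
            rw [← h5] at h8 h9
            exact absurd ⟨h9, h8⟩ h7
      · have hv' : z 1 = S.hi e a := by simpa [circ] using hv
        have hpw := (mem_circ_iff X.rho_pos).1 hzS
        rw [pw_circ, hv', sub_self] at hpw
        -- The rightmost point of the circle lies beyond the lower corner, outside the closure of
        -- the region.
        have h5 : z 0 = a - ρ := by
          rcases sq_eq_sq_iff_eq_or_eq_neg.1 (by linarith : (z 0 - a) ^ 2 = ρ ^ 2) with h | h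
          · linarith [h0.2, hx₂.2]
          · linarith
        have hz' : z = pt (a - ρ) (S.hi e a) := plane_ext (by rw [h5, pt_zero])
          (by rw [hv', pt_one])
        exact ⟨some (some none), hz' ▸ hseg₃⟩
    · obtain ⟨v, hv⟩ := X.model.sing_seg z ((X.carving.isSingular_iff hzX 0).1 hz)
      exact ⟨some (some (some v)), hv⟩
  · rintro C' (rfl | hC')
    · exact .inr disjoint_sdiff_left
    · rcases X.model.side C' hC' with h | h
      exacts [.inl (sdiff_subset.trans h), .inr (h.mono_left sdiff_subset)]

theorem mbcc (ε : Smallness) (hr : ρ < ε.radius R (pt a (S.hi e a))) :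
    MBCC ε R X.carving.region := by
  have hb := X.arc.boundary a X.a_mem
  exact ⟨⟨_, hb.1⟩, circ S e a ρ, hb, ⟨C, X.arc.onlyOn a X.a_mem⟩,
    fun i => X.arc.generic a X.a_mem hb.1 i, rfl, X.rho_pos, hr,
    fun h => X.model.notMem_circ X.leftmost_mem h X.leftmost_mem_circ, rfl, rfl⟩

end DiskCut

/-- A fork can be made in an edge by removing a small disk. -/
theorem StripData.IsModel.exists_mbcc {T : FGraph} {S : StripData T} {R : SSRegion}
    (hS : S.IsModel R) (ε : Smallness) (e : T.E) :
    ∃ (R' : SSRegion) (S' : StripData (T.fork e)), MBCC ε R R' ∧ S'.IsModel R' := by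
  obtain ⟨C, σ, α, β, A⟩ := hS.exists_arc e
  have hαβ := A.lt
  set a := (α + β) / 2 with ha
  have hm : a ∈ Ioo α β := ⟨by linarith, by linarith⟩
  obtain ⟨η, hη, hnear⟩ := A.exists_near hS hm one_pos
  obtain ⟨δ, hδ, hball⟩ := hS.covers.exists_ball
    (hS.hi_mem_strip e (A.mem_Ioo (Ioo_subset_Icc_self hm)))
  -- `η` keeps the disk over the generic arc and above the lower boundary, and `δ` keeps it away
  -- from all other cells.
  set M := min (min η δ) (ε.radius R (pt a (S.hi e a))) with hM
  have hMpos : 0 < M := lt_min (lt_min hη hδ) (ε.radius_pos _ _)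
  have hM₁ : M ≤ η := (min_le_left _ _).trans (min_le_left _ _)
  have hM₂ : M ≤ δ := (min_le_left _ _).trans (min_le_right _ _)
  have hM₃ : M ≤ ε.radius R (pt a (S.hi e a)) := min_le_right _ _
  set ρ := M / 2 with hρ
  have hl := (hnear (a - η) ⟨le_rfl, by linarith⟩).1
  have hr := (hnear (a + η) ⟨by linarith, le_rfl⟩).1
  have A' : Arc S R e C σ (a - η) (a + η) := A.mono hl.1.le (by linarith) hr.2.le
  have hsub : Icc (a - ρ) (a + ρ) ⊆ Icc (a - η) (a + η) :=
    Icc_subset_Icc (by linarith) (by linarith)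
  obtain ⟨x₁, hx₁, x₂, hx₂, e₁, e₂, g₁, l₁, g₂, l₂⟩ := exists_corners (by linarith : 0 < ρ)
    ((A'.continuousOn hS).1.mono hsub) (A'.anti.mono hsub)
  have X : DiskCut S R e C σ (a - η) (a + η) a ρ x₁ x₂ :=
    ⟨hS, A', by linarith, by linarith, by linarith, fun t ht =>
      ((hnear a ⟨by linarith, by linarith⟩).2.2 t ht).trans_le (by linarith),
      fun z hz hd => hball z hz (hd.trans_lt (by linarith)), hx₁, hx₂, e₁, e₂, g₁, l₁, g₂, l₂⟩
  exact ⟨_, _, X.mbcc ε (by linarith), X.isModel⟩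

end SSRegions
end

noncomputable section
namespace SSRegions

open Set

/-! ### The unit disk, and the theorem -/

/-- The decomposition of the unit disk into strips. -/
def unitDiskData : StripData FGraph.oneEdge where
  x := fun b : Bool => cond b 1 (-1)
  bot := fun _ => 0
  top := fun _ => 0
  lo := fun _ t => -arch 0 1 t
  hi := fun _ => arch 0 1

theorem pw_unit (z : Plane) : pw ⟨0, 1⟩ z = z 0 ^ 2 + z 1 ^ 2 - 1 := by
  simp [pw]

theorem mem_closure_unitDisk (z : Plane) :
    z ∈ closure unitDisk.domain ↔ z 0 ^ 2 + z 1 ^ 2 ≤ 1 := by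
  have h : closure unitDisk.domain = closedDisk ⟨0, 1⟩ := closure_ball (0 : Plane) one_ne_zero
  rw [h, mem_closedDisk_iff (C := ⟨0, 1⟩) one_pos, pw_unit, sub_nonpos]

theorem mem_unitDisk (z : Plane) : z ∈ unitDisk.domain ↔ z 0 ^ 2 + z 1 ^ 2 < 1 := by
  change z ∈ openDisk ⟨0, 1⟩ ↔ _
  rw [mem_openDisk_iff (C := ⟨0, 1⟩) one_pos, pw_unit, sub_neg]

theorem isSingular_unitDisk (z : Plane) :
    unitDisk.IsSingular 0 z ↔ z 0 ^ 2 = 1 ∧ z 1 = 0 := by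
  have hmem : z ∈ (⟨0, 1⟩ : Circ) ↔ z 0 ^ 2 + z 1 ^ 2 = 1 := by
    rw [mem_circ_iff (C := ⟨0, 1⟩) one_pos, pw_unit, sub_eq_zero]
  constructor
  · rintro ⟨-, h | ⟨S, ⟨rfl, hz, -⟩, hv⟩⟩
    · have : {S | S ∈ unitDisk.circles ∧ z ∈ S} ⊆ {⟨0, 1⟩} := fun S hS => hS.1
      have := ncard_le_ncard this
      rw [h, ncard_singleton] at this
      omega
    · have h1 := (tangent_vertical_iff (C := ⟨0, 1⟩) one_pos hz 0).1 hv
      simp only [sub_zero, PiLp.zero_apply] at h1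
      rw [hmem, h1] at hz
      exact ⟨by linarith, h1⟩
  · rintro ⟨h0, h1⟩
    have hz : z 0 ^ 2 + z 1 ^ 2 = 1 := by rw [h0, h1]; norm_num
    have hzC := hmem.2 hz
    refine ⟨⟨(mem_closure_unitDisk z).2 hz.le, fun h => ((mem_unitDisk z).1 h).ne hz⟩,
      .inr ⟨⟨0, 1⟩, ⟨rfl, hzC, fun T hT _ => hT⟩, ?_⟩⟩
    rw [tangent_vertical_iff (C := ⟨0, 1⟩) one_pos hzC 0]
    simpa using h1

/-- The only singular points are the two ends of the horizontal diameter, whose segments are single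
points, and the upper half circle falls over `Icc 0 1`. -/
theorem unitDiskData_isModel : unitDiskData.IsModel unitDisk := by
  have harch : ∀ t : ℝ, t ∈ Icc (-1 : ℝ) 1 → arch 0 1 t ^ 2 = 1 - t ^ 2 := by
    intro t ht
    have := arch_sq (a := 0) (ρ := 1) (t := t) ⟨by linarith [ht.1], by linarith [ht.2]⟩
    rw [this]
    ring
  have hends : arch 0 1 (-1) = 0 ∧ arch 0 1 1 = 0 := by
    constructor <;> simp [arch]
  have hpos : ∀ t ∈ Ioo (-1 : ℝ) 1, 0 < arch 0 1 t := fun t ht =>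
    arch_pos ⟨by linarith [ht.1], by linarith [ht.2]⟩
  have hle : ∀ z : Plane, z 0 ∈ Icc (-1 : ℝ) 1 →
      (z 0 ^ 2 + z 1 ^ 2 ≤ 1 ↔ -arch 0 1 (z 0) ≤ z 1 ∧ z 1 ≤ arch 0 1 (z 0)) := by
    intro z hz
    have h := harch _ hz
    rw [← abs_le, ← sq_le_sq₀ (abs_nonneg _) (arch_nonneg _ _ _), sq_abs, h]
    constructor <;> intro <;> linarith
  have hseg : ∀ (v : Bool) (z : Plane), z ∈ unitDiskData.seg v ↔ z 0 = cond v 1 (-1) ∧ z 1 = 0 :=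
    fun v z => and_congr_right fun _ => ⟨fun h => le_antisymm h.2 h.1, fun h => ⟨h.ge, h.le⟩⟩
  have hstrip : ∀ (e : Unit) (z : Plane), z ∈ unitDiskData.strip e ↔ z 0 ∈ Ioo (-1 : ℝ) 1 ∧
      -arch 0 1 (z 0) ≤ z 1 ∧ z 1 ≤ arch 0 1 (z 0) := fun _ _ => Iff.rfl
  refine ⟨⟨fun _ => le_rfl, fun _ => ?_, fun _ => (continuous_arch 0 1).neg.continuousOn,
    fun _ => (continuous_arch 0 1).continuousOn, ?_, ?_, ?_, ?_, ?_, ?_, ?_, ?_, ?_⟩,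
    ?_, ?_, ?_, ?_, ?_⟩
  · change (-1 : ℝ) < 1
    norm_num
  · intro _ t ht
    have := hpos t ht
    change -arch 0 1 t < arch 0 1 t
    linarith
  · intro _
    change (0 : ℝ) ≤ -arch 0 1 (-1)
    rw [hends.1, neg_zero]
  · intro _
    exact hends.1.le
  · intro _
    change (0 : ℝ) ≤ -arch 0 1 1
    rw [hends.2, neg_zero]
  · intro _
    exact hends.2.le
  · intro z
    rw [mem_closure_unitDisk]
    constructor
    · intro h
      have h0 := abs_le_of_sq_le_sq' (by nlinarith [sq_nonneg (z 1)] : z 0 ^ 2 ≤ (1 : ℝ) ^ 2)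
        zero_le_one
      have h1 := (hle z h0).1 h
      rcases h0.1.eq_or_lt with h2 | h2
      · rw [← h2, hends.1, neg_zero] at h1
        exact .inl ⟨false, (hseg false z).2 ⟨h2.symm, le_antisymm h1.2 h1.1⟩⟩
      · rcases h0.2.eq_or_lt with h3 | h3
        · rw [h3, hends.2, neg_zero] at h1
          exact .inl ⟨true, (hseg true z).2 ⟨h3, le_antisymm h1.2 h1.1⟩⟩
        · exact .inr ⟨(), (hstrip () z).2 ⟨⟨h2, h3⟩, h1⟩⟩
    · rintro (⟨v, hv⟩ | ⟨e, he⟩)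
      · obtain ⟨h0, h1⟩ := (hseg v z).1 hv
        rw [h0, h1]
        cases v <;> norm_num
      · exact (hle z (Ioo_subset_Icc_self he.1)).2 he.2
  · intro v w z hv hw
    have h := ((hseg v z).1 hv).1.symm.trans ((hseg w z).1 hw).1
    change Bool at v w
    cases v <;> cases w <;> first | rfl | (norm_num at h)
  · exact fun _ _ _ _ _ => rfl
  · intro v e z hv he
    have h0 := ((hseg v z).1 hv).1
    have h1 := ((hstrip e z).1 he).1
    rw [h0] at h1
    change Bool at v
    cases v
    exacts [h1.1.false, h1.2.false]
  · rintro e z ⟨h0, h1, h2⟩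
    rw [mem_unitDisk]
    have h := harch _ (Ioo_subset_Icc_self h0)
    have h3 := sq_lt_sq' h1 h2
    change z 1 ^ 2 < arch 0 1 (z 0) ^ 2 at h3
    linarith
  · intro e
    refine ⟨0, 1, ?_, one_pos, le_rfl, ?_⟩
    · change (-1 : ℝ) ≤ 0
      norm_num
    · have := strictAntiOn_arch (a := 0) one_pos
      rwa [zero_add] at this
  · intro v
    refine ⟨pt (cond v 1 (-1)) 0, (hseg v _).2 ⟨pt_zero _ _, pt_one _ _⟩, ?_⟩
    rw [isSingular_unitDisk, pt_zero, pt_one]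
    change Bool at v
    cases v <;> norm_num
  · intro z hz
    obtain ⟨h0, h1⟩ := (isSingular_unitDisk z).1 hz
    rcases sq_eq_sq_iff_eq_or_eq_neg.1 (h0.trans (one_pow 2).symm) with h | h
    · exact ⟨true, (hseg true z).2 ⟨h, h1⟩⟩
    · exact ⟨false, (hseg false z).2 ⟨h, h1⟩⟩
  · rintro C rfl
    exact .inl Subset.rfl

theorem FGraph.Buildable.exists_model (ε : Smallness) {T : FGraph} (h : T.Buildable) :
    ∃ (R : SSRegion) (S : StripData T), Obtainable ε R ∧ S.IsModel R := by
  induction h with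
  | base => exact ⟨_, _, .refl, unitDiskData_isModel⟩
  | pair G e _ ih =>
    obtain ⟨R, S, hR, hS⟩ := ih
    obtain ⟨R', S', h, hS'⟩ := hS.exists_sscc ε e
    exact ⟨R', S', hR.tail (.inr h), hS'⟩
  | fork G e _ ih =>
    obtain ⟨R, S, hR, hS⟩ := ih
    obtain ⟨R', S', h, hS'⟩ := hS.exists_mbcc ε e
    exact ⟨R', S', hR.tail (.inl h), hS'⟩
  | iso G H φ _ ih =>
    obtain ⟨R, S, hR, hS⟩ := ih
    exact ⟨R, S.map φ, hR, hS.map φ⟩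

end SSRegions
end

open SSRegions in
theorem theorem2 (G : PiecedGraph) (hG : G.IsStage) (hdone : ∀ v : G.V, G.degree v ≠ 2)
    (m : G.E → ℕ) (hm : G.Admissible m) (ε : Smallness) :
    (G.subdivide m).IsTree ∧
      ∃ R : SSRegion, Obtainable ε R ∧ HasPoincareReebGraph R (G.subdivide m) := by
  obtain ⟨hT, hB⟩ := PiecedGraph.isTree_and_buildable hG hdone hm
  obtain ⟨R, S, hR, hS⟩ := hB.exists_model ε
  exact ⟨hT, R, hR, hS.covers.hasPoincareReebGraph hS.seg_sing hS.sing_seg⟩
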